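/- Let $d\ge 1$ and let $\mu$ be a compactly supported positive Borel measure on $\mathbb R^d$. For $t>0$ let $\mu_t$ be the dilated measure, $\int \phi\,d\mu_t=\int \phi(ty)\,d\mu(y)$, and put $(f*\mu_t)(x)=\int f(x-ty)\,d\mu(y)$ and $M_\mu f(x)=\sup_{t>0}|(f*\mu_t)(x)|$. Suppose that for some constant $C_0$ and real numbers $a>\frac12$ and $d-1<b\le d$ we have $|\widehat\mu(\xi)|\le C_0|\xi|^{-a}$ for all $\xi\in\mathbb R^d\setminus\{0\}$, where $\widehat\mu(\xi)=\int e^{-2\pi i x\cdot\xi}\,d\mu(x)$, and $\mu(B(x,r))\le C_0 r^{b}$ for all $x\in\mathbb R^d$ and $r>0$. Let $$p_{(a,b)}=\frac{2(d-b)+2a-1}{d-b+2a-1}.$$ Then: (i) for every $p$ with $p_{(a,b)}<p\le\infty$ there is a constant $C$ such that $\|M_\mu f\|_{L^p(\mathbb R^d)}\le C\|f\|_{L^p(\mathbb R^d)}$ for all $f\in L^p(\mathbb R^d)$; (ii) there is a constant $C$ such that, with $p=p_{(a,b)}$, $\|M_\mu f\|_{L^{p,\infty}(\mathbb R^d)}\le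 C\|f\|_{L^{p,1}(\mathbb R^d)}$ for all $f\in L^{p,1}(\mathbb R^d)$, where $\|f\|_{L^{p,1}}=p\int_0^\infty |\{|f|>s\}|^{1/p}\,ds$ and $\|g\|_{L^{p,\infty}}=\sup_{s>0}s\,|\{|g|>s\}|^{1/p}$. In both cases, for almost every $x$ the integrals $(f*\mu_t)(x)$, $t>0$, all converge absolutely, and $M_\mu f$ is Lebesgue measurable. -/

import Mathlib

open MeasureTheory Set
open scoped ENNReal NNReal

noncomputable section

namespace DilationMaximal

/-- The Fourier transform `μ̂(ξ) = ∫ exp(-2πi x·ξ) dμ(x)` of a measure on `ℝᵈ`. -/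
def measureFourier {d : ℕ} (μ : Measure (EuclideanSpace ℝ (Fin d)))
    (ξ : EuclideanSpace ℝ (Fin d)) : ℂ :=
  ∫ x, Complex.exp (-(2 * Real.pi * (inner ℝ x ξ : ℝ) : ℝ) * Complex.I) ∂μ

/-- Fourier decay of order `a`: `|μ̂(ξ)| ≤ C |ξ|^{-a}` for all `ξ ≠ 0`, for some constant `C`. -/
def HasFourierDecay {d : ℕ} (μ : Measure (EuclideanSpace ℝ (Fin d))) (a : ℝ) : Prop :=
  ∃ C : ℝ, ∀ ξ : EuclideanSpace ℝ (Fin d), ξ ≠ 0 → ‖measureFourier μ ξ‖ ≤ C * ‖ξ‖ ^ (-a)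

/-- The Frostman condition of order `b`: `μ(B(x,r)) ≤ C r^b` for all `x` and all `r > 0`, for some
constant `C`. -/
def IsFrostman {d : ℕ} (μ : Measure (EuclideanSpace ℝ (Fin d))) (b : ℝ) : Prop :=
  ∃ C : ℝ, ∀ x : EuclideanSpace ℝ (Fin d), ∀ r : ℝ, 0 < r →
    μ (Metric.ball x r) ≤ ENNReal.ofReal (C * r ^ b)

/-- The dilation `μ_t` of a measure: `∫ φ dμ_t = ∫ φ(t y) dμ(y)`. -/
def dilate {d : ℕ} (μ : Measure (EuclideanSpace ℝ (Fin d))) (t : ℝ) :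
    Measure (EuclideanSpace ℝ (Fin d)) :=
  μ.map (fun y => t • y)

/-- The convolution `(f ∗ ν)(x) = ∫ f(x - y) dν(y)` of a function with a measure. -/
def convMeasure {d : ℕ} (f : EuclideanSpace ℝ (Fin d) → ℂ)
    (ν : Measure (EuclideanSpace ℝ (Fin d))) (x : EuclideanSpace ℝ (Fin d)) : ℂ :=
  ∫ y, f (x - y) ∂ν

/-- The maximal function `M_μ f(x) = sup_{t > 0} |(f ∗ μ_t)(x)|`, with values in `[0, ∞]`. -/
def maximalFn {d : ℕ} (μ : Measure (EuclideanSpace ℝ (Fin d)))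
    (f : EuclideanSpace ℝ (Fin d) → ℂ) (x : EuclideanSpace ℝ (Fin d)) : ℝ≥0∞ :=
  ⨆ (t : ℝ) (_ : 0 < t), ‖convMeasure f (dilate μ t) x‖ₑ

/-- All the integrals that define `M_μ f(x)` converge absolutely at almost every `x`. -/
def MaximalFnDefinedAE {d : ℕ} (μ : Measure (EuclideanSpace ℝ (Fin d)))
    (f : EuclideanSpace ℝ (Fin d) → ℂ) : Prop :=
  ∀ᵐ x : EuclideanSpace ℝ (Fin d), ∀ t : ℝ, 0 < t →
    Integrable (fun y => f (x - y)) (dilate μ t)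

/-- The Lorentz norm `‖f‖_{L^{p,1}} = p ∫_0^∞ |{|f| > s}|^{1/p} ds`. -/
def lorentzNormOne {α ε : Type*} [MeasurableSpace α] [ENorm ε] (f : α → ε) (p : ℝ)
    (ν : Measure α) : ℝ≥0∞ :=
  ENNReal.ofReal p * ∫⁻ s in Ioi (0 : ℝ), ν {x | ENNReal.ofReal s < ‖f x‖ₑ} ^ (1 / p)

/-- The Lorentz (weak `L^p`) quasinorm `‖f‖_{L^{p,∞}} = sup_{s > 0} s |{|f| > s}|^{1/p}`. -/
def lorentzNormTop {α ε : Type*} [MeasurableSpace α] [ENorm ε] (f : α → ε) (p : ℝ)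
    (ν : Measure α) : ℝ≥0∞ :=
  ⨆ (s : ℝ) (_ : 0 < s), ENNReal.ofReal s * ν {x | ENNReal.ofReal s < ‖f x‖ₑ} ^ (1 / p)

/-- The critical exponent `p_{(a,b)} = (2(d-b) + 2a - 1) / (d - b + 2a - 1)`. -/
def critExp (d : ℕ) (a b : ℝ) : ℝ :=
  (2 * ((d : ℝ) - b) + 2 * a - 1) / ((d : ℝ) - b + 2 * a - 1)

end DilationMaximal

end

/-!
The maximal function is split at each scale according to frequency. Write `n` for the dimension and
let `f` be a Schwartz function. Averaging `f` over the dilate `μ_t` is the Fourier multiplier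
operator with symbol `μ̂(t ξ)`; a cutoff `χ(s t ξ)` splits this symbol at the threshold `1 / s`.

* The low frequency part is a convolution with `μ` smoothed out at scale `t s`. By the Frostman
  condition the smoothed measure has, for `t = 1`, density `O(s ^ (b - n))` and is concentrated
  in a ball of radius comparable to `t`, so this part is at most `C s ^ (b - n)` times the Hardy–Littlewood
  maximal function (`exists_enorm_lowFrequency_le`).
* The high frequency part is bounded on `L²`. The fundamental theorem of calculus in `t` controls
  the square of the supremum by the integral over `t` of the multiplier times its radial derivative
  (`lintegral_iSup_dilatedMultiplier_sq_le`). These decay like `|ξ| ^ (-a)` and `|ξ| ^ (1 - a)`, so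
  that the annulus `|ξ| ∼ 1 / s` contributes `C s ^ (2 a - 1)` to the square of the norm
  (`exists_lintegral_iSup_highFrequency_sq_le`); as `2 a > 1`, the dyadic annuli beyond `1 / s` sum
  to a bound of the same form (`exists_volume_lt_iSup_le`).

Applied to an approximate indicator function of a set `E`, the two bounds give
`|{M 1_E > λ}| ≤ C (s ^ (b - n) / λ + s ^ (2 a - 1) / λ ^ 2) |E|`, and the best choice of `s` is a
restricted weak-type inequality at exactly the exponent `p = p_(a,b)`
(`restrictedWeakType_of_decay`).

Except at the endpoint `p = 1`, the remaining arguments use only this inequality. Decomposing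
a function into its dyadic level sets gives the strong-type inequalities for exponents above `p`
(`RestrictedWeakType.exists_volume_lt_le_tsum`, `lintegral_rpow_le_of_measure_lt_le`). For `p > 1`
weak `L^p` is normable and the level sets may be summed at the endpoint as well
(`RestrictedWeakType.lorentzWeakType`). The case `p = 1` occurs only for `b = n`, when `μ` has
a bounded density and the maximal operator is dominated by the Hardy–Littlewood one
(`lorentzWeakType_one`). Convergence and measurability follow from these inequalities by
approximation with functions whose averages are continuous in `t`
(`HasContinuousAverages.of_tendsto`, `HasContinuousAverages.aemeasurable_iSup`).
-/

noncomputable section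

namespace DilationMaximal

open Metric Filter Topology

/-! ### The Hardy–Littlewood maximal function -/

section HardyLittlewood

variable {V : Type*} [NormedAddCommGroup V] [InnerProductSpace ℝ V] [FiniteDimensional ℝ V]
  [MeasurableSpace V] [BorelSpace V]

/-- The centred Hardy–Littlewood maximal function, for functions with values in `[0, ∞]`. -/
def hlMaximal (f : V → ℝ≥0∞) (x : V) : ℝ≥0∞ :=
  ⨆ (r : ℝ) (_ : 0 < r), (∫⁻ y in ball x r, f y) / volume (ball x r)

theorem setLIntegral_ball_le_hlMaximal (f : V → ℝ≥0∞) (x : V) {r : ℝ} (hr : 0 < r) :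
    ∫⁻ y in ball x r, f y ≤ volume (ball x r) * hlMaximal f x := by
  have h1 : (∫⁻ y in ball x r, f y) / volume (ball x r) ≤ hlMaximal f x :=
    le_iSup₂ (f := fun (r : ℝ) (_ : 0 < r) => (∫⁻ y in ball x r, f y) / volume (ball x r)) r hr
  rw [ENNReal.div_le_iff (measure_ball_pos _ _ hr).ne' measure_ball_lt_top.ne] at h1
  rwa [mul_comm]

/-- The weak type `(1,1)` inequality, from the Vitali covering lemma applied to balls of
bounded radius. -/
theorem volume_lt_hlMaximal_le (f : V → ℝ≥0∞) {c : ℝ≥0∞} (hc0 : c ≠ 0) (hc : c ≠ ∞) :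
    volume {x | c < hlMaximal f x} ≤ 4 ^ Module.finrank ℝ V * (∫⁻ y, f y) / c := by
  set S : ℕ → Set V := fun n =>
    {x | ∃ r : ℝ, 0 < r ∧ r ≤ n ∧ c * volume (ball x r) ≤ ∫⁻ y in ball x r, f y} with hS
  have hsub : {x | c < hlMaximal f x} ⊆ ⋃ n, S n := by
    intro x hx
    simp only [hlMaximal, mem_ofPred_eq, lt_iSup_iff] at hx
    obtain ⟨r, hr, hx⟩ := hx
    obtain ⟨n, hn⟩ := exists_nat_ge r
    refine mem_iUnion.2 ⟨n, r, hr, hn, ?_⟩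
    rw [ENNReal.lt_div_iff_mul_lt (Or.inl (measure_ball_pos _ _ hr).ne')
      (Or.inl measure_ball_lt_top.ne)] at hx
    exact hx.le
  have hmono : Monotone S := by
    rintro m n hmn x ⟨r, hr, hrm, h⟩
    exact ⟨r, hr, hrm.trans (by exact_mod_cast hmn), h⟩
  refine (measure_mono hsub).trans ?_
  rw [hmono.measure_iUnion]
  refine iSup_le fun n => ?_
  choose! ρ hρ0 hρn hρ using fun x (hx : x ∈ S n) => hx
  obtain ⟨u, huS, hdisj, hcov⟩ := Vitali.exists_disjoint_subfamily_covering_enlargement_ball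
    (S n) id ρ n hρn 4 (by norm_num)
  have hucount : u.Countable := hdisj.countable_of_isOpen (fun _ _ => isOpen_ball)
    fun x hx => ⟨x, mem_ball_self (hρ0 x (huS hx))⟩
  have hcov' : S n ⊆ ⋃ b ∈ u, ball b (4 * ρ b) := by
    intro x hx
    obtain ⟨b, hb, h⟩ := hcov x hx
    exact mem_iUnion₂.2 ⟨b, hb, h (mem_ball_self (hρ0 x hx))⟩
  rw [ENNReal.le_div_iff_mul_le (Or.inl hc0) (Or.inl hc), mul_comm]
  have := hucount.to_subtype
  calc c * volume (S n) ≤ c * ∑' b : u, volume (ball (b : V) (4 * ρ b)) := by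
        gcongr
        refine (measure_mono hcov').trans ?_
        rw [biUnion_eq_iUnion]
        exact measure_iUnion_le _
    _ = ∑' b : u, 4 ^ Module.finrank ℝ V * (c * volume (ball (b : V) (ρ b))) := by
        rw [← ENNReal.tsum_mul_left]
        refine tsum_congr fun b => ?_
        rw [Measure.addHaar_ball_mul_of_pos _ _ (by norm_num),
          Measure.addHaar_ball_center _ (b : V) (ρ b), ENNReal.ofReal_pow (by norm_num)]
        simp only [ENNReal.ofReal_ofNat]
        ring
    _ ≤ ∑' b : u, 4 ^ Module.finrank ℝ V * ∫⁻ y in ball (b : V) (ρ b), f y := by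
        gcongr with b
        exact hρ b (huS b.2)
    _ = 4 ^ Module.finrank ℝ V * ∫⁻ y in ⋃ b ∈ u, ball b (ρ b), f y := by
        rw [ENNReal.tsum_mul_left, lintegral_biUnion hucount (fun _ _ => measurableSet_ball)
          (show u.PairwiseDisjoint fun a => ball a (ρ a) from hdisj)]
    _ ≤ 4 ^ Module.finrank ℝ V * ∫⁻ y, f y := by
        gcongr
        exact Measure.restrict_le_self

end HardyLittlewood

end DilationMaximal

end

noncomputable section

namespace DilationMaximal

open Metric Filter Topology FourierTransform

/-! ### Maximal functions of dilated Fourier multipliers -/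

section Multiplier

/-- A one-dimensional Sobolev inequality for the multiplicative Haar measure `dt / t`: `G` stands
for `t F'(t)`, and `δ` balances the two terms. -/
theorem enorm_sq_le_lintegral_of_hasDerivAt {F G : ℝ → ℂ} {δ : ℝ} (hδ : 0 < δ)
    (hF : ∀ t : ℝ, 0 < t → HasDerivAt F ((t : ℂ)⁻¹ * G t) t) (hG : Continuous G)
    (h0 : Tendsto F (𝓝[>] 0) (𝓝 0)) {T : ℝ} (hT : 0 < T) :
    ‖F T‖ₑ ^ 2 ≤ ∫⁻ t in Ioi (0 : ℝ),
      (ENNReal.ofReal δ⁻¹ * ‖F t‖ₑ ^ 2 + ENNReal.ofReal δ * ‖G t‖ₑ ^ 2) * ENNReal.ofReal t⁻¹ := by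
  set I := ∫⁻ t in Ioi (0 : ℝ),
    (ENNReal.ofReal δ⁻¹ * ‖F t‖ₑ ^ 2 + ENNReal.ofReal δ * ‖G t‖ₑ ^ 2) * ENNReal.ofReal t⁻¹ with hI
  have hFc : ContinuousOn F (Ioi 0) := fun t ht => (hF t ht).continuousAt.continuousWithinAt
  have key : ∀ ε, 0 < ε → ε < T → ‖F T‖ₑ ^ 2 ≤ ‖F ε‖ₑ ^ 2 + I := by
    intro ε hε hεT
    have hsub : uIcc ε T ⊆ Ioi 0 := by
      rw [uIcc_of_le hεT.le]; exact fun t ht => hε.trans_le ht.1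
    have hd : ∀ t ∈ uIcc ε T,
        HasDerivAt (fun t => ‖F t‖ ^ 2) (2 * inner ℝ (F t) ((t : ℂ)⁻¹ * G t)) t :=
      fun t ht => (hF t (hsub ht)).norm_sq
    have hFc' := hFc.mono hsub
    have hinv : ContinuousOn (fun t : ℝ => (t : ℂ)⁻¹) (uIcc ε T) := by
      refine ContinuousOn.inv₀ (by fun_prop) fun t ht => ?_
      exact_mod_cast (hsub ht : (0 : ℝ) < t).ne'
    have hinv' : ContinuousOn (fun t : ℝ => t⁻¹) (uIcc ε T) :=
      ContinuousOn.inv₀ (by fun_prop) fun t ht => (hsub ht : (0 : ℝ) < t).ne'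
    have hint : IntervalIntegrable (fun t => 2 * inner ℝ (F t) ((t : ℂ)⁻¹ * G t)) volume ε T := by
      refine ContinuousOn.intervalIntegrable ?_
      exact continuousOn_const.mul (hFc'.inner (𝕜 := ℝ) (hinv.mul hG.continuousOn))
    have hint2 : ContinuousOn (fun t => (δ⁻¹ * ‖F t‖ ^ 2 + δ * ‖G t‖ ^ 2) * t⁻¹) (uIcc ε T) :=
      ((continuousOn_const.mul (hFc'.norm.pow 2)).add
        (continuousOn_const.mul (hG.continuousOn.norm.pow 2))).mul hinv'
    have h1 := intervalIntegral.integral_eq_sub_of_hasDerivAt hd hint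
    have h2 : ∫ t in ε..T, 2 * inner ℝ (F t) ((t : ℂ)⁻¹ * G t) ≤
        ∫ t in ε..T, (δ⁻¹ * ‖F t‖ ^ 2 + δ * ‖G t‖ ^ 2) * t⁻¹ := by
      refine intervalIntegral.integral_mono_on hεT.le hint hint2.intervalIntegrable fun t ht => ?_
      have ht0 : 0 < t := hε.trans_le ht.1
      have h3 : inner ℝ (F t) ((t : ℂ)⁻¹ * G t) ≤ ‖F t‖ * (t⁻¹ * ‖G t‖) := by
        refine (real_inner_le_norm _ _).trans (le_of_eq ?_)
        rw [norm_mul, norm_inv, Complex.norm_real, Real.norm_of_nonneg ht0.le]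
      have h4 : 2 * (‖F t‖ * ‖G t‖) ≤ δ⁻¹ * ‖F t‖ ^ 2 + δ * ‖G t‖ ^ 2 := by
        have h5 : δ⁻¹ * ‖F t‖ ^ 2 + δ * ‖G t‖ ^ 2 - 2 * (‖F t‖ * ‖G t‖)
            = δ⁻¹ * (‖F t‖ - δ * ‖G t‖) ^ 2 := by field_simp; ring
        nlinarith [mul_nonneg (inv_nonneg.2 hδ.le) (sq_nonneg (‖F t‖ - δ * ‖G t‖))]
      calc 2 * inner ℝ (F t) ((t : ℂ)⁻¹ * G t) ≤ (2 * (‖F t‖ * ‖G t‖)) * t⁻¹ := by linarith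
        _ ≤ _ := by gcongr
    have h6 : ‖F T‖ ^ 2 ≤ ‖F ε‖ ^ 2 + ∫ t in ε..T, (δ⁻¹ * ‖F t‖ ^ 2 + δ * ‖G t‖ ^ 2) * t⁻¹ := by
      linarith
    have hnn : ∀ t ∈ Ioc ε T, 0 ≤ (δ⁻¹ * ‖F t‖ ^ 2 + δ * ‖G t‖ ^ 2) * t⁻¹ := by
      intro t ht
      have : 0 < t := hε.trans ht.1
      positivity
    have h7 : ENNReal.ofReal (∫ t in ε..T, (δ⁻¹ * ‖F t‖ ^ 2 + δ * ‖G t‖ ^ 2) * t⁻¹) ≤ I := by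
      rw [intervalIntegral.integral_of_le hεT.le, ofReal_integral_eq_lintegral_ofReal
        ((intervalIntegrable_iff_integrableOn_Ioc_of_le hεT.le).1 hint2.intervalIntegrable)
        ((ae_restrict_iff' measurableSet_Ioc).2 (ae_of_all _ hnn))]
      refine (setLIntegral_mono' measurableSet_Ioc fun t ht => ?_).trans
        (lintegral_mono_set fun t ht => hε.trans ht.1)
      have : 0 < t := hε.trans ht.1
      rw [ENNReal.ofReal_mul (by positivity), ENNReal.ofReal_add (by positivity) (by positivity),
        ENNReal.ofReal_mul (by positivity), ENNReal.ofReal_mul (by positivity),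
        ENNReal.ofReal_pow (norm_nonneg _), ENNReal.ofReal_pow (norm_nonneg _), ofReal_norm,
        ofReal_norm]
    calc ‖F T‖ₑ ^ 2 = ENNReal.ofReal (‖F T‖ ^ 2) := by
          rw [ENNReal.ofReal_pow (norm_nonneg _), ofReal_norm]
      _ ≤ ENNReal.ofReal (‖F ε‖ ^ 2 + ∫ t in ε..T, (δ⁻¹ * ‖F t‖ ^ 2 + δ * ‖G t‖ ^ 2) * t⁻¹) :=
          ENNReal.ofReal_le_ofReal h6
      _ ≤ ENNReal.ofReal (‖F ε‖ ^ 2) + I := ENNReal.ofReal_add_le.trans (by gcongr)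
      _ = _ := by rw [ENNReal.ofReal_pow (norm_nonneg _), ofReal_norm]
  have hlim : Tendsto (fun ε => ‖F ε‖ₑ ^ 2 + I) (𝓝[>] 0) (𝓝 (‖(0 : ℂ)‖ₑ ^ 2 + I)) :=
    ((ENNReal.continuous_pow 2).tendsto _ |>.comp h0.enorm).add_const I
  have := ge_of_tendsto hlim (by
    filter_upwards [Ioo_mem_nhdsGT hT] with ε hε using key ε hε.1 hε.2)
  simpa using this

variable {V : Type*} [NormedAddCommGroup V] [InnerProductSpace ℝ V]

/-- The radial derivative of a multiplier. -/
def radialDeriv (Φ : V → ℂ) (η : V) : ℂ := fderiv ℝ Φ η η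

theorem contDiff_radialDeriv {Φ : V → ℂ} (hΦ : ContDiff ℝ (⊤ : ℕ∞) Φ) :
    ContDiff ℝ (⊤ : ℕ∞) (radialDeriv Φ) :=
  (hΦ.fderiv_right (m := (⊤ : ℕ∞)) (by simp)).clm_apply contDiff_id

theorem radialDeriv_eq_zero {Φ : V → ℂ} {r R : ℝ}
    (hsupp : ∀ η, ‖η‖ < r ∨ R < ‖η‖ → Φ η = 0) (η : V) (hη : ‖η‖ < r ∨ R < ‖η‖) :
    radialDeriv Φ η = 0 := by
  have ho : IsOpen {η : V | ‖η‖ < r ∨ R < ‖η‖} :=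
    (isOpen_lt continuous_norm continuous_const).union (isOpen_lt continuous_const continuous_norm)
  have : Φ =ᶠ[𝓝 η] fun _ => 0 := by
    filter_upwards [ho.mem_nhds hη] with ζ hζ using hsupp ζ hζ
  simp [radialDeriv, this.fderiv_eq]

/-- `∫ dt / t` over those `t` for which `t|ξ|` lies in `[r, 4r]` is at most `3`. -/
theorem lintegral_dilation_annulus_le {r : ℝ} (hr : 0 < r) (ξ : V) {H : V → ℝ≥0∞} {K : ℝ≥0∞}
    (hH : ∀ η, H η ≤ K) (hsupp : ∀ η, ‖η‖ < r ∨ 4 * r < ‖η‖ → H η = 0) :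
    ∫⁻ t in Ioi (0 : ℝ), H (t • ξ) * ENNReal.ofReal t⁻¹ ≤ 3 * K := by
  rcases eq_or_ne ξ 0 with rfl | hξ
  · simp [hsupp 0 (Or.inl (by simpa using hr))]
  have hξ' : 0 < ‖ξ‖ := norm_pos_iff.2 hξ
  calc ∫⁻ t in Ioi (0 : ℝ), H (t • ξ) * ENNReal.ofReal t⁻¹
      ≤ ∫⁻ t in Ioi (0 : ℝ), (Icc (r / ‖ξ‖) (4 * r / ‖ξ‖)).indicator
          (fun _ => K * ENNReal.ofReal (‖ξ‖ / r)) t := by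
        refine setLIntegral_mono' measurableSet_Ioi fun t ht => ?_
        have ht' : (0 : ℝ) < t := ht
        by_cases hmem : t ∈ Icc (r / ‖ξ‖) (4 * r / ‖ξ‖)
        · rw [indicator_of_mem hmem]
          gcongr
          · exact hH _
          · rw [inv_le_comm₀ ht' (by positivity), inv_div]
            exact hmem.1
        · rw [hsupp, zero_mul]
          · exact zero_le
          · rw [norm_smul, Real.norm_of_nonneg ht'.le]
            by_contra! hcon
            exact hmem ⟨(div_le_iff₀ hξ').2 hcon.1, (le_div_iff₀ hξ').2 hcon.2⟩
    _ ≤ ∫⁻ t, (Icc (r / ‖ξ‖) (4 * r / ‖ξ‖)).indicator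
          (fun _ => K * ENNReal.ofReal (‖ξ‖ / r)) t := setLIntegral_le_lintegral _ _
    _ = 3 * K := by
        rw [lintegral_indicator measurableSet_Icc, setLIntegral_const, Real.volume_Icc, mul_assoc,
          ← ENNReal.ofReal_mul (by positivity)]
        have : ‖ξ‖ / r * (4 * r / ‖ξ‖ - r / ‖ξ‖) = 3 := by field_simp; ring
        rw [this, mul_comm]
        simp

variable [FiniteDimensional ℝ V]

theorem hasCompactSupport_of_norm {Φ : V → ℂ} {r R : ℝ}
    (hsupp : ∀ η, ‖η‖ < r ∨ R < ‖η‖ → Φ η = 0) : HasCompactSupport Φ := by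
  refine HasCompactSupport.intro (isCompact_closedBall (0 : V) R) fun η hη => hsupp η (Or.inr ?_)
  simpa using hη

theorem exists_cutoff (R : ℝ) (hR : 0 < R) : ∃ χ : SchwartzMap V ℂ,
    (∀ η, ‖η‖ ≤ R → χ η = 1) ∧ (∀ η, 2 * R ≤ ‖η‖ → χ η = 0) ∧ HasCompactSupport χ := by
  let c : ContDiffBump (0 : V) := ⟨R, 2 * R, hR, by linarith⟩
  have hs : HasCompactSupport fun η => (c η : ℂ) :=
    c.hasCompactSupport.comp_left (g := fun r : ℝ => (r : ℂ)) (by simp)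
  have hd : ContDiff ℝ (⊤ : ℕ∞) fun η => (c η : ℂ) := Complex.ofRealCLM.contDiff.comp c.contDiff
  refine ⟨hs.toSchwartzMap hd, fun η hη => ?_, fun η hη => ?_, hs⟩
  · change (c η : ℂ) = 1
    rw [c.one_of_mem_closedBall (by simpa using hη)]
    simp
  · change (c η : ℂ) = 0
    rw [c.zero_of_le_dist (by simpa using hη)]
    simp

variable [MeasurableSpace V] [BorelSpace V]

/-- The function whose Fourier transform is `ξ ↦ h ξ * Φ (t ξ)`. -/
def dilatedMultiplier (h Φ : V → ℂ) (t : ℝ) : V → ℂ :=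
  𝓕⁻ fun ξ => h ξ * Φ (t • ξ)

theorem dilatedMultiplier_apply (h Φ : V → ℂ) (t : ℝ) (x : V) :
    dilatedMultiplier h Φ t x = ∫ ξ, (𝐞 (inner ℝ ξ x) : ℂ) * (h ξ * Φ (t • ξ)) := by
  simp [dilatedMultiplier, Real.fourierInv_eq, Circle.smul_def]

theorem continuous_dilatedMultiplier {h Φ : V → ℂ} (hh : Integrable h) (hhc : Continuous h)
    (hΦ : Continuous Φ) {A : ℝ} (hA : ∀ η, ‖Φ η‖ ≤ A) :
    Continuous fun p : ℝ × V => dilatedMultiplier h Φ p.1 p.2 := by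
  simp_rw [dilatedMultiplier_apply]
  refine continuous_of_dominated (bound := fun ξ => ‖h ξ‖ * A) (fun p => ?_) (fun p => ?_)
    (hh.norm.mul_const A) ?_
  · refine Continuous.aestronglyMeasurable ?_
    have := Real.continuous_fourierChar
    fun_prop
  · refine ae_of_all _ fun ξ => ?_
    rw [norm_mul, Circle.norm_coe, one_mul, norm_mul]
    gcongr
    exact hA _
  · refine ae_of_all _ fun ξ => ?_
    have := Real.continuous_fourierChar
    fun_prop

theorem tendsto_dilatedMultiplier {ι : Type*} {l : Filter ι} [l.IsCountablyGenerated]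
    {h : V → ℂ} (hh : Integrable h)
    {Φ : ι → V → ℂ} (hΦ : ∀ i, Continuous (Φ i)) {A : ℝ} (hA : ∀ i η, ‖Φ i η‖ ≤ A)
    {Φ' : V → ℂ} {t : ι → ℝ} {t' : ℝ}
    (hlim : ∀ ξ, Tendsto (fun i => Φ i (t i • ξ)) l (𝓝 (Φ' (t' • ξ)))) (x : V) :
    Tendsto (fun i => dilatedMultiplier h (Φ i) (t i) x) l (𝓝 (dilatedMultiplier h Φ' t' x)) := by
  simp_rw [dilatedMultiplier_apply]
  refine tendsto_integral_filter_of_dominated_convergence (fun ξ => ‖h ξ‖ * A)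
    (Eventually.of_forall fun i => ?_) (Eventually.of_forall fun i => ae_of_all _ fun ξ => ?_)
    (hh.norm.mul_const A) (ae_of_all _ fun ξ => ?_)
  · have := Real.continuous_fourierChar
    refine AEStronglyMeasurable.mul ?_ (hh.aestronglyMeasurable.mul ?_)
    · exact Continuous.aestronglyMeasurable (by fun_prop)
    · exact ((hΦ i).comp (by fun_prop)).aestronglyMeasurable
  · rw [norm_mul, Circle.norm_coe, one_mul, norm_mul]
    gcongr
    exact hA _ _
  · exact ((hlim ξ).const_mul _).const_mul _

theorem lintegral_enorm_fourier_sq (f : SchwartzMap V ℂ) :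
    ∫⁻ ξ, ‖(𝓕 f : SchwartzMap V ℂ) ξ‖ₑ ^ 2 = ∫⁻ x, ‖f x‖ₑ ^ 2 := by
  have h3 : ∀ Q : SchwartzMap V ℂ, ∫⁻ x, ‖Q x‖ₑ ^ 2 = ENNReal.ofReal (∫ x, ‖Q x‖ ^ 2) := by
    intro Q
    rw [ofReal_integral_eq_lintegral_ofReal]
    · refine lintegral_congr fun x => ?_
      rw [ENNReal.ofReal_pow (norm_nonneg _), ofReal_norm]
    · exact (memLp_two_iff_integrable_sq_norm Q.continuous.aestronglyMeasurable).1 (Q.memLp 2)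
    · exact ae_of_all _ fun x => by positivity
  rw [h3, h3, SchwartzMap.integral_norm_sq_fourier]

/-- Plancherel's identity for a smooth compactly supported frequency cut-off. -/
theorem lintegral_enorm_dilatedMultiplier_sq (h : SchwartzMap V ℂ) {Φ : V → ℂ}
    (hΦ : ContDiff ℝ (⊤ : ℕ∞) Φ) (hΦc : HasCompactSupport Φ) {t : ℝ} (ht : t ≠ 0) :
    ∫⁻ x, ‖dilatedMultiplier h Φ t x‖ₑ ^ 2 = ∫⁻ ξ, ‖h ξ‖ₑ ^ 2 * ‖Φ (t • ξ)‖ₑ ^ 2 := by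
  have hc : HasCompactSupport fun ξ => h ξ * Φ (t • ξ) := by
    refine HasCompactSupport.mul_left ?_
    exact hΦc.comp_homeomorph (Homeomorph.smulOfNeZero t ht)
  have hs : ContDiff ℝ (⊤ : ℕ∞) fun ξ => h ξ * Φ (t • ξ) :=
    (h.smooth ⊤).mul (hΦ.comp (contDiff_const_smul t))
  set S : SchwartzMap V ℂ := hc.toSchwartzMap hs with hS
  have hSc : ∀ ξ, S ξ = h ξ * Φ (t • ξ) := fun ξ => rfl
  have h1 : ∀ x, dilatedMultiplier h Φ t x = (𝓕⁻ S : SchwartzMap V ℂ) x := by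
    intro x
    rw [SchwartzMap.fourierInv_coe]
    rfl
  have h2 := lintegral_enorm_fourier_sq (𝓕⁻ S : SchwartzMap V ℂ)
  rw [FourierTransform.fourier_fourierInv_eq] at h2
  calc ∫⁻ x, ‖dilatedMultiplier h Φ t x‖ₑ ^ 2
      = ∫⁻ x, ‖(𝓕⁻ S : SchwartzMap V ℂ) x‖ₑ ^ 2 := by simp_rw [h1]
    _ = ∫⁻ x, ‖S x‖ₑ ^ 2 := h2.symm
    _ = _ := by simp_rw [hSc, enorm_mul, mul_pow]

theorem hasDerivAt_dilatedMultiplier (h : SchwartzMap V ℂ) {Φ : V → ℂ}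
    (hΦ : ContDiff ℝ (⊤ : ℕ∞) Φ) {A B : ℝ} (hA : ∀ η, ‖Φ η‖ ≤ A) (hB : ∀ η, ‖radialDeriv Φ η‖ ≤ B)
    (x : V) {t : ℝ} (ht : 0 < t) :
    HasDerivAt (fun t => dilatedMultiplier h Φ t x)
      ((t : ℂ)⁻¹ * dilatedMultiplier h (radialDeriv Φ) t x) t := by
  have hχ := Real.continuous_fourierChar
  have hΦc := hΦ.continuous
  have hΨc := (contDiff_radialDeriv hΦ).continuous
  have hhc := h.continuous
  have hderiv : ∀ ξ : V, ∀ s : ℝ, 0 < s →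
      HasDerivAt (fun s : ℝ => Φ (s • ξ)) ((s : ℂ)⁻¹ * radialDeriv Φ (s • ξ)) s := by
    intro ξ s hs
    have h1 : HasFDerivAt Φ (fderiv ℝ Φ (s • ξ)) (s • ξ) :=
      (hΦ.differentiable (by simp) _).hasFDerivAt
    have h2 : HasDerivAt (fun s : ℝ => s • ξ) ξ s := by
      simpa using (hasDerivAt_id s).smul_const ξ
    have h3 := h1.comp_hasDerivAt s h2
    have hs' : (s : ℂ) ≠ 0 := by exact_mod_cast hs.ne'
    have h4 : (s : ℂ)⁻¹ * radialDeriv Φ (s • ξ) = fderiv ℝ Φ (s • ξ) ξ := by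
      change (s : ℂ)⁻¹ * fderiv ℝ Φ (s • ξ) (s • ξ) = _
      rw [map_smul, Complex.real_smul, ← mul_assoc, inv_mul_cancel₀ hs', one_mul]
    rw [h4]
    exact h3
  have key := (hasDerivAt_integral_of_dominated_loc_of_deriv_le (μ := volume) (x₀ := t)
    (s := Ioi (t / 2)) (Ioi_mem_nhds (by linarith))
    (F := fun t (ξ : V) => (𝐞 (inner ℝ ξ x) : ℂ) * (h ξ * Φ (t • ξ)))
    (F' := fun t (ξ : V) => (𝐞 (inner ℝ ξ x) : ℂ) * (h ξ * ((t : ℂ)⁻¹ * radialDeriv Φ (t • ξ))))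
    (bound := fun ξ => ‖h ξ‖ * ((t / 2)⁻¹ * B)) ?_ ?_ ?_ ?_ ?_ ?_).2
  · have e : (t : ℂ)⁻¹ * dilatedMultiplier h (radialDeriv Φ) t x =
        ∫ ξ, (𝐞 (inner ℝ ξ x) : ℂ) * (h ξ * ((t : ℂ)⁻¹ * radialDeriv Φ (t • ξ))) := by
      rw [dilatedMultiplier_apply, ← integral_const_mul]
      congr 1 with ξ
      ring
    rw [e]
    simp_rw [dilatedMultiplier_apply]
    exact key
  · refine Eventually.of_forall fun s => Continuous.aestronglyMeasurable ?_
    fun_prop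
  · refine Integrable.mono' (h.integrable.norm.mul_const A) ?_ (ae_of_all _ fun ξ => ?_)
    · exact Continuous.aestronglyMeasurable (by fun_prop)
    · rw [norm_mul, Circle.norm_coe, one_mul, norm_mul]
      gcongr
      exact hA _
  · exact Continuous.aestronglyMeasurable (by fun_prop)
  · refine ae_of_all _ fun ξ s hs => ?_
    have hs0 : 0 < s := (half_pos ht).trans hs
    rw [norm_mul, Circle.norm_coe, one_mul, norm_mul, norm_mul, norm_inv, Complex.norm_real,
      Real.norm_of_nonneg hs0.le]
    have hs1 : s⁻¹ ≤ (t / 2)⁻¹ := inv_anti₀ (half_pos ht) (le_of_lt hs)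
    gcongr
    exact hB _
  · exact h.integrable.norm.mul_const _
  · refine ae_of_all _ fun ξ s hs => ?_
    exact ((hderiv ξ s ((half_pos ht).trans hs)).const_mul (h ξ)).const_mul _

/-- The Sobolev inequality in `t`, at each point `x`. The multiplier has to vanish at the origin,
so that the averages tend to zero with `t`. -/
theorem iSup_dilatedMultiplier_sq_le (h : SchwartzMap V ℂ) {Φ : V → ℂ}
    (hΦ : ContDiff ℝ (⊤ : ℕ∞) Φ) {A B δ : ℝ} (hδ : 0 < δ) (hA : ∀ η, ‖Φ η‖ ≤ A)
    (hB : ∀ η, ‖radialDeriv Φ η‖ ≤ B) (h0 : Φ 0 = 0) (x : V) :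
    (⨆ (t : ℝ) (_ : 0 < t), ‖dilatedMultiplier h Φ t x‖ₑ) ^ 2 ≤
      ∫⁻ t in Ioi (0 : ℝ), (ENNReal.ofReal δ⁻¹ * ‖dilatedMultiplier h Φ t x‖ₑ ^ 2 +
        ENNReal.ofReal δ * ‖dilatedMultiplier h (radialDeriv Φ) t x‖ₑ ^ 2) *
          ENNReal.ofReal t⁻¹ := by
  have hcF : Continuous fun t => dilatedMultiplier h Φ t x := by
    have := continuous_dilatedMultiplier h.integrable h.continuous hΦ.continuous hA
    fun_prop
  have hcG : Continuous fun t => dilatedMultiplier h (radialDeriv Φ) t x := by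
    have := continuous_dilatedMultiplier h.integrable h.continuous
      (contDiff_radialDeriv hΦ).continuous hB
    fun_prop
  have hlim : Tendsto (fun t => dilatedMultiplier h Φ t x) (𝓝[>] 0) (𝓝 0) := by
    have h2 : dilatedMultiplier h Φ 0 x = 0 := by simp [dilatedMultiplier_apply, h0]
    have h3 := hcF.tendsto 0
    rw [h2] at h3
    exact h3.mono_left nhdsWithin_le_nhds
  have e : ∀ I : ℝ≥0∞, I = (I ^ (2⁻¹ : ℝ)) ^ 2 := fun I => by
    rw [← ENNReal.rpow_natCast, ← ENNReal.rpow_mul]; norm_num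
  rw [e (∫⁻ t in Ioi (0 : ℝ), _)]
  gcongr
  refine iSup₂_le fun t ht => ?_
  have h1 := enorm_sq_le_lintegral_of_hasDerivAt hδ
    (fun t ht => hasDerivAt_dilatedMultiplier h hΦ hA hB x ht) hcG hlim ht
  rw [ENNReal.le_rpow_inv_iff (by norm_num), ENNReal.rpow_ofNat]
  exact h1

/-- The square-function bound for the maximal function of a multiplier that lives in an annulus. -/
theorem lintegral_iSup_dilatedMultiplier_sq_le (h : SchwartzMap V ℂ) {Φ : V → ℂ}
    (hΦ : ContDiff ℝ (⊤ : ℕ∞) Φ) {A B r δ : ℝ} (hr : 0 < r) (hδ : 0 < δ) (hA : ∀ η, ‖Φ η‖ ≤ A)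
    (hB : ∀ η, ‖radialDeriv Φ η‖ ≤ B) (hsupp : ∀ η, ‖η‖ < r ∨ 4 * r < ‖η‖ → Φ η = 0) :
    ∫⁻ x, (⨆ (t : ℝ) (_ : 0 < t), ‖dilatedMultiplier h Φ t x‖ₑ) ^ 2 ≤
      3 * ENNReal.ofReal (δ⁻¹ * A ^ 2 + δ * B ^ 2) * ∫⁻ ξ, ‖h ξ‖ₑ ^ 2 := by
  set Ψ := radialDeriv Φ with hΨ
  have hΨs : ContDiff ℝ (⊤ : ℕ∞) Ψ := contDiff_radialDeriv hΦ
  have hΨsupp : ∀ η, ‖η‖ < r ∨ 4 * r < ‖η‖ → Ψ η = 0 := radialDeriv_eq_zero hsupp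
  have hA0 : 0 ≤ A := (norm_nonneg _).trans (hA 0)
  have hB0 : 0 ≤ B := (norm_nonneg _).trans (hB 0)
  have hcF := continuous_dilatedMultiplier h.integrable h.continuous hΦ.continuous hA
  have hcG := continuous_dilatedMultiplier h.integrable h.continuous hΨs.continuous hB
  have hpt := iSup_dilatedMultiplier_sq_le h hΦ hδ hA hB
    (hsupp 0 (Or.inl (by simpa using hr)))
  calc ∫⁻ x, (⨆ (t : ℝ) (_ : 0 < t), ‖dilatedMultiplier h Φ t x‖ₑ) ^ 2
      ≤ ∫⁻ x, ∫⁻ t in Ioi (0 : ℝ), (ENNReal.ofReal δ⁻¹ * ‖dilatedMultiplier h Φ t x‖ₑ ^ 2 +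
        ENNReal.ofReal δ * ‖dilatedMultiplier h Ψ t x‖ₑ ^ 2) * ENNReal.ofReal t⁻¹ :=
        lintegral_mono hpt
    _ = ∫⁻ t in Ioi (0 : ℝ), ∫⁻ x, (ENNReal.ofReal δ⁻¹ * ‖dilatedMultiplier h Φ t x‖ₑ ^ 2 +
        ENNReal.ofReal δ * ‖dilatedMultiplier h Ψ t x‖ₑ ^ 2) * ENNReal.ofReal t⁻¹ := by
        refine lintegral_lintegral_swap (Measurable.aemeasurable ?_)
        have hF' := (hcF.comp continuous_swap).enorm.measurable
        have hG' := (hcG.comp continuous_swap).enorm.measurable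
        simp only [Function.comp_def, Prod.fst_swap, Prod.snd_swap] at hF' hG'
        simp only [Function.uncurry_def]
        fun_prop
    _ = ∫⁻ t in Ioi (0 : ℝ), ∫⁻ ξ, ‖h ξ‖ₑ ^ 2 * ((ENNReal.ofReal δ⁻¹ * ‖Φ (t • ξ)‖ₑ ^ 2 +
        ENNReal.ofReal δ * ‖Ψ (t • ξ)‖ₑ ^ 2) * ENNReal.ofReal t⁻¹) := by
        refine setLIntegral_congr_fun measurableSet_Ioi fun t ht => ?_
        have ht' : t ≠ 0 := (ne_of_gt ht : t ≠ 0)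
        have hmF : Measurable fun x => ‖dilatedMultiplier h Φ t x‖ₑ ^ 2 :=
          ((hcF.comp (by fun_prop : Continuous fun x : V => (t, x))).enorm.measurable.pow_const 2)
        have hmh : Measurable fun ξ => ‖h ξ‖ₑ ^ 2 := h.continuous.enorm.measurable.pow_const 2
        have hmΦ : Measurable fun ξ : V => ‖Φ (t • ξ)‖ₑ ^ 2 :=
          (hΦ.continuous.comp (continuous_const_smul t)).enorm.measurable.pow_const 2
        have hmm : Measurable fun ξ => ENNReal.ofReal δ⁻¹ * (‖h ξ‖ₑ ^ 2 * ‖Φ (t • ξ)‖ₑ ^ 2) := by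
          fun_prop
        have e1 := lintegral_enorm_dilatedMultiplier_sq h hΦ (hasCompactSupport_of_norm hsupp) ht'
        have e2 := lintegral_enorm_dilatedMultiplier_sq h hΨs (hasCompactSupport_of_norm hΨsupp) ht'
        rw [lintegral_mul_const' _ _ ENNReal.ofReal_ne_top, lintegral_add_left (hmF.const_mul _),
          lintegral_const_mul' _ _ ENNReal.ofReal_ne_top,
          lintegral_const_mul' _ _ ENNReal.ofReal_ne_top, e1, e2,
          ← lintegral_const_mul' _ _ ENNReal.ofReal_ne_top,
          ← lintegral_const_mul' _ _ ENNReal.ofReal_ne_top,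
          ← lintegral_add_left hmm,
          ← lintegral_mul_const' _ _ ENNReal.ofReal_ne_top]
        refine lintegral_congr fun ξ => ?_
        ring
    _ = ∫⁻ ξ, ∫⁻ t in Ioi (0 : ℝ), ‖h ξ‖ₑ ^ 2 * ((ENNReal.ofReal δ⁻¹ * ‖Φ (t • ξ)‖ₑ ^ 2 +
        ENNReal.ofReal δ * ‖Ψ (t • ξ)‖ₑ ^ 2) * ENNReal.ofReal t⁻¹) := by
        refine lintegral_lintegral_swap (Measurable.aemeasurable ?_)
        have hmh : Measurable fun p : ℝ × V => ‖h p.2‖ₑ :=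
          (h.continuous.comp continuous_snd).enorm.measurable
        have hmΦ : Measurable fun p : ℝ × V => ‖Φ (p.1 • p.2)‖ₑ :=
          (hΦ.continuous.comp (by fun_prop)).enorm.measurable
        have hmΨ : Measurable fun p : ℝ × V => ‖Ψ (p.1 • p.2)‖ₑ :=
          (hΨs.continuous.comp (by fun_prop)).enorm.measurable
        simp only [Function.uncurry_def]
        fun_prop
    _ = ∫⁻ ξ, ‖h ξ‖ₑ ^ 2 * ∫⁻ t in Ioi (0 : ℝ), (ENNReal.ofReal δ⁻¹ * ‖Φ (t • ξ)‖ₑ ^ 2 +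
        ENNReal.ofReal δ * ‖Ψ (t • ξ)‖ₑ ^ 2) * ENNReal.ofReal t⁻¹ := by
        refine lintegral_congr fun ξ => ?_
        rw [lintegral_const_mul' _ _ (by simp)]
    _ ≤ ∫⁻ ξ, ‖h ξ‖ₑ ^ 2 * (3 * ENNReal.ofReal (δ⁻¹ * A ^ 2 + δ * B ^ 2)) := by
        refine lintegral_mono fun ξ => ?_
        gcongr
        refine lintegral_dilation_annulus_le (H := fun η => ENNReal.ofReal δ⁻¹ * ‖Φ η‖ₑ ^ 2 +
          ENNReal.ofReal δ * ‖Ψ η‖ₑ ^ 2) hr ξ (fun η => ?_) fun η hη => ?_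
        · rw [ENNReal.ofReal_add (by positivity) (by positivity),
            ENNReal.ofReal_mul (by positivity), ENNReal.ofReal_mul (by positivity),
            ENNReal.ofReal_pow hA0, ENNReal.ofReal_pow hB0, ← ofReal_norm, ← ofReal_norm]
          gcongr
          · exact hA η
          · exact hB η
        · simp [hsupp η hη, hΨsupp η hη]
    _ = _ := by
        rw [lintegral_mul_const _ (h.continuous.enorm.measurable.pow_const 2), mul_comm]

end Multiplier

end DilationMaximal

end

noncomputable section

namespace DilationMaximal

open Metric Filter Topology FourierTransform

/-! ### The Fourier transform of a compactly supported measure -/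

section FourierMeasure

variable {V : Type*} [NormedAddCommGroup V] [InnerProductSpace ℝ V] [MeasurableSpace V]

/-- The Fourier transform of a measure on an inner product space. -/
def fourierMeasure (μ : Measure V) (ξ : V) : ℂ := ∫ y, (𝐞 (-inner ℝ y ξ) : ℂ) ∂μ

theorem norm_fourierMeasure_le (μ : Measure V) (ξ : V) : ‖fourierMeasure μ ξ‖ ≤ μ.real univ := by
  refine (norm_integral_le_integral_norm _).trans ?_
  simp [Circle.norm_coe]

theorem fourierMeasure_eq_fourierIntegral (μ : Measure V) :
    fourierMeasure μ =
      VectorFourier.fourierIntegral 𝐞 μ (innerSL ℝ (E := V)).toLinearMap₁₂ fun _ => (1 : ℂ) := by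
  ext ξ
  simp [fourierMeasure, VectorFourier.fourierIntegral, Circle.smul_def]

theorem integrable_norm_pow_of_measure_compl_closedBall {V : Type*} [NormedAddCommGroup V]
    [MeasurableSpace V] [BorelSpace V] (μ : Measure V) [IsFiniteMeasure μ] {R : ℝ}
    (hR : μ (closedBall 0 R)ᶜ = 0) (n : ℕ) : Integrable (fun y => ‖y‖ ^ n) μ := by
  refine Integrable.mono' (integrable_const (R ^ n))
    (continuous_norm.pow n).aestronglyMeasurable ?_
  filter_upwards [compl_mem_ae_iff.2 hR] with y hy
  have hy' : ‖y‖ ≤ R := by simpa using hy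
  rw [norm_pow, norm_norm]
  gcongr

variable [FiniteDimensional ℝ V] [BorelSpace V]

theorem contDiff_fourierMeasure (μ : Measure V) [IsFiniteMeasure μ] {R : ℝ}
    (hR : μ (closedBall 0 R)ᶜ = 0) : ContDiff ℝ (⊤ : ℕ∞) (fourierMeasure μ) := by
  rw [fourierMeasure_eq_fourierIntegral]
  refine VectorFourier.contDiff_fourierIntegral (N := ⊤) _ fun n _ => ?_
  simpa using integrable_norm_pow_of_measure_compl_closedBall μ hR n

theorem radialDeriv_fourierMeasure (μ : Measure V) [IsFiniteMeasure μ] {R : ℝ}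
    (hR : μ (closedBall 0 R)ᶜ = 0) (ξ : V) :
    radialDeriv (fourierMeasure μ) ξ =
      ∫ y, (𝐞 (-inner ℝ y ξ) : ℂ) * (-(2 * Real.pi * Complex.I) * (inner ℝ y ξ : ℝ)) ∂μ := by
  have h1 : Integrable (fun _ : V => (1 : ℂ)) μ := integrable_const _
  have h2 : Integrable (fun y : V => ‖y‖ * ‖(1 : ℂ)‖) μ := by
    simpa using integrable_norm_pow_of_measure_compl_closedBall μ hR 1
  unfold radialDeriv
  rw [fourierMeasure_eq_fourierIntegral, VectorFourier.fderiv_fourierIntegral _ h1 h2,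
    VectorFourier.fourierIntegral]
  rw [ContinuousLinearMap.integral_apply]
  · refine integral_congr_ae (ae_of_all _ fun y => ?_)
    simp only [ContinuousLinearMap.toLinearMap₁₂_apply, smul_apply,
      VectorFourier.fourierSMulRight_apply, Circle.smul_def, smul_eq_mul, Complex.real_smul,
      mul_one]
    rfl
  · refine Integrable.mono' (h2.const_mul (2 * Real.pi * ‖innerSL ℝ (E := V)‖)) ?_ ?_
    · have := h1.aestronglyMeasurable.fourierSMulRight (L := innerSL ℝ (E := V))
      refine AEStronglyMeasurable.fun_smul (Continuous.aestronglyMeasurable ?_) this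
      refine Real.continuous_fourierChar.comp ?_
      exact (continuous_id.inner continuous_const).neg
    · refine ae_of_all _ fun y => ?_
      rw [Circle.norm_smul]
      refine (VectorFourier.norm_fourierSMulRight_le _ _ _).trans (le_of_eq ?_)
      ring

/-- Multiplying a measure by a Schwartz function preserves the decay of its Fourier transform:
on the Fourier side one convolves with a Schwartz function. -/
theorem exists_norm_integral_fourierChar_mul_le (μ : Measure V) [IsFiniteMeasure μ] {a C₀ : ℝ}
    (ha : 0 ≤ a) (hdecay : ∀ ξ, ‖fourierMeasure μ ξ‖ ≤ C₀ * (1 + ‖ξ‖) ^ (-a))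
    (h : SchwartzMap V ℂ) :
    ∃ C, 0 ≤ C ∧ ∀ ξ, ‖∫ y, (𝐞 (-inner ℝ y ξ) : ℂ) * h y ∂μ‖ ≤ C * (1 + ‖ξ‖) ^ (-a) := by
  have hC₀ : 0 ≤ C₀ := by
    have := (norm_nonneg _).trans (hdecay 0)
    simpa using this
  obtain ⟨n, hn⟩ := exists_nat_ge a
  set g : SchwartzMap V ℂ := 𝓕 h with hg
  have hint : Integrable (fun η => (1 + ‖η‖) ^ a * ‖g η‖) := by
    have h1 : Integrable fun η : V => 2 ^ n * (‖g η‖ + ‖η‖ ^ n * ‖g η‖) :=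
      (g.integrable.norm.add (g.integrable_pow_mul volume n)).const_mul _
    refine h1.mono' ?_ (ae_of_all _ fun η => ?_)
    · refine Continuous.aestronglyMeasurable ?_
      have := g.continuous
      refine Continuous.mul (Continuous.rpow_const (by fun_prop) fun η => Or.inr ha) (by fun_prop)
    · rw [Real.norm_of_nonneg (by positivity)]
      have h2 : (1 + ‖η‖) ^ a ≤ (1 + ‖η‖) ^ n := by
        rw [← Real.rpow_natCast]
        exact Real.rpow_le_rpow_of_exponent_le (by linarith [norm_nonneg η]) hn
      have h3 : (1 + ‖η‖) ^ n ≤ 2 ^ n * (1 + ‖η‖ ^ n) := by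
        rcases le_total ‖η‖ 1 with h4 | h4
        · calc (1 + ‖η‖) ^ n ≤ 2 ^ n := by gcongr; linarith
            _ ≤ 2 ^ n * (1 + ‖η‖ ^ n) := by
                have : 0 ≤ ‖η‖ ^ n := by positivity
                nlinarith [pow_pos (two_pos : (0 : ℝ) < 2) n]
        · calc (1 + ‖η‖) ^ n ≤ (2 * ‖η‖) ^ n := by gcongr; linarith
            _ ≤ 2 ^ n * (1 + ‖η‖ ^ n) := by
                rw [mul_pow]
                nlinarith [pow_pos (two_pos : (0 : ℝ) < 2) n]
      calc (1 + ‖η‖) ^ a * ‖g η‖ ≤ (2 ^ n * (1 + ‖η‖ ^ n)) * ‖g η‖ := by gcongr; exact h2.trans h3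
        _ = _ := by ring
  refine ⟨C₀ * ∫ η, (1 + ‖η‖) ^ a * ‖g η‖, ?_, fun ξ => ?_⟩
  · exact mul_nonneg hC₀ (integral_nonneg fun η => by positivity)
  have hinv : ∀ y, h y = ∫ η, (𝐞 (inner ℝ η y) : ℂ) * g η := by
    intro y
    have h1 : (𝓕⁻ g : SchwartzMap V ℂ) = h := by rw [hg, fourierInv_fourier_eq]
    rw [← h1, SchwartzMap.fourierInv_coe, Real.fourierInv_eq]
    simp [Circle.smul_def]
  have hswap : ∫ y, (𝐞 (-inner ℝ y ξ) : ℂ) * h y ∂μ = ∫ η, g η * fourierMeasure μ (ξ - η) := by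
    calc ∫ y, (𝐞 (-inner ℝ y ξ) : ℂ) * h y ∂μ
        = ∫ y, (∫ η, (𝐞 (-inner ℝ y ξ) : ℂ) * ((𝐞 (inner ℝ η y) : ℂ) * g η)) ∂μ := by
          refine integral_congr_ae (ae_of_all _ fun y => ?_)
          dsimp only
          rw [hinv, integral_const_mul]
      _ = ∫ η, ∫ y, (𝐞 (-inner ℝ y ξ) : ℂ) * ((𝐞 (inner ℝ η y) : ℂ) * g η) ∂μ := by
          refine integral_integral_swap ?_
          have h1 : Integrable (fun p : V × V => (1 : ℝ) * ‖g p.2‖) (μ.prod volume) :=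
            (integrable_const (1 : ℝ)).mul_prod g.integrable.norm
          refine h1.mono' ?_ (ae_of_all _ fun p => ?_)
          · refine Continuous.aestronglyMeasurable ?_
            have h2 := Real.continuous_fourierChar
            have h3 := g.continuous
            simp only [Function.uncurry_def]
            fun_prop
          · simp [Function.uncurry_def, Circle.norm_coe]
      _ = ∫ η, g η * fourierMeasure μ (ξ - η) := by
          refine integral_congr_ae (ae_of_all _ fun η => ?_)
          dsimp only
          rw [fourierMeasure, ← integral_const_mul]
          refine integral_congr_ae (ae_of_all _ fun y => ?_)
          dsimp only
          have h2 : -inner ℝ y (ξ - η) = -inner ℝ y ξ + inner ℝ η y := by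
            rw [inner_sub_right, real_inner_comm η y]; ring
          rw [h2, AddChar.map_add_eq_mul, Circle.coe_mul]
          ring
  rw [hswap]
  refine (norm_integral_le_of_norm_le (hint.const_mul (C₀ * (1 + ‖ξ‖) ^ (-a)))
    (ae_of_all _ fun η => ?_)).trans (le_of_eq ?_)
  · rw [norm_mul]
    have h1 : (1 + ‖ξ - η‖) ^ (-a) ≤ (1 + ‖ξ‖) ^ (-a) * (1 + ‖η‖) ^ a := by
      have h2 : 1 + ‖ξ‖ ≤ (1 + ‖ξ - η‖) * (1 + ‖η‖) := by
        have := norm_add_le (ξ - η) η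
        rw [sub_add_cancel] at this
        nlinarith [norm_nonneg (ξ - η), norm_nonneg η]
      have h3 : (1 + ‖ξ‖) ^ a ≤ (1 + ‖ξ - η‖) ^ a * (1 + ‖η‖) ^ a := by
        rw [← Real.mul_rpow (by positivity) (by positivity)]
        exact Real.rpow_le_rpow (by positivity) h2 ha
      rw [Real.rpow_neg (by positivity), Real.rpow_neg (by positivity),
        inv_mul_eq_div, inv_eq_one_div, div_le_div_iff₀ (by positivity) (by positivity)]
      linarith
    calc ‖g η‖ * ‖fourierMeasure μ (ξ - η)‖
        ≤ ‖g η‖ * (C₀ * ((1 + ‖ξ‖) ^ (-a) * (1 + ‖η‖) ^ a)) := by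
          gcongr
          exact (hdecay _).trans (by gcongr)
      _ = _ := by ring
  · rw [integral_const_mul]; ring

/-- The gradient of the Fourier transform of a compactly supported measure inherits its decay. -/
theorem exists_norm_radialDeriv_fourierMeasure_le (μ : Measure V) [IsFiniteMeasure μ] {R : ℝ}
    (hR0 : 0 < R) (hR : μ (closedBall 0 R)ᶜ = 0) {a C₀ : ℝ} (ha : 0 ≤ a)
    (hdecay : ∀ ξ, ‖fourierMeasure μ ξ‖ ≤ C₀ * (1 + ‖ξ‖) ^ (-a)) :
    ∃ C, 0 ≤ C ∧
      ∀ ξ, ‖radialDeriv (fourierMeasure μ) ξ‖ ≤ C * ‖ξ‖ * (1 + ‖ξ‖) ^ (-a) := by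
  obtain ⟨χ, hχ1, -, hχc⟩ := exists_cutoff (V := V) R hR0
  set b := stdOrthonormalBasis ℝ V with hb
  have hs : ∀ i, HasCompactSupport fun y => χ y * ((inner ℝ y (b i) : ℝ) : ℂ) :=
    fun i => hχc.mul_right
  have hd : ∀ i, ContDiff ℝ (⊤ : ℕ∞) fun y => χ y * ((inner ℝ y (b i) : ℝ) : ℂ) := by
    intro i
    refine (χ.smooth ⊤).mul (Complex.ofRealCLM.contDiff.comp ?_)
    exact contDiff_id.inner ℝ contDiff_const
  choose C hC0 hC using fun i =>
    exists_norm_integral_fourierChar_mul_le μ ha hdecay ((hs i).toSchwartzMap (hd i))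
  refine ⟨2 * Real.pi * ∑ i, C i,
    mul_nonneg (by positivity) (Finset.sum_nonneg fun i _ => hC0 i), fun ξ => ?_⟩
  have hint : ∀ i, Integrable
      (fun y => (𝐞 (-inner ℝ y ξ) : ℂ) * ((hs i).toSchwartzMap (hd i)) y) μ := by
    intro i
    set q := (hs i).toSchwartzMap (hd i)
    obtain ⟨K, hK⟩ : ∃ K, ∀ y, ‖q y‖ ≤ K := ⟨_, q.norm_le_seminorm ℝ⟩
    refine Integrable.mono' (integrable_const K) (Continuous.aestronglyMeasurable ?_)
      (ae_of_all _ fun y => ?_)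
    · have := Real.continuous_fourierChar
      have := q.continuous
      fun_prop
    · rw [norm_mul, Circle.norm_coe, one_mul]; exact hK y
  have key : radialDeriv (fourierMeasure μ) ξ = -(2 * Real.pi * Complex.I) *
      ∑ i, ((inner ℝ (b i) ξ : ℝ) : ℂ) *
        ∫ y, (𝐞 (-inner ℝ y ξ) : ℂ) * ((hs i).toSchwartzMap (hd i)) y ∂μ := by
    rw [radialDeriv_fourierMeasure μ hR]
    simp_rw [← integral_const_mul]
    rw [← integral_finsetSum _ (fun i _ => (hint i).const_mul _), ← integral_const_mul]
    refine integral_congr_ae ?_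
    filter_upwards [compl_mem_ae_iff.2 hR] with y hy
    have hy1 : χ y = 1 := hχ1 y (by simpa using hy)
    have hsum : ((inner ℝ y ξ : ℝ) : ℂ) =
        ∑ i, ((inner ℝ y (b i) : ℝ) : ℂ) * ((inner ℝ (b i) ξ : ℝ) : ℂ) := by
      rw [← b.sum_inner_mul_inner y ξ]; push_cast; rfl
    rw [hsum, Finset.mul_sum, Finset.mul_sum, Finset.mul_sum]
    refine Finset.sum_congr rfl fun i _ => ?_
    change _ = -(2 * Real.pi * Complex.I) * (((inner ℝ (b i) ξ : ℝ) : ℂ) *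
      ((𝐞 (-inner ℝ y ξ) : ℂ) * (χ y * ((inner ℝ y (b i) : ℝ) : ℂ))))
    rw [hy1]
    ring
  rw [key, norm_mul]
  have h2pi : ‖-(2 * (Real.pi : ℂ) * Complex.I)‖ = 2 * Real.pi := by
    simp [abs_of_pos Real.pi_pos]
  rw [h2pi]
  calc 2 * Real.pi * ‖∑ i, ((inner ℝ (b i) ξ : ℝ) : ℂ) *
        ∫ y, (𝐞 (-inner ℝ y ξ) : ℂ) * ((hs i).toSchwartzMap (hd i)) y ∂μ‖
      ≤ 2 * Real.pi * ∑ i, ‖ξ‖ * (C i * (1 + ‖ξ‖) ^ (-a)) := by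
        gcongr
        refine (norm_sum_le _ _).trans (Finset.sum_le_sum fun i _ => ?_)
        rw [norm_mul, Complex.norm_real]
        gcongr
        · refine (norm_inner_le_norm _ _).trans ?_
          rw [b.norm_eq_one, one_mul]
        · exact hC i ξ
    _ = _ := by
        rw [← Finset.mul_sum, ← Finset.sum_mul]; ring

/-- Fourier inversion inside an average of translates of a Schwartz function. -/
theorem integral_comp_sub_mul_eq {α : Type*} [MeasurableSpace α] (ν : Measure α) [SFinite ν]
    (f : SchwartzMap V ℂ) {w : α → V} (hw : Measurable w) {k : α → ℂ} (hk : Integrable k ν)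
    (x : V) :
    ∫ p, f (x - w p) * k p ∂ν = ∫ ξ, (𝐞 (inner ℝ ξ x) : ℂ) *
      ((𝓕 f : SchwartzMap V ℂ) ξ * ∫ p, (𝐞 (-inner ℝ (w p) ξ) : ℂ) * k p ∂ν) := by
  set g : SchwartzMap V ℂ := 𝓕 f with hg
  have hinv : ∀ y, f y = ∫ η, (𝐞 (inner ℝ η y) : ℂ) * g η := by
    intro y
    have h1 : (𝓕⁻ g : SchwartzMap V ℂ) = f := by rw [hg, fourierInv_fourier_eq]
    rw [← h1, SchwartzMap.fourierInv_coe, Real.fourierInv_eq]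
    simp [Circle.smul_def]
  calc ∫ p, f (x - w p) * k p ∂ν
      = ∫ p, (∫ ξ, ((𝐞 (inner ℝ ξ (x - w p)) : ℂ) * g ξ) * k p) ∂ν := by
        refine integral_congr_ae (ae_of_all _ fun p => ?_)
        dsimp only
        rw [hinv, integral_mul_const]
    _ = ∫ ξ, ∫ p, ((𝐞 (inner ℝ ξ (x - w p)) : ℂ) * g ξ) * k p ∂ν := by
        refine integral_integral_swap ?_
        have h1 : Integrable (fun p : α × V => ‖k p.1‖ * ‖g p.2‖) (ν.prod volume) :=
          hk.norm.mul_prod g.integrable.norm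
        refine h1.mono' ?_ (ae_of_all _ fun p => ?_)
        · have h2 : Measurable fun p : α × V => (inner ℝ p.2 (x - w p.1) : ℝ) :=
            measurable_snd.inner (measurable_const.sub (hw.comp measurable_fst))
          have h3 : Continuous fun r : ℝ => (𝐞 r : ℂ) := by
            have := Real.continuous_fourierChar
            fun_prop
          refine AEStronglyMeasurable.mul (AEStronglyMeasurable.mul ?_ ?_) ?_
          · exact (h3.measurable.comp h2).aestronglyMeasurable
          · exact (g.continuous.measurable.comp measurable_snd).aestronglyMeasurable
          · exact hk.aestronglyMeasurable.comp_fst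
        · simp [Function.uncurry_def, Circle.norm_coe, mul_comm]
    _ = _ := by
        refine integral_congr_ae (ae_of_all _ fun ξ => ?_)
        dsimp only
        rw [← integral_const_mul, ← integral_const_mul]
        refine integral_congr_ae (ae_of_all _ fun p => ?_)
        dsimp only
        have h2 : inner ℝ ξ (x - w p) = inner ℝ ξ x + -inner ℝ (w p) ξ := by
          rw [inner_sub_right, real_inner_comm ξ (w p)]; ring
        rw [h2, AddChar.map_add_eq_mul, Circle.coe_mul]
        ring

theorem integral_comp_sub_smul_eq (μ : Measure V) [IsFiniteMeasure μ] (f : SchwartzMap V ℂ)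
    (t : ℝ) (x : V) :
    ∫ y, f (x - t • y) ∂μ =
      dilatedMultiplier (𝓕 f : SchwartzMap V ℂ) (fourierMeasure μ) t x := by
  have h := integral_comp_sub_mul_eq μ f (w := fun y => t • y) (by fun_prop)
    (integrable_const (1 : ℂ)) x
  simp only [mul_one] at h
  rw [h, dilatedMultiplier_apply]
  simp only [fourierMeasure, inner_smul_left, inner_smul_right]
  rfl

/-- Cutting off `μ̂` at frequency `1 / s` amounts to averaging over `μ` at scale `s`. -/
theorem integral_prod_comp_sub_smul_eq (μ : Measure V) [IsFiniteMeasure μ]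
    (f κ : SchwartzMap V ℂ) (t s : ℝ) (x : V) :
    ∫ p : V × V, f (x - (t • p.1 + (t * s) • p.2)) * κ p.2 ∂(μ.prod volume) =
      dilatedMultiplier (𝓕 f : SchwartzMap V ℂ)
        (fun ξ => fourierMeasure μ ξ * (𝓕 κ : SchwartzMap V ℂ) (s • ξ)) t x := by
  have hk : Integrable (fun p : V × V => κ p.2) (μ.prod volume) := by
    simpa using (integrable_const (1 : ℂ)).mul_prod (μ := μ) κ.integrable
  rw [integral_comp_sub_mul_eq (μ.prod volume) f (w := fun p => t • p.1 + (t * s) • p.2)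
    (by fun_prop) hk x, dilatedMultiplier_apply]
  refine integral_congr_ae (ae_of_all _ fun ξ => ?_)
  dsimp only
  congr 2
  rw [SchwartzMap.fourier_coe, Real.fourier_eq, fourierMeasure, ← integral_prod_mul]
  refine integral_congr_ae (ae_of_all _ fun p => ?_)
  dsimp only
  have h1 : -inner ℝ (t • p.1 + (t * s) • p.2) ξ =
      -inner ℝ p.1 (t • ξ) + -inner ℝ p.2 (s • t • ξ) := by
    simp only [inner_add_left, inner_smul_left, inner_smul_right]
    simp
    ring
  rw [h1, AddChar.map_add_eq_mul, Circle.coe_mul, Circle.smul_def, smul_eq_mul]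
  ring

end FourierMeasure

end DilationMaximal

end

noncomputable section

namespace DilationMaximal

open Metric Filter Topology FourierTransform

/-! ### The low-frequency part -/

section LowFrequency

variable {V : Type*} [NormedAddCommGroup V] [InnerProductSpace ℝ V] [MeasurableSpace V]
  [FiniteDimensional ℝ V] [BorelSpace V]

theorem setLIntegral_comp_sub_smul_ball (g : V → ℝ≥0∞) (c : V) {u ρ : ℝ} (hu : 0 < u) :
    ∫⁻ z in ball 0 ρ, g (c - u • z) =
      ENNReal.ofReal (u ^ Module.finrank ℝ V)⁻¹ * ∫⁻ w in ball c (u * ρ), g w := by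
  have hu' : -u ≠ 0 := by simpa using hu.ne'
  have h1 : ∫⁻ z in ball 0 ρ, g (c - u • z) =
      ∫⁻ z, (fun w => (ball c (u * ρ)).indicator g (c + w)) ((-u) • z) := by
    rw [← lintegral_indicator measurableSet_ball]
    refine lintegral_congr fun z => ?_
    have h2 : c + (-u) • z = c - u • z := by rw [neg_smul, sub_eq_add_neg]
    by_cases hz : z ∈ ball (0 : V) ρ
    · rw [indicator_of_mem hz]
      dsimp only
      rw [h2, indicator_of_mem]
      simp only [mem_ball, dist_zero_right, dist_self_sub_left, norm_smul,
        Real.norm_of_nonneg hu.le] at hz ⊢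
      gcongr
    · rw [indicator_of_notMem hz]
      dsimp only
      rw [h2, indicator_of_notMem]
      simp only [mem_ball, dist_zero_right, dist_self_sub_left, norm_smul,
        Real.norm_of_nonneg hu.le, not_lt] at hz ⊢
      gcongr
  have h3 : ∀ F : V → ℝ≥0∞, ∫⁻ z, F ((-u) • z) =
      ENNReal.ofReal (u ^ Module.finrank ℝ V)⁻¹ * ∫⁻ z, F z := by
    intro F
    have h4 : ∫⁻ z, F ((-u) • z) = ∫⁻ z, F z ∂(Measure.map (fun z : V => (-u) • z) volume) :=
      (lintegral_map_equiv F (Homeomorph.smulOfNeZero (-u) hu').toMeasurableEquiv).symm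
    rw [h4, Measure.map_addHaar_smul volume hu', lintegral_smul_measure, smul_eq_mul, abs_inv,
      abs_pow, abs_neg, abs_of_pos hu]
  rw [h1, h3 fun w => (ball c (u * ρ)).indicator g (c + w),
    lintegral_add_left_eq_self (fun w => (ball c (u * ρ)).indicator g w) c,
    lintegral_indicator measurableSet_ball]

/-- Averaging over the `s ρ`-neighbourhood of the `t`-dilate of `μ` is controlled by the
Hardy–Littlewood maximal function, with a gain from the Frostman condition. -/
theorem lintegral_average_le_hlMaximal (μ : Measure V) [IsFiniteMeasure μ] {R b C₀ : ℝ}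
    (hR0 : 0 < R) (hR : μ (closedBall 0 R)ᶜ = 0) (hC₀ : 0 ≤ C₀)
    (hF : ∀ x r, 0 < r → μ (ball x r) ≤ ENNReal.ofReal (C₀ * r ^ b))
    {g : V → ℝ≥0∞} (hg : Measurable g) (x : V) {t s ρ : ℝ} (ht : 0 < t) (hs : 0 < s) (hs1 : s ≤ 1)
    (hρ : 1 ≤ ρ) :
    ∫⁻ y, (∫⁻ z in ball 0 ρ, g (x - t • y - (t * s) • z)) ∂μ ≤
      ENNReal.ofReal (C₀ * (R + 1) ^ Module.finrank ℝ V * volume.real (ball (0 : V) 1) *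
        s ^ (b - Module.finrank ℝ V) * ρ ^ (b + Module.finrank ℝ V)) * hlMaximal g x := by
  set n := Module.finrank ℝ V with hn
  have hts : 0 < t * s := mul_pos ht hs
  have hρ0 : 0 < ρ := one_pos.trans_le hρ
  set Q := t * ((R + 1) * ρ) with hQ
  have hQ0 : 0 < Q := by positivity
  calc ∫⁻ y, (∫⁻ z in ball 0 ρ, g (x - t • y - (t * s) • z)) ∂μ
      = ENNReal.ofReal ((t * s) ^ n)⁻¹ *
          ∫⁻ y, (∫⁻ w, (ball (x - t • y) (t * s * ρ)).indicator g w) ∂μ := by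
        rw [← lintegral_const_mul' _ _ ENNReal.ofReal_ne_top]
        refine lintegral_congr fun y => ?_
        rw [setLIntegral_comp_sub_smul_ball g _ hts, lintegral_indicator measurableSet_ball]
    _ = ENNReal.ofReal ((t * s) ^ n)⁻¹ *
          ∫⁻ w, (∫⁻ y, (ball (x - t • y) (t * s * ρ)).indicator g w ∂μ) := by
        congr 1
        refine lintegral_lintegral_swap (Measurable.aemeasurable ?_)
        have hm : MeasurableSet {p : V × V | dist p.2 (x - t • p.1) < t * s * ρ} := by
          refine measurableSet_lt ?_ measurable_const
          exact Continuous.measurable (by fun_prop)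
        exact (hg.comp measurable_snd).indicator hm
    _ ≤ ENNReal.ofReal ((t * s) ^ n)⁻¹ *
          ∫⁻ w, ENNReal.ofReal (C₀ * (s * ρ) ^ b) * (ball x Q).indicator g w := by
        gcongr with w
        by_cases hw : w ∈ ball x Q
        · rw [indicator_of_mem hw]
          have hset : ∀ y, (ball (x - t • y) (t * s * ρ)).indicator g w =
              (ball (t⁻¹ • (x - w)) (s * ρ)).indicator (fun _ => g w) y := by
            intro y
            have hiff : w ∈ ball (x - t • y) (t * s * ρ) ↔ y ∈ ball (t⁻¹ • (x - w)) (s * ρ) := by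
              have e : w - (x - t • y) = t • (y - t⁻¹ • (x - w)) := by
                rw [smul_sub, smul_smul, mul_inv_cancel₀ ht.ne', one_smul]; abel
              rw [mem_ball_iff_norm, mem_ball_iff_norm, e, norm_smul, Real.norm_of_nonneg ht.le,
                mul_assoc, mul_lt_mul_iff_right₀ ht]
            by_cases hy : w ∈ ball (x - t • y) (t * s * ρ)
            · rw [indicator_of_mem hy, indicator_of_mem (hiff.1 hy)]
            · rw [indicator_of_notMem hy, indicator_of_notMem (fun h => hy (hiff.2 h))]
          simp_rw [hset]
          rw [lintegral_indicator measurableSet_ball, setLIntegral_const, mul_comm]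
          gcongr
          exact hF _ _ (by positivity)
        · rw [indicator_of_notMem hw, mul_zero, nonpos_iff_eq_zero]
          rw [lintegral_eq_zero_iff' ?_]
          · filter_upwards [compl_mem_ae_iff.2 hR] with y hy
            refine indicator_of_notMem (fun h => hw ?_) _
            have hy' : ‖y‖ ≤ R := by simpa using hy
            rw [mem_ball_iff_norm] at h ⊢
            calc ‖w - x‖ = ‖(w - (x - t • y)) - t • y‖ := by congr 1; abel
              _ ≤ ‖w - (x - t • y)‖ + ‖t • y‖ := norm_sub_le _ _
              _ < t * s * ρ + t * R := by
                  rw [norm_smul, Real.norm_of_nonneg ht.le]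
                  have : t * ‖y‖ ≤ t * R := by gcongr
                  linarith
              _ ≤ Q := by
                  have h1 : s * ρ ≤ ρ := mul_le_of_le_one_left hρ0.le hs1
                  have h2 : R ≤ R * ρ := le_mul_of_one_le_right hR0.le hρ
                  have : s * ρ + R ≤ (R + 1) * ρ := by linarith
                  calc t * s * ρ + t * R = t * (s * ρ + R) := by ring
                    _ ≤ _ := by rw [hQ]; gcongr
          · have hm : MeasurableSet {y : V | dist w (x - t • y) < t * s * ρ} :=
              measurableSet_lt (Continuous.measurable (by fun_prop)) measurable_const
            exact (measurable_const.indicator hm).aemeasurable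
    _ = ENNReal.ofReal ((t * s) ^ n)⁻¹ * ENNReal.ofReal (C₀ * (s * ρ) ^ b) *
          ∫⁻ w in ball x Q, g w := by
        rw [lintegral_const_mul' _ _ ENNReal.ofReal_ne_top, lintegral_indicator measurableSet_ball,
          mul_assoc]
    _ ≤ ENNReal.ofReal ((t * s) ^ n)⁻¹ * ENNReal.ofReal (C₀ * (s * ρ) ^ b) *
          (volume (ball x Q) * hlMaximal g x) := by
        gcongr
        exact setLIntegral_ball_le_hlMaximal g x hQ0
    _ = _ := by
        rw [← mul_assoc]
        congr 1
        have h1 := Measure.addHaar_ball_mul_of_pos (volume : Measure V) x hQ0 1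
        rw [mul_one] at h1
        rw [h1, ← ofReal_measureReal (measure_ball_lt_top.ne),
          ← ENNReal.ofReal_mul (by positivity), ← ENNReal.ofReal_mul (by positivity),
          ← ENNReal.ofReal_mul (by positivity)]
        congr 1
        rw [Real.rpow_sub hs, Real.rpow_add hρ0, Real.rpow_natCast, Real.rpow_natCast,
          Real.mul_rpow hs.le hρ0.le, hQ, ← hn]
        field_simp
        simp only [mul_pow]
        ring

/-- The low-frequency part of `f ∗ μ_t` is controlled by the Hardy–Littlewood maximal function,
uniformly in `t`. -/
theorem exists_enorm_lowFrequency_le (μ : Measure V) [IsFiniteMeasure μ] {R b C₀ : ℝ}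
    (hR0 : 0 < R) (hR : μ (closedBall 0 R)ᶜ = 0) (hC₀ : 0 ≤ C₀)
    (hF : ∀ x r, 0 < r → μ (ball x r) ≤ ENNReal.ofReal (C₀ * r ^ b)) (χ : SchwartzMap V ℂ) :
    ∃ C : ℝ, 0 ≤ C ∧ ∀ (f : SchwartzMap V ℂ) (x : V) (t s : ℝ), 0 < t → 0 < s → s ≤ 1 →
      ‖dilatedMultiplier (𝓕 f : SchwartzMap V ℂ) (fun ξ => fourierMeasure μ ξ * χ (s • ξ)) t x‖ₑ ≤
        ENNReal.ofReal (C * s ^ (b - Module.finrank ℝ V)) * hlMaximal (fun y => ‖f y‖ₑ) x := by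
  set n := Module.finrank ℝ V with hn
  set κ : SchwartzMap V ℂ := 𝓕⁻ χ with hκ
  have hχ : (𝓕 κ : SchwartzMap V ℂ) = χ := by rw [hκ, fourier_fourierInv_eq]
  obtain ⟨M, hM⟩ := exists_nat_gt (b + n)
  obtain ⟨A, hA0, hA⟩ : ∃ A, 0 ≤ A ∧ ∀ z, ‖κ z‖ ≤ A := by
    obtain ⟨A, hA⟩ := κ.decay 0 0
    exact ⟨A, hA.1.le, fun z => by simpa using hA.2 z⟩
  obtain ⟨A', hA'0, hA'⟩ : ∃ A, 0 ≤ A ∧ ∀ z, ‖z‖ ^ M * ‖κ z‖ ≤ A := by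
    obtain ⟨A, hA⟩ := κ.decay M 0
    exact ⟨A, hA.1.le, fun z => by simpa using hA.2 z⟩
  set B := A + A' * 2 ^ M with hB
  have hB0 : 0 ≤ B := by positivity
  -- a dyadic majorant of the kernel by indicators of balls
  have hmaj : ∀ z, ‖κ z‖ₑ ≤ ∑' k : ℕ, ENNReal.ofReal (B * ((2 : ℝ) ^ k) ^ (-(M : ℝ))) *
      (ball (0 : V) (2 ^ k)).indicator 1 z := by
    intro z
    have hz : ∃ k : ℕ, ‖z‖ < 2 ^ k ∧ ‖κ z‖ ≤ B * ((2 : ℝ) ^ k) ^ (-(M : ℝ)) := by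
      rcases lt_or_ge ‖z‖ 1 with h1 | h1
      · refine ⟨0, by simpa using h1, ?_⟩
        simp only [pow_zero, Real.one_rpow, mul_one]
        exact (hA z).trans (le_add_of_nonneg_right (by positivity))
      · obtain ⟨k, hk1, hk2⟩ := exists_nat_pow_near h1 one_lt_two
        refine ⟨k + 1, hk2, ?_⟩
        rw [Real.rpow_neg (by positivity), Real.rpow_natCast, ← div_eq_mul_inv,
          le_div_iff₀ (by positivity)]
        calc ‖κ z‖ * (2 ^ (k + 1)) ^ M = 2 ^ M * ((2 ^ k) ^ M * ‖κ z‖) := by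
              rw [pow_succ, mul_pow]; ring
          _ ≤ 2 ^ M * (‖z‖ ^ M * ‖κ z‖) := by gcongr
          _ ≤ 2 ^ M * A' := by gcongr; exact hA' z
          _ ≤ B := by rw [hB]; linarith
    obtain ⟨k, hk1, hk2⟩ := hz
    refine le_trans ?_ (ENNReal.le_tsum k)
    rw [indicator_of_mem (by simpa using hk1), Pi.one_apply, mul_one, ← ofReal_norm]
    exact ENNReal.ofReal_le_ofReal hk2
  set K := C₀ * (R + 1) ^ n * volume.real (ball (0 : V) 1) with hK
  have hK0 : 0 ≤ K := by positivity
  set q : ℝ := 2 ^ (b + n - M) with hq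
  have hq0 : 0 < q := by positivity
  have hq1 : q < 1 := Real.rpow_lt_one_of_one_lt_of_neg one_lt_two (by linarith)
  refine ⟨B * K * (1 - q)⁻¹, mul_nonneg (by positivity) (inv_nonneg.2 (by linarith)), ?_⟩
  intro f x t s ht hs hs1
  have hsp : 0 ≤ s ^ (b - n) := by positivity
  have hfm : Measurable fun y => ‖f y‖ₑ := f.continuous.enorm.measurable
  have h1 := integral_prod_comp_sub_smul_eq μ f κ t s x
  rw [hχ] at h1
  rw [← h1]
  have hmz : ∀ y, Measurable fun z => ‖f (x - t • y - (t * s) • z)‖ₑ := fun y =>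
    hfm.comp (by fun_prop)
  calc ‖∫ p : V × V, f (x - (t • p.1 + (t * s) • p.2)) * κ p.2 ∂(μ.prod volume)‖ₑ
      ≤ ∫⁻ p : V × V, ‖f (x - t • p.1 - (t * s) • p.2)‖ₑ * ‖κ p.2‖ₑ ∂(μ.prod volume) := by
        refine (enorm_integral_le_lintegral_enorm _).trans (le_of_eq ?_)
        refine lintegral_congr fun p => ?_
        rw [enorm_mul, sub_sub]
    _ = ∫⁻ y, (∫⁻ z, ‖f (x - t • y - (t * s) • z)‖ₑ * ‖κ z‖ₑ) ∂μ := by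
        refine lintegral_prod _ (Measurable.aemeasurable ?_)
        have := κ.continuous.enorm.measurable
        have h2 : Measurable fun p : V × V => ‖f (x - t • p.1 - (t * s) • p.2)‖ₑ :=
          hfm.comp (by fun_prop)
        fun_prop
    _ ≤ ∫⁻ y, (∑' k : ℕ, ENNReal.ofReal (B * ((2 : ℝ) ^ k) ^ (-(M : ℝ))) *
          ∫⁻ z in ball 0 (2 ^ k), ‖f (x - t • y - (t * s) • z)‖ₑ) ∂μ := by
        refine lintegral_mono fun y => ?_
        calc ∫⁻ z, ‖f (x - t • y - (t * s) • z)‖ₑ * ‖κ z‖ₑ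
            ≤ ∫⁻ z, ∑' k : ℕ, ENNReal.ofReal (B * ((2 : ℝ) ^ k) ^ (-(M : ℝ))) *
              (ball (0 : V) (2 ^ k)).indicator (fun z => ‖f (x - t • y - (t * s) • z)‖ₑ) z := by
              refine lintegral_mono fun z => ?_
              refine (mul_le_mul_right (hmaj z) _).trans (le_of_eq ?_)
              rw [← ENNReal.tsum_mul_left]
              refine tsum_congr fun k => ?_
              by_cases hz : z ∈ ball (0 : V) (2 ^ k)
              · simp only [indicator_of_mem hz, Pi.one_apply]; ring
              · simp only [indicator_of_notMem hz]; ring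
          _ = _ := by
              rw [lintegral_tsum fun k =>
                (((hmz y).indicator measurableSet_ball).const_mul _).aemeasurable]
              refine tsum_congr fun k => ?_
              rw [lintegral_const_mul' _ _ ENNReal.ofReal_ne_top,
                lintegral_indicator measurableSet_ball]
    _ = ∑' k : ℕ, ENNReal.ofReal (B * ((2 : ℝ) ^ k) ^ (-(M : ℝ))) *
          ∫⁻ y, (∫⁻ z in ball 0 (2 ^ k), ‖f (x - t • y - (t * s) • z)‖ₑ) ∂μ := by
        have hm : ∀ k : ℕ, Measurable fun y =>
            ∫⁻ z in ball 0 (2 ^ k), ‖f (x - t • y - (t * s) • z)‖ₑ := by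
          intro k
          refine Measurable.lintegral_prod_right' (f := fun p : V × V =>
            ‖f (x - t • p.1 - (t * s) • p.2)‖ₑ) ?_
          exact hfm.comp (by fun_prop)
        rw [lintegral_tsum fun k => ((hm k).const_mul _).aemeasurable]
        refine tsum_congr fun k => ?_
        rw [lintegral_const_mul' _ _ ENNReal.ofReal_ne_top]
    _ ≤ ∑' k : ℕ, ENNReal.ofReal (B * K * s ^ (b - n)) * ENNReal.ofReal q ^ k *
          hlMaximal (fun y => ‖f y‖ₑ) x := by
        refine ENNReal.tsum_le_tsum fun k => ?_
        refine (mul_le_mul_right (lintegral_average_le_hlMaximal μ hR0 hR hC₀ hF hfm x ht hs hs1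
          (one_le_pow₀ one_le_two)) _).trans (le_of_eq ?_)
        rw [← mul_assoc, ← ENNReal.ofReal_mul (by positivity), ← ENNReal.ofReal_pow hq0.le,
          ← ENNReal.ofReal_mul (by positivity)]
        congr 2
        have h2 : q ^ k = ((2 : ℝ) ^ k) ^ (-(M : ℝ)) * ((2 : ℝ) ^ k) ^ (b + n) := by
          rw [← Real.rpow_add (by positivity), hq, ← Real.rpow_natCast, ← Real.rpow_natCast,
            ← Real.rpow_mul (by norm_num), ← Real.rpow_mul (by norm_num)]
          congr 1
          ring
        rw [h2, ← hn, hK]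
        ring
    _ = _ := by
        rw [ENNReal.tsum_mul_right, ENNReal.tsum_mul_left, ENNReal.tsum_geometric]
        congr 1
        rw [← ENNReal.ofReal_one, ← ENNReal.ofReal_sub _ hq0.le,
          ← ENNReal.ofReal_inv_of_pos (by linarith), ← ENNReal.ofReal_mul (by positivity)]
        congr 1
        ring

end LowFrequency

end DilationMaximal

end

noncomputable section

namespace DilationMaximal

open Metric Filter Topology FourierTransform

/-! ### High frequencies and the weak-type bound for Schwartz functions -/

section HighFrequency

/-- A union bound for the superlevel sets of a series, with geometric weights. -/
theorem measure_lt_tsum_le {α : Type*} [MeasurableSpace α] (ν : Measure α) (S : ℕ → α → ℝ≥0∞)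
    {lam θ : ℝ} (hlam : 0 ≤ lam) (hθ0 : 0 < θ) (hθ1 : θ < 1) :
    ν {x | ENNReal.ofReal lam < ∑' j, S j x} ≤
      ∑' j, ν {x | ENNReal.ofReal (lam * (1 - θ) * θ ^ j) < S j x} := by
  refine le_trans (measure_mono fun x hx => ?_) (measure_iUnion_le _)
  by_contra hcon
  simp only [mem_iUnion, mem_ofPred_eq, not_exists, not_lt] at hcon hx
  refine hx.not_ge ((ENNReal.tsum_le_tsum hcon).trans (le_of_eq ?_))
  have h1 : 0 ≤ 1 - θ := by linarith
  calc ∑' j, ENNReal.ofReal (lam * (1 - θ) * θ ^ j)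
      = ∑' j, ENNReal.ofReal (lam * (1 - θ)) * ENNReal.ofReal θ ^ j := by
        refine tsum_congr fun j => ?_
        rw [ENNReal.ofReal_mul (by positivity), ENNReal.ofReal_pow hθ0.le]
    _ = ENNReal.ofReal lam := by
        rw [ENNReal.tsum_mul_left, ENNReal.tsum_geometric, ← ENNReal.ofReal_one,
          ← ENNReal.ofReal_sub _ hθ0.le, ← ENNReal.ofReal_inv_of_pos (by linarith),
          ← ENNReal.ofReal_mul (by positivity), mul_assoc, mul_inv_cancel₀ (by linarith), mul_one]

variable {V : Type*} [NormedAddCommGroup V] [InnerProductSpace ℝ V]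

theorem radialDeriv_mul_comp_smul {Φ ψ : V → ℂ} (hΦ : Differentiable ℝ Φ)
    (hψ : Differentiable ℝ ψ) (s : ℝ) (η : V) :
    radialDeriv (fun ξ => Φ ξ * ψ (s • ξ)) η =
      radialDeriv Φ η * ψ (s • η) + Φ η * radialDeriv ψ (s • η) := by
  have h1 : HasFDerivAt (fun ξ : V => ψ (s • ξ))
      ((fderiv ℝ ψ (s • η)).comp (s • ContinuousLinearMap.id ℝ V)) η :=
    (hψ (s • η)).hasFDerivAt.comp η ((hasFDerivAt_id η).const_smul s)
  have h2 := ((hΦ η).hasFDerivAt.fun_mul h1).fderiv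
  unfold radialDeriv
  rw [h2]
  simp
  ring

variable [MeasurableSpace V] [FiniteDimensional ℝ V] [BorelSpace V]

/-- The contribution of the frequencies `|ξ| ∼ 1 / (s t)`: the multiplier is of size `s ^ a` and its
radial derivative of size `s ^ (a - 1)`, and the geometric mean of their squares is
`s ^ (2 a - 1)`. -/
theorem exists_lintegral_iSup_highFrequency_sq_le (μ : Measure V) [IsFiniteMeasure μ] {R a C₀ : ℝ}
    (hR0 : 0 < R) (hR : μ (closedBall 0 R)ᶜ = 0) (ha : 0 ≤ a)
    (hdecay : ∀ ξ, ‖fourierMeasure μ ξ‖ ≤ C₀ * (1 + ‖ξ‖) ^ (-a)) {ψ : V → ℂ}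
    (hψ : ContDiff ℝ (⊤ : ℕ∞) ψ) (hψ0 : ∀ η, ‖η‖ < 1 ∨ 4 < ‖η‖ → ψ η = 0) :
    ∃ C : ℝ, 0 ≤ C ∧ ∀ (h : SchwartzMap V ℂ) (s : ℝ), 0 < s → s ≤ 1 →
      ∫⁻ x, (⨆ (t : ℝ) (_ : 0 < t),
        ‖dilatedMultiplier h (fun ξ => fourierMeasure μ ξ * ψ (s • ξ)) t x‖ₑ) ^ 2 ≤
          ENNReal.ofReal (C * s ^ (2 * a - 1)) * ∫⁻ ξ, ‖h ξ‖ₑ ^ 2 := by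
  have hC₀ : 0 ≤ C₀ := by
    have := (norm_nonneg _).trans (hdecay 0)
    simpa using this
  obtain ⟨C₁, hC₁, hC₁'⟩ := exists_norm_radialDeriv_fourierMeasure_le μ hR0 hR ha hdecay
  have hμs := contDiff_fourierMeasure μ hR
  obtain ⟨D, hD⟩ := (hasCompactSupport_of_norm hψ0).exists_bound_of_continuous hψ.continuous
  have hψ0' := radialDeriv_eq_zero hψ0
  obtain ⟨D', hD'⟩ := (hasCompactSupport_of_norm hψ0').exists_bound_of_continuous
    (contDiff_radialDeriv hψ).continuous
  have hD0 : 0 ≤ D := (norm_nonneg _).trans (hD 0)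
  have hD'0 : 0 ≤ D' := (norm_nonneg _).trans (hD' 0)
  set A := C₀ * D with hA
  set B := 4 * C₁ * D + C₀ * D' with hB
  refine ⟨3 * (A ^ 2 + B ^ 2), by positivity, fun h s hs hs1 => ?_⟩
  have hnorm : ∀ η : V, ‖s • η‖ = s * ‖η‖ := fun η => by
    rw [norm_smul, Real.norm_of_nonneg hs.le]
  have hsupp : ∀ η : V, ‖η‖ < s⁻¹ ∨ 4 * s⁻¹ < ‖η‖ → ‖s • η‖ < 1 ∨ 4 < ‖s • η‖ := by
    intro η hη
    rw [hnorm]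
    refine hη.imp (fun h1 => ?_) fun h1 => ?_
    · have := mul_lt_mul_of_pos_left h1 hs
      rwa [mul_inv_cancel₀ hs.ne'] at this
    · have := mul_lt_mul_of_pos_left h1 hs
      rwa [mul_left_comm, mul_inv_cancel₀ hs.ne', mul_one] at this
  -- on the annulus `1 / s ≤ |η| ≤ 4 / s` the decay factor is at most `s ^ a`
  have hdec : ∀ η : V, s⁻¹ ≤ ‖η‖ → (1 + ‖η‖) ^ (-a) ≤ s ^ a := by
    intro η hη
    calc (1 + ‖η‖) ^ (-a) ≤ (s⁻¹) ^ (-a) :=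
          Real.rpow_le_rpow_of_nonpos (by positivity) (by linarith) (by linarith)
      _ = s ^ a := by rw [Real.inv_rpow hs.le, Real.rpow_neg hs.le, inv_inv]
  have hsa : s ^ a ≤ s ^ (a - 1) := Real.rpow_le_rpow_of_exponent_ge hs hs1 (by linarith)
  have hsa' : s⁻¹ * s ^ a = s ^ (a - 1) := by
    rw [Real.rpow_sub hs, Real.rpow_one]; ring
  have hbA : ∀ η, ‖fourierMeasure μ η * ψ (s • η)‖ ≤ A * s ^ a := by
    intro η
    by_cases hη : ‖η‖ < s⁻¹ ∨ 4 * s⁻¹ < ‖η‖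
    · rw [hψ0 _ (hsupp η hη), mul_zero, norm_zero]; positivity
    · push Not at hη
      rw [norm_mul]
      calc ‖fourierMeasure μ η‖ * ‖ψ (s • η)‖ ≤ (C₀ * s ^ a) * D := by
            gcongr
            · exact (hdecay η).trans (by gcongr; exact hdec η hη.1)
            · exact hD _
        _ = _ := by ring
  have hbB : ∀ η, ‖radialDeriv (fun ξ => fourierMeasure μ ξ * ψ (s • ξ)) η‖ ≤
      B * s ^ (a - 1) := by
    intro η
    rw [radialDeriv_mul_comp_smul (hμs.differentiable (by simp)) (hψ.differentiable (by simp))]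
    by_cases hη : ‖η‖ < s⁻¹ ∨ 4 * s⁻¹ < ‖η‖
    · rw [hψ0 _ (hsupp η hη), hψ0' _ (hsupp η hη)]
      simp only [mul_zero, add_zero, norm_zero]
      positivity
    · push Not at hη
      refine (norm_add_le _ _).trans ?_
      rw [norm_mul, norm_mul]
      calc ‖radialDeriv (fourierMeasure μ) η‖ * ‖ψ (s • η)‖ +
            ‖fourierMeasure μ η‖ * ‖radialDeriv ψ (s • η)‖
          ≤ (C₁ * (4 * s⁻¹) * s ^ a) * D + (C₀ * s ^ a) * D' := by
            gcongr
            · exact (hC₁' η).trans (by gcongr; exacts [hη.2, hdec η hη.1])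
            · exact hD _
            · exact (hdecay η).trans (by gcongr; exact hdec η hη.1)
            · exact hD' _
        _ = 4 * C₁ * D * (s⁻¹ * s ^ a) + C₀ * D' * s ^ a := by ring
        _ ≤ 4 * C₁ * D * s ^ (a - 1) + C₀ * D' * s ^ (a - 1) := by
            rw [hsa']; gcongr
        _ = _ := by rw [hB]; ring
  have key := lintegral_iSup_dilatedMultiplier_sq_le h
    (hμs.mul (hψ.comp (contDiff_const_smul s))) (r := s⁻¹) (δ := s) (by positivity) hs hbA hbB
    (fun η hη => by simp only [Function.comp, hψ0 _ (hsupp η hη), mul_zero])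
  refine key.trans ?_
  gcongr
  have h3 : (3 : ℝ≥0∞) = ENNReal.ofReal 3 := by simp
  rw [h3, ← ENNReal.ofReal_mul (by norm_num)]
  refine ENNReal.ofReal_le_ofReal (le_of_eq ?_)
  have e1 : s⁻¹ * (s ^ a) ^ 2 = s ^ (2 * a - 1) := by
    rw [Real.rpow_sub hs, Real.rpow_one, two_mul, Real.rpow_add hs]; ring
  have e2 : s * (s ^ (a - 1)) ^ 2 = s ^ (2 * a - 1) := by
    rw [← hsa', ← e1]; field_simp
  calc 3 * (s⁻¹ * (A * s ^ a) ^ 2 + s * (B * s ^ (a - 1)) ^ 2)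
      = 3 * (A ^ 2 * (s⁻¹ * (s ^ a) ^ 2) + B ^ 2 * (s * (s ^ (a - 1)) ^ 2)) := by ring
    _ = _ := by rw [e1, e2]; ring

theorem dilatedMultiplier_add {h Φ Ψ : V → ℂ} (hh : Integrable h) (hhc : Continuous h)
    (hΦ : Continuous Φ) (hΨ : Continuous Ψ) {A B : ℝ} (hA : ∀ η, ‖Φ η‖ ≤ A)
    (hB : ∀ η, ‖Ψ η‖ ≤ B) (t : ℝ) (x : V) :
    dilatedMultiplier h (fun ξ => Φ ξ + Ψ ξ) t x =
      dilatedMultiplier h Φ t x + dilatedMultiplier h Ψ t x := by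
  have hint : ∀ {Φ : V → ℂ} {A : ℝ}, Continuous Φ → (∀ η, ‖Φ η‖ ≤ A) →
      Integrable fun ξ => (𝐞 (inner ℝ ξ x) : ℂ) * (h ξ * Φ (t • ξ)) := by
    intro Φ A hΦ hA
    refine Integrable.mono' (hh.norm.mul_const A) (Continuous.aestronglyMeasurable ?_)
      (ae_of_all _ fun ξ => ?_)
    · have := Real.continuous_fourierChar
      fun_prop
    · rw [norm_mul, Circle.norm_coe, one_mul, norm_mul]
      gcongr
      exact hA _
  simp_rw [dilatedMultiplier_apply]
  rw [← integral_add (hint hΦ hA) (hint hΨ hB)]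
  refine integral_congr_ae (ae_of_all _ fun ξ => ?_)
  dsimp only
  ring

/-- The averages `f ∗ μ_t` as a telescoping sum over frequency scales `2 ^ j / s`. -/
theorem enorm_integral_comp_sub_smul_le_tsum (μ : Measure V) [IsFiniteMeasure μ] {R : ℝ}
    (hR : μ (closedBall 0 R)ᶜ = 0) (χ : SchwartzMap V ℂ) (hχ : χ 0 = 1)
    (f : SchwartzMap V ℂ) (s t : ℝ) (x : V) :
    ‖∫ y, f (x - t • y) ∂μ‖ₑ ≤
      ‖dilatedMultiplier (𝓕 f : SchwartzMap V ℂ)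
        (fun ξ => fourierMeasure μ ξ * χ (s • ξ)) t x‖ₑ +
      ∑' j : ℕ, ‖dilatedMultiplier (𝓕 f : SchwartzMap V ℂ) (fun ξ => fourierMeasure μ ξ *
        (fun η => χ ((2 : ℝ)⁻¹ • η) - χ η) ((s * 2⁻¹ ^ j) • ξ)) t x‖ₑ := by
  set h : SchwartzMap V ℂ := 𝓕 f with hh
  have hμc := (contDiff_fourierMeasure μ hR).continuous
  have hχc := χ.continuous
  obtain ⟨K, hK⟩ : ∃ K, ∀ y, ‖χ y‖ ≤ K := ⟨_, χ.norm_le_seminorm ℝ⟩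
  have hbχ : ∀ (u : ℝ) η, ‖fourierMeasure μ η * χ (u • η)‖ ≤ μ.real univ * K := by
    intro u η
    rw [norm_mul]
    gcongr
    exacts [norm_fourierMeasure_le μ η, hK _]
  have hbψ : ∀ (u : ℝ) η, ‖fourierMeasure μ η * (fun η => χ ((2 : ℝ)⁻¹ • η) - χ η) (u • η)‖ ≤
      μ.real univ * (K + K) := by
    intro u η
    rw [norm_mul]
    gcongr
    · exact norm_fourierMeasure_le μ η
    · exact (norm_sub_le _ _).trans (add_le_add (hK _) (hK _))
  have hpartial : ∀ J : ℕ, dilatedMultiplier h (fun ξ => fourierMeasure μ ξ *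
      χ ((s * 2⁻¹ ^ J) • ξ)) t x = dilatedMultiplier h (fun ξ => fourierMeasure μ ξ *
        χ (s • ξ)) t x + ∑ j ∈ Finset.range J, dilatedMultiplier h (fun ξ => fourierMeasure μ ξ *
        (fun η => χ ((2 : ℝ)⁻¹ • η) - χ η) ((s * 2⁻¹ ^ j) • ξ)) t x := by
    intro J
    induction J with
    | zero => simp
    | succ J ih =>
      rw [Finset.sum_range_succ, ← add_assoc, ← ih, ← dilatedMultiplier_add h.integrable
        h.continuous (by fun_prop) (by fun_prop) (hbχ _) (hbψ _)]
      congr 1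
      ext ξ
      have : s * 2⁻¹ ^ (J + 1) = 2⁻¹ * (s * 2⁻¹ ^ J) := by ring
      dsimp only
      rw [this, mul_smul]
      ring
  have hlim : Tendsto (fun J : ℕ => dilatedMultiplier h (fun ξ => fourierMeasure μ ξ *
      χ ((s * 2⁻¹ ^ J) • ξ)) t x) atTop (𝓝 (dilatedMultiplier h (fourierMeasure μ) t x)) := by
    refine tendsto_dilatedMultiplier h.integrable (fun J => by fun_prop)
      (A := μ.real univ * K) (fun J => hbχ _) (fun ξ => ?_) x
    have h1 : Tendsto (fun J : ℕ => (s * 2⁻¹ ^ J) • t • ξ) atTop (𝓝 ((s * 0) • t • ξ)) := by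
      refine Tendsto.smul_const (Tendsto.const_mul s ?_) _
      exact tendsto_pow_atTop_nhds_zero_of_lt_one (by norm_num) (by norm_num)
    have h2 := (hχc.tendsto _).comp h1
    rw [mul_zero, zero_smul, hχ] at h2
    simpa using h2.const_mul (fourierMeasure μ (t • ξ))
  rw [integral_comp_sub_smul_eq]
  refine le_of_tendsto' hlim.enorm fun J => ?_
  rw [hpartial J]
  refine (enorm_add_le _ _).trans ?_
  gcongr
  exact (enorm_sum_le _ _).trans (ENNReal.sum_le_tsum _)

/-- The basic inequality: at every frequency threshold `1 / s`, the low frequencies satisfy a weak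
`(1,1)` bound with constant `s ^ (b - n)` and the high frequencies an `L²` bound with constant
`s ^ (a - 1/2)`. -/
theorem exists_volume_lt_iSup_le (μ : Measure V) [IsFiniteMeasure μ] {R a b C₀ C₁ : ℝ}
    (hR0 : 0 < R) (hR : μ (closedBall 0 R)ᶜ = 0) (ha : 1 / 2 < a)
    (hdecay : ∀ ξ, ‖fourierMeasure μ ξ‖ ≤ C₀ * (1 + ‖ξ‖) ^ (-a)) (hC₁ : 0 ≤ C₁)
    (hF : ∀ x r, 0 < r → μ (ball x r) ≤ ENNReal.ofReal (C₁ * r ^ b)) :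
    ∃ C : ℝ, 0 ≤ C ∧ ∀ (f : SchwartzMap V ℂ) (s lam : ℝ), 0 < s → s ≤ 1 → 0 < lam →
      volume {x | ENNReal.ofReal lam < ⨆ (t : ℝ) (_ : 0 < t), ‖∫ y, f (x - t • y) ∂μ‖ₑ} ≤
        ENNReal.ofReal (C * s ^ (b - Module.finrank ℝ V) * lam⁻¹) * (∫⁻ x, ‖f x‖ₑ) +
        ENNReal.ofReal (C * s ^ (2 * a - 1) * (lam ^ 2)⁻¹) * ∫⁻ x, ‖f x‖ₑ ^ 2 := by
  obtain ⟨χ, hχ1, hχ2, -⟩ := exists_cutoff (V := V) 1 one_pos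
  set ψ : V → ℂ := fun η => χ ((2 : ℝ)⁻¹ • η) - χ η with hψ
  have hψs : ContDiff ℝ (⊤ : ℕ∞) ψ :=
    ((χ.smooth ⊤).comp (contDiff_const_smul _)).sub (χ.smooth ⊤)
  have hψ0 : ∀ η, ‖η‖ < 1 ∨ 4 < ‖η‖ → ψ η = 0 := by
    intro η hη
    have hn : ‖(2 : ℝ)⁻¹ • η‖ = 2⁻¹ * ‖η‖ := by rw [norm_smul]; norm_num
    simp only [hψ]
    rcases hη with hη | hη
    · rw [hχ1 _ (by rw [hn]; linarith [norm_nonneg η]), hχ1 _ hη.le, sub_self]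
    · rw [hχ2 _ (by rw [hn]; linarith), hχ2 _ (by linarith), sub_self]
  obtain ⟨CL, hCL0, hCL⟩ := exists_enorm_lowFrequency_le μ hR0 hR hC₁ hF χ
  obtain ⟨CH, hCH0, hCH⟩ := exists_lintegral_iSup_highFrequency_sq_le μ hR0 hR (by linarith)
    hdecay hψs hψ0
  set n := Module.finrank ℝ V with hn
  set e := 2 * a - 1 with he
  have he0 : 0 < e := by linarith
  -- the annulus with index `j` gains `2 ^ (-e j)`, and the weights `θ ^ j`, which enter squared,
  -- use up half of it
  set θ : ℝ := 2 ^ (-(e / 4)) with hθ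
  have hθ0 : 0 < θ := by positivity
  have hθ1 : θ < 1 := Real.rpow_lt_one_of_one_lt_of_neg one_lt_two (by linarith)
  set q : ℝ := 2 ^ (-(e / 2)) with hq
  have hq0 : 0 < q := by positivity
  have hq1 : q < 1 := Real.rpow_lt_one_of_one_lt_of_neg one_lt_two (by linarith)
  set C' := 4 * CH * ((1 - θ) ^ 2)⁻¹ * (1 - q)⁻¹ with hC'
  have h1q : 0 < 1 - q := by linarith
  have h1θ : 0 < 1 - θ := by linarith
  have hC'0 : 0 ≤ C' := by positivity
  refine ⟨max (2 * 4 ^ n * CL) C', le_max_of_le_right hC'0, fun f s lam hs hs1 hlam => ?_⟩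
  set h : SchwartzMap V ℂ := 𝓕 f with hh
  set S : ℕ → V → ℝ≥0∞ := fun j x => ⨆ (t : ℝ) (_ : 0 < t), ‖dilatedMultiplier h
    (fun ξ => fourierMeasure μ ξ * ψ ((s * 2⁻¹ ^ j) • ξ)) t x‖ₑ with hS
  have hSm : ∀ j, Measurable (S j) := by
    intro j
    refine LowerSemicontinuous.measurable ?_
    refine lowerSemicontinuous_iSup fun t => lowerSemicontinuous_iSup fun _ => ?_
    refine Continuous.lowerSemicontinuous ?_
    have hμc := (contDiff_fourierMeasure μ hR).continuous
    have hψc := hψs.continuous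
    obtain ⟨D, hD⟩ := (hasCompactSupport_of_norm hψ0).exists_bound_of_continuous hψc
    have := continuous_dilatedMultiplier (Φ := fun ξ => fourierMeasure μ ξ *
      ψ ((s * 2⁻¹ ^ j) • ξ)) h.integrable h.continuous (by fun_prop)
      (A := μ.real univ * D) (fun η => by
        rw [norm_mul]; gcongr; exacts [norm_fourierMeasure_le μ η, hD _])
    have h2 : Continuous fun x => dilatedMultiplier h (fun ξ => fourierMeasure μ ξ *
      ψ ((s * 2⁻¹ ^ j) • ξ)) t x := by fun_prop
    exact h2.enorm
  have hsub : {x | ENNReal.ofReal lam < ⨆ (t : ℝ) (_ : 0 < t), ‖∫ y, f (x - t • y) ∂μ‖ₑ} ⊆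
      {x | ENNReal.ofReal (lam / 2) <
        ENNReal.ofReal (CL * s ^ (b - n)) * hlMaximal (fun y => ‖f y‖ₑ) x} ∪
      {x | ENNReal.ofReal (lam / 2) < ∑' j, S j x} := by
    intro x hx
    by_contra hcon
    simp only [mem_union, mem_ofPred_eq, not_or, not_lt] at hcon hx
    refine hx.not_ge (iSup₂_le fun t ht => ?_)
    have hsplit := enorm_integral_comp_sub_smul_le_tsum μ hR χ (hχ1 0 (by simp)) f s t x
    calc ‖∫ y, f (x - t • y) ∂μ‖ₑ ≤ _ := hsplit
      _ ≤ ENNReal.ofReal (CL * s ^ (b - n)) * hlMaximal (fun y => ‖f y‖ₑ) x + ∑' j, S j x := by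
          gcongr with j
          · exact hCL f x t s ht hs hs1
          · exact le_iSup₂ (f := fun (t : ℝ) (_ : 0 < t) => ‖dilatedMultiplier h
              (fun ξ => fourierMeasure μ ξ * ψ ((s * 2⁻¹ ^ j) • ξ)) t x‖ₑ) t ht
      _ ≤ ENNReal.ofReal (lam / 2) + ENNReal.ofReal (lam / 2) := add_le_add hcon.1 hcon.2
      _ = ENNReal.ofReal lam := by
          rw [← ENNReal.ofReal_add (by positivity) (by positivity), add_halves]
  refine (measure_mono hsub).trans ((measure_union_le _ _).trans (add_le_add ?_ ?_))
  · have hc0 : 0 ≤ CL * s ^ (b - n) := by positivity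
    rcases hc0.eq_or_lt with hc | hc
    · simp [← hc]
    have hset : {x | ENNReal.ofReal (lam / 2) <
        ENNReal.ofReal (CL * s ^ (b - n)) * hlMaximal (fun y => ‖f y‖ₑ) x} ⊆
        {x | ENNReal.ofReal (lam / 2 / (CL * s ^ (b - n))) <
          hlMaximal (fun y => ‖f y‖ₑ) x} := by
      intro x hx
      simp only [mem_ofPred_eq] at hx ⊢
      rw [ENNReal.ofReal_div_of_pos hc]
      refine ENNReal.div_lt_of_lt_mul ?_
      rwa [mul_comm]
    refine (measure_mono hset).trans ((volume_lt_hlMaximal_le _ ?_ ENNReal.ofReal_ne_top).trans ?_)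
    · simp only [ne_eq, ENNReal.ofReal_eq_zero, not_le]; positivity
    · rw [ENNReal.mul_div_right_comm]
      gcongr
      have h4 : (4 : ℝ≥0∞) ^ n = ENNReal.ofReal (4 ^ n) := by
        rw [ENNReal.ofReal_pow (by norm_num)]; simp
      rw [h4, ← ENNReal.ofReal_div_of_pos (by positivity)]
      refine ENNReal.ofReal_le_ofReal ?_
      calc (4 : ℝ) ^ n / (lam / 2 / (CL * s ^ (b - n)))
          = (2 * 4 ^ n * CL) * s ^ (b - n) * lam⁻¹ := by field_simp
        _ ≤ _ := by gcongr; exact le_max_left _ _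
  · refine (measure_lt_tsum_le volume S (by positivity) hθ0 hθ1).trans ?_
    have hj : ∀ j, volume {x | ENNReal.ofReal (lam / 2 * (1 - θ) * θ ^ j) < S j x} ≤
        ENNReal.ofReal (4 * CH * ((1 - θ) ^ 2)⁻¹ * s ^ e * (lam ^ 2)⁻¹ * q ^ j) *
          ∫⁻ x, ‖f x‖ₑ ^ 2 := by
      intro j
      set c := lam / 2 * (1 - θ) * θ ^ j with hc
      have hc0 : 0 < c := by positivity
      calc volume {x | ENNReal.ofReal c < S j x}
          ≤ volume {x | ENNReal.ofReal c ^ 2 ≤ S j x ^ 2} := by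
            refine measure_mono fun x hx => ?_
            simp only [mem_ofPred_eq] at hx ⊢
            gcongr
        _ ≤ (∫⁻ x, S j x ^ 2) / ENNReal.ofReal c ^ 2 := by
            refine meas_ge_le_lintegral_div ((hSm j).pow_const 2).aemeasurable ?_ (by simp)
            simpa using hc0
        _ ≤ (ENNReal.ofReal (CH * (s * 2⁻¹ ^ j) ^ e) * ∫⁻ x, ‖f x‖ₑ ^ 2) /
              ENNReal.ofReal c ^ 2 := by
            gcongr
            rw [← lintegral_enorm_fourier_sq f]
            refine hCH h (s * 2⁻¹ ^ j) (by positivity) ?_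
            exact mul_le_one₀ hs1 (by positivity) (pow_le_one₀ (by norm_num) (by norm_num))
        _ = _ := by
            rw [ENNReal.mul_div_right_comm, ← ENNReal.ofReal_pow hc0.le,
              ← ENNReal.ofReal_div_of_pos (by positivity)]
            congr 2
            have h1 : ((2⁻¹ : ℝ) ^ j) ^ e = q ^ j * (θ ^ j) ^ 2 := by
              rw [hq, hθ, ← Real.rpow_natCast, ← Real.rpow_natCast, ← Real.rpow_natCast,
                ← Real.rpow_natCast, ← Real.rpow_mul (by positivity),
                ← Real.rpow_mul (by positivity), ← Real.rpow_mul (by positivity),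
                ← Real.rpow_mul (by positivity),
                ← Real.rpow_add (by norm_num), Real.inv_rpow (by norm_num),
                ← Real.rpow_neg (by norm_num)]
              congr 1
              push_cast
              ring
            rw [Real.mul_rpow hs.le (by positivity), h1, hc]
            field_simp
            ring
    refine (ENNReal.tsum_le_tsum hj).trans ?_
    rw [ENNReal.tsum_mul_right]
    gcongr
    have : ∀ j : ℕ, ENNReal.ofReal (4 * CH * ((1 - θ) ^ 2)⁻¹ * s ^ e * (lam ^ 2)⁻¹ * q ^ j) =
        ENNReal.ofReal (4 * CH * ((1 - θ) ^ 2)⁻¹ * s ^ e * (lam ^ 2)⁻¹) * ENNReal.ofReal q ^ j := by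
      intro j
      rw [ENNReal.ofReal_mul (by positivity), ENNReal.ofReal_pow hq0.le]
    simp_rw [this]
    rw [ENNReal.tsum_mul_left, ENNReal.tsum_geometric, ← ENNReal.ofReal_one,
      ← ENNReal.ofReal_sub _ hq0.le, ← ENNReal.ofReal_inv_of_pos h1q,
      ← ENNReal.ofReal_mul (by positivity)]
    refine ENNReal.ofReal_le_ofReal ?_
    calc _ = C' * s ^ e * (lam ^ 2)⁻¹ := by rw [hC']; ring
      _ ≤ _ := by gcongr; exact le_max_right _ _

end HighFrequency

end DilationMaximal

end

noncomputable section

namespace DilationMaximal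

open Metric Filter Topology FourierTransform

/-! ### The restricted weak-type inequality -/

section RestrictedWeakType

theorem exists_schwartz_between {V : Type*} [NormedAddCommGroup V] [InnerProductSpace ℝ V]
    [FiniteDimensional ℝ V] {K U : Set V} (hK : IsCompact K) (hU : IsOpen U) (hKU : K ⊆ U) :
    ∃ f : SchwartzMap V ℂ, ∃ g : V → ℝ, (∀ x, f x = g x) ∧ (∀ x, 0 ≤ g x ∧ g x ≤ 1) ∧
      (∀ x ∈ K, g x = 1) ∧ (∀ x ∉ U, g x = 0) := by
  obtain ⟨W, hWo, hKW, hWU, hWc⟩ := exists_open_between_and_isCompact_closure hK hU hKU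
  obtain ⟨g, hg, hg01, hgs, hg1⟩ := exists_contMDiff_support_eq_eq_one_iff
    (modelWithCornersSelf ℝ V) (n := (⊤ : ℕ∞)) hWo hK.isClosed hKW
  have hgc : HasCompactSupport g := by
    refine hWc.of_isClosed_subset (isClosed_tsupport g) ?_
    rw [tsupport, hgs]
  have hs : HasCompactSupport fun η => (g η : ℂ) :=
    hgc.comp_left (g := fun r : ℝ => (r : ℂ)) (by simp)
  have hd : ContDiff ℝ (⊤ : ℕ∞) fun η => (g η : ℂ) :=
    Complex.ofRealCLM.contDiff.comp hg.contDiff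
  refine ⟨hs.toSchwartzMap hd, g, fun x => rfl, fun x => hg01 (mem_range_self x),
    fun x hx => (hg1 x).1 hx, fun x hx => ?_⟩
  by_contra hne
  have : x ∈ Function.support g := hne
  rw [hgs] at this
  exact hx (hWU (subset_closure this))

variable {V : Type*} [NormedAddCommGroup V] [InnerProductSpace ℝ V] [MeasurableSpace V]

/-- The maximal function `sup_{t > 0} ∫ g(x - t y) dμ(y)` of a function with values in `[0, ∞]`. -/
def posMaximal (μ : Measure V) (g : V → ℝ≥0∞) (x : V) : ℝ≥0∞ :=
  ⨆ (t : ℝ) (_ : 0 < t), ∫⁻ y, g (x - t • y) ∂μ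

theorem lintegral_le_posMaximal (μ : Measure V) (g : V → ℝ≥0∞) (x : V) {t : ℝ} (ht : 0 < t) :
    ∫⁻ y, g (x - t • y) ∂μ ≤ posMaximal μ g x :=
  le_iSup₂ (f := fun (t : ℝ) (_ : 0 < t) => ∫⁻ y, g (x - t • y) ∂μ) t ht

theorem posMaximal_mono (μ : Measure V) {f g : V → ℝ≥0∞} (h : f ≤ g) :
    posMaximal μ f ≤ posMaximal μ g := by
  intro x
  unfold posMaximal
  gcongr
  exact h _

theorem posMaximal_le_of_le_const (μ : Measure V) {g : V → ℝ≥0∞} {c : ℝ≥0∞} (h : ∀ x, g x ≤ c)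
    (x : V) : posMaximal μ g x ≤ c * μ univ := by
  refine iSup₂_le fun t _ => ?_
  calc ∫⁻ y, g (x - t • y) ∂μ ≤ ∫⁻ _, c ∂μ := lintegral_mono fun y => h _
    _ = _ := lintegral_const c

theorem posMaximal_const_mul_le (μ : Measure V) (g : V → ℝ≥0∞) {c : ℝ≥0∞} (hc : c ≠ ∞) (x : V) :
    posMaximal μ (fun y => c * g y) x ≤ c * posMaximal μ g x := by
  refine iSup₂_le fun t ht => ?_
  rw [lintegral_const_mul' _ _ hc]
  gcongr
  exact lintegral_le_posMaximal μ g x ht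

variable [BorelSpace V]

theorem measurable_comp_sub_smul {β : Type*} [MeasurableSpace β] {g : V → β} (hg : Measurable g)
    (x : V) (t : ℝ) : Measurable fun y => g (x - t • y) :=
  hg.comp (by fun_prop)

theorem posMaximal_tsum_le {ι : Type*} [Countable ι] (μ : Measure V) {g : ι → V → ℝ≥0∞}
    (hg : ∀ i, Measurable (g i)) (x : V) :
    posMaximal μ (fun y => ∑' i, g i y) x ≤ ∑' i, posMaximal μ (g i) x := by
  refine iSup₂_le fun t ht => ?_
  rw [lintegral_tsum fun i => (measurable_comp_sub_smul (hg i) x t).aemeasurable]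
  gcongr with i
  exact lintegral_le_posMaximal μ (g i) x ht

theorem posMaximal_add_le (μ : Measure V) {f g : V → ℝ≥0∞} (hf : Measurable f) (x : V) :
    posMaximal μ (fun y => f y + g y) x ≤ posMaximal μ f x + posMaximal μ g x := by
  refine iSup₂_le fun t ht => ?_
  rw [lintegral_add_left (measurable_comp_sub_smul hf x t)]
  gcongr
  exacts [lintegral_le_posMaximal μ f x ht, lintegral_le_posMaximal μ g x ht]

variable [FiniteDimensional ℝ V]

/-- The restricted weak-type inequality for `μ`: the maximal operator maps indicator functions
into weak `L^p`. -/
def RestrictedWeakType (μ : Measure V) (p : ℝ) : Prop :=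
  ∃ C : ℝ, 0 ≤ C ∧ ∀ (E : Set V), MeasurableSet E → ∀ lam : ℝ, 0 < lam →
    volume {x | ENNReal.ofReal lam < posMaximal μ (E.indicator 1) x} ≤
      ENNReal.ofReal (C * lam ^ (-p)) * volume E

/-- Optimizing the frequency threshold gives the restricted weak-type inequality for indicator
functions of compact sets. -/
theorem exists_volume_lt_posMaximal_compact_le (μ : Measure V) [IsFiniteMeasure μ]
    {R a b C₀ C₁ : ℝ} (hR0 : 0 < R) (hR : μ (closedBall 0 R)ᶜ = 0) (ha : 1 / 2 < a)
    (hb : b ≤ Module.finrank ℝ V)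
    (hdecay : ∀ ξ, ‖fourierMeasure μ ξ‖ ≤ C₀ * (1 + ‖ξ‖) ^ (-a)) (hC₁ : 0 ≤ C₁)
    (hF : ∀ x r, 0 < r → μ (ball x r) ≤ ENNReal.ofReal (C₁ * r ^ b)) :
    ∃ C : ℝ, 0 ≤ C ∧ ∀ (K U : Set V), IsCompact K → IsOpen U → K ⊆ U → ∀ lam : ℝ, 0 < lam →
      volume {x | ENNReal.ofReal lam < posMaximal μ (K.indicator 1) x} ≤
        ENNReal.ofReal (C * lam ^ (-((2 * (Module.finrank ℝ V - b) + 2 * a - 1) /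
          (Module.finrank ℝ V - b + 2 * a - 1)))) * volume U := by
  obtain ⟨C, hC0, hC⟩ := exists_volume_lt_iSup_le μ hR0 hR ha hdecay hC₁ hF
  set n : ℝ := ((Module.finrank ℝ V : ℕ) : ℝ) with hn
  set γ := n - b + 2 * a - 1 with hγ
  have hγ0 : 0 < γ := by linarith
  set p := (2 * (n - b) + 2 * a - 1) / γ with hp
  set A := μ.real univ + 1 with hA
  have hA0 : 0 < A := by positivity
  refine ⟨C * A ^ (-((b - n) / γ)) + C * A ^ (-((2 * a - 1) / γ)), by positivity, ?_⟩
  intro K U hK hU hKU lam hlam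
  rcases le_or_gt A lam with hAl | hAl
  · have : {x | ENNReal.ofReal lam < posMaximal μ (K.indicator 1) x} = ∅ := by
      refine eq_empty_of_forall_notMem fun x hx => ?_
      refine (not_le.2 (show ENNReal.ofReal lam < _ from hx)) ?_
      calc posMaximal μ (K.indicator 1) x ≤ 1 * μ univ :=
            posMaximal_le_of_le_const μ (fun y => indicator_le_self' (by simp) y) x
        _ = ENNReal.ofReal (μ.real univ) := by rw [one_mul, ofReal_measureReal]
        _ ≤ ENNReal.ofReal lam := ENNReal.ofReal_le_ofReal (by linarith)
    rw [this, measure_empty]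
    exact zero_le
  obtain ⟨f, g, hfg, hg01, hg1, hg0⟩ := exists_schwartz_between hK hU hKU
  have hgc : Continuous g := by
    have h1 : g = fun x => (f x).re := by ext x; rw [hfg]; simp
    rw [h1]
    exact Complex.continuous_re.comp f.continuous
  have hfe : ∀ x, ‖f x‖ₑ ≤ U.indicator 1 x := by
    intro x
    by_cases hx : x ∈ U
    · rw [indicator_of_mem hx, hfg, ← ofReal_norm, Complex.norm_real,
        Real.norm_of_nonneg (hg01 x).1, Pi.one_apply, ENNReal.ofReal_le_one]
      exact (hg01 x).2
    · rw [hfg, hg0 x hx]; simp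
  have hfe2 : ∀ x, ‖f x‖ₑ ^ 2 ≤ U.indicator 1 x := by
    intro x
    have h1 : ‖f x‖ₑ ≤ 1 := (hfe x).trans (indicator_le_self' (by simp) x)
    calc ‖f x‖ₑ ^ 2 = ‖f x‖ₑ * ‖f x‖ₑ := sq _
      _ ≤ ‖f x‖ₑ * 1 := by gcongr
      _ ≤ _ := by rw [mul_one]; exact hfe x
  have hmax : ∀ x, posMaximal μ (K.indicator 1) x ≤
      ⨆ (t : ℝ) (_ : 0 < t), ‖∫ y, f (x - t • y) ∂μ‖ₑ := by
    intro x
    unfold posMaximal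
    gcongr with t ht
    have hgi : Integrable (fun y => g (x - t • y)) μ := by
      refine Integrable.mono' (integrable_const (1 : ℝ))
        (hgc.comp (by fun_prop)).aestronglyMeasurable (ae_of_all _ fun y => ?_)
      rw [Real.norm_of_nonneg (hg01 _).1]
      exact (hg01 _).2
    have h1 : ∫ y, f (x - t • y) ∂μ = ((∫ y, g (x - t • y) ∂μ : ℝ) : ℂ) := by
      simp_rw [hfg]
      exact integral_ofReal
    rw [h1, ← ofReal_norm, Complex.norm_real,
      Real.norm_of_nonneg (integral_nonneg fun y => (hg01 _).1),
      ofReal_integral_eq_lintegral_ofReal hgi (ae_of_all _ fun y => (hg01 _).1)]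
    refine lintegral_mono fun y => ?_
    by_cases hy : x - t • y ∈ K
    · rw [indicator_of_mem hy, hg1 _ hy]; simp
    · rw [indicator_of_notMem hy]; exact zero_le
  -- the threshold balancing the two terms
  set s := (lam / A) ^ γ⁻¹ with hs
  have hlA : 0 < lam / A := by positivity
  have hs0 : 0 < s := by positivity
  have hs1 : s ≤ 1 := Real.rpow_le_one hlA.le ((div_le_one hA0).2 hAl.le) (by positivity)
  have hspow : ∀ e : ℝ, s ^ e = lam ^ (e / γ) * A ^ (-(e / γ)) := by
    intro e
    rw [hs, ← Real.rpow_mul hlA.le, inv_mul_eq_div, Real.div_rpow hlam.le hA0.le,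
      Real.rpow_neg hA0.le, div_eq_mul_inv]
  calc volume {x | ENNReal.ofReal lam < posMaximal μ (K.indicator 1) x}
      ≤ volume {x | ENNReal.ofReal lam < ⨆ (t : ℝ) (_ : 0 < t), ‖∫ y, f (x - t • y) ∂μ‖ₑ} :=
        measure_mono fun x hx => lt_of_lt_of_le hx (hmax x)
    _ ≤ _ := hC f s lam hs0 hs1 hlam
    _ ≤ ENNReal.ofReal (C * s ^ (b - n) * lam⁻¹) * volume U +
        ENNReal.ofReal (C * s ^ (2 * a - 1) * (lam ^ 2)⁻¹) * volume U := by
        gcongr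
        · refine (lintegral_mono hfe).trans (le_of_eq ?_)
          rw [lintegral_indicator_one hU.measurableSet]
        · refine (lintegral_mono hfe2).trans (le_of_eq ?_)
          rw [lintegral_indicator_one hU.measurableSet]
    _ = _ := by
        rw [← add_mul, ← ENNReal.ofReal_add (by positivity) (by positivity)]
        congr 2
        have e1 : s ^ (b - n) * lam⁻¹ = A ^ (-((b - n) / γ)) * lam ^ (-p) := by
          have : -p = (b - n) / γ + -1 := by rw [hp]; field_simp; rw [hγ]; ring
          rw [hspow, this, Real.rpow_add hlam, Real.rpow_neg_one]; ring
        have e2 : s ^ (2 * a - 1) * (lam ^ 2)⁻¹ = A ^ (-((2 * a - 1) / γ)) * lam ^ (-p) := by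
          have : -p = (2 * a - 1) / γ + -2 := by rw [hp]; field_simp; rw [hγ]; ring
          rw [hspow, this, Real.rpow_add hlam, Real.rpow_neg hlam.le, Real.rpow_two]; ring
        rw [mul_assoc, mul_assoc, e1, e2]
        ring

/-- The restricted weak-type inequality at the critical exponent. The inequality for compact sets
passes to open sets by monotone convergence, and to all sets by outer regularity. -/
theorem restrictedWeakType_of_decay (μ : Measure V) [IsFiniteMeasure μ]
    {R a b C₀ C₁ : ℝ} (hR0 : 0 < R) (hR : μ (closedBall 0 R)ᶜ = 0) (ha : 1 / 2 < a)
    (hb : b ≤ Module.finrank ℝ V)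
    (hdecay : ∀ ξ, ‖fourierMeasure μ ξ‖ ≤ C₀ * (1 + ‖ξ‖) ^ (-a)) (hC₁ : 0 ≤ C₁)
    (hF : ∀ x r, 0 < r → μ (ball x r) ≤ ENNReal.ofReal (C₁ * r ^ b)) :
    RestrictedWeakType μ ((2 * (Module.finrank ℝ V - b) + 2 * a - 1) /
      (Module.finrank ℝ V - b + 2 * a - 1)) := by
  obtain ⟨C, hC0, hC⟩ := exists_volume_lt_posMaximal_compact_le μ hR0 hR ha hb hdecay hC₁ hF
  refine ⟨C, hC0, fun E _ lam hlam => ?_⟩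
  set c := C * lam ^ (-((2 * (Module.finrank ℝ V - b) + 2 * a - 1) /
      (Module.finrank ℝ V - b + 2 * a - 1))) with hc
  have hopen : ∀ U : Set V, IsOpen U →
      volume {x | ENNReal.ofReal lam < posMaximal μ (U.indicator 1) x} ≤
        ENNReal.ofReal c * volume U := by
    intro U hU
    obtain ⟨F, hFc, hFU, hFun, hFm⟩ := hU.exists_iUnion_isClosed
    set K : ℕ → Set V := fun m => F m ∩ closedBall 0 m with hK
    have hKc : ∀ m, IsCompact (K m) := fun m => (isCompact_closedBall _ _).inter_left (hFc m)
    have hKm : Monotone K := fun i j hij =>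
      inter_subset_inter (hFm hij) (closedBall_subset_closedBall (by exact_mod_cast hij))
    have hKU : ∀ m, K m ⊆ U := fun m => inter_subset_left.trans (hFU m)
    have hind : ∀ z, U.indicator (1 : V → ℝ≥0∞) z = ⨆ m, (K m).indicator 1 z := by
      intro z
      refine le_antisymm ?_ (iSup_le fun m => indicator_le_indicator_of_subset (hKU m) (by simp) z)
      by_cases hz : z ∈ U
      · rw [← hFun] at hz
        obtain ⟨i, hi⟩ := mem_iUnion.1 hz
        obtain ⟨j, hj⟩ := exists_nat_ge ‖z‖
        refine le_iSup_of_le (max i j) ?_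
        have hzK : z ∈ K (max i j) := by
          refine ⟨hFm (le_max_left i j) hi, ?_⟩
          rw [mem_closedBall, dist_zero_right]
          exact hj.trans (by exact_mod_cast le_max_right i j)
        rw [indicator_of_mem hzK]
        exact indicator_le_self' (by simp) z
      · rw [indicator_of_notMem hz]; exact zero_le
    have hsub : {x | ENNReal.ofReal lam < posMaximal μ (U.indicator 1) x} ⊆
        ⋃ m, {x | ENNReal.ofReal lam < posMaximal μ ((K m).indicator 1) x} := by
      intro x hx
      simp only [posMaximal, mem_ofPred_eq, lt_iSup_iff] at hx
      obtain ⟨t, ht, hx⟩ := hx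
      simp_rw [hind] at hx
      have hmono : Monotone fun m y => (K m).indicator (1 : V → ℝ≥0∞) (x - t • y) :=
        fun i j hij y => indicator_le_indicator_of_subset (hKm hij) (by simp) _
      rw [lintegral_iSup (fun m => measurable_comp_sub_smul
        (measurable_one.indicator (hKc m).measurableSet) x t) hmono, lt_iSup_iff] at hx
      obtain ⟨m, hx⟩ := hx
      exact mem_iUnion.2 ⟨m, hx.trans_le (lintegral_le_posMaximal μ _ x ht)⟩
    refine (measure_mono hsub).trans ?_
    rw [Monotone.measure_iUnion]
    · exact iSup_le fun m => hC (K m) U (hKc m) hU (hKU m) lam hlam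
    · intro i j hij x hx
      exact lt_of_lt_of_le hx (posMaximal_mono μ (indicator_le_indicator_of_subset (hKm hij)
        (by simp)) x)
  have hc0 : ENNReal.ofReal c ≠ ∞ := ENNReal.ofReal_ne_top
  refine ENNReal.le_of_forall_pos_le_add fun ε hε _ => ?_
  obtain ⟨U, hEU, hU, hUE⟩ := E.exists_isOpen_le_add volume
    (ε := ε / (ENNReal.ofReal c + 1)) (by simp [hε.ne'])
  calc volume {x | ENNReal.ofReal lam < posMaximal μ (E.indicator 1) x}
      ≤ volume {x | ENNReal.ofReal lam < posMaximal μ (U.indicator 1) x} :=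
        measure_mono fun x hx => lt_of_lt_of_le hx
          (posMaximal_mono μ (indicator_le_indicator_of_subset hEU (by simp)) x)
    _ ≤ ENNReal.ofReal c * volume U := hopen U hU
    _ ≤ ENNReal.ofReal c * (volume E + ε / (ENNReal.ofReal c + 1)) := by gcongr
    _ ≤ ENNReal.ofReal c * volume E + ε := by
        rw [mul_add]
        gcongr
        rw [← mul_div_assoc]
        refine ENNReal.div_le_of_le_mul ?_
        rw [mul_comm]
        gcongr
        exact le_self_add

end RestrictedWeakType

end DilationMaximal

end

noncomputable section

namespace DilationMaximal

open Metric Filter Topology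

/-! ### Dyadic level sets -/

section Dyadic

/-- The dyadic layers of `g` above height `c`; the value `∞` is included. -/
theorem le_add_tsum_two_pow_mul_indicator {α : Type*} (g : α → ℝ≥0∞) {c : ℝ≥0∞} (hc : c ≠ 0)
    (x : α) : g x ≤ c + ∑' k : ℕ, 2 ^ k * c * {z | 2 ^ k * c < g z}.indicator 1 x := by
  have hmin : ∀ m : ℕ, min (g x) (2 ^ m * c) ≤
      c + ∑ k ∈ Finset.range m, 2 ^ k * c * {z | 2 ^ k * c < g z}.indicator 1 x := by
    intro m
    induction m with
    | zero => simp
    | succ m ih =>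
      rw [Finset.sum_range_succ, ← add_assoc]
      by_cases hx : 2 ^ m * c < g x
      · rw [min_eq_right hx.le] at ih
        rw [indicator_of_mem (show x ∈ {z | 2 ^ m * c < g z} from hx), Pi.one_apply, mul_one]
        calc min (g x) (2 ^ (m + 1) * c) ≤ 2 ^ m * c + 2 ^ m * c :=
              (min_le_right _ _).trans (le_of_eq (by rw [pow_succ]; ring))
          _ ≤ _ := by gcongr
      · rw [min_eq_left (not_lt.1 hx)] at ih
        exact (min_le_left _ _).trans (ih.trans le_self_add)
  refine le_of_forall_lt_imp_le_of_dense fun r hr => ?_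
  have hT : Tendsto (fun m : ℕ => (2 : ℝ≥0∞) ^ m * c) atTop (𝓝 (∞ * c)) :=
    ENNReal.Tendsto.mul_const (ENNReal.tendsto_pow_atTop_nhds_top_iff.2 (by norm_num))
      (Or.inl (by simp))
  rw [ENNReal.top_mul hc] at hT
  obtain ⟨m, hm⟩ := (hT.eventually (lt_mem_nhds (hr.trans_le le_top))).exists
  refine (le_min hr.le hm.le).trans ((hmin m).trans ?_)
  gcongr
  exact ENNReal.sum_le_tsum _

/-- The dyadic layers of `g` dominate it, up to a factor `2`; the value `∞` is included. -/
theorem rpow_le_tsum_two_zpow {α : Type*} (g : α → ℝ≥0∞) {s : ℝ} (hs : 0 < s) (x : α) :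
    g x ^ s ≤ ∑' m : ℤ, (2 ^ (m + 1)) ^ s * {z | (2 : ℝ≥0∞) ^ m < g z}.indicator 1 x := by
  refine le_of_forall_lt_imp_le_of_dense fun r hr => ?_
  rcases eq_or_ne r 0 with rfl | hr0
  · exact zero_le
  have hrx : r ^ s⁻¹ < g x := by
    rwa [ENNReal.rpow_inv_lt_iff hs]
  obtain ⟨m, hm1, hm2⟩ := ENNReal.exists_mem_Ioc_zpow (x := r ^ s⁻¹) (y := 2)
    (by simp [hr0, hs, hs.le]) (hrx.trans_le le_top).ne (by norm_num) (by norm_num)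
  refine le_trans ?_ (ENNReal.le_tsum m)
  rw [indicator_of_mem (show x ∈ {z | (2 : ℝ≥0∞) ^ m < g z} from hm1.trans hrx), Pi.one_apply,
    mul_one]
  exact (ENNReal.rpow_inv_le_iff hs).1 hm2

theorem tsum_two_zpow_le {α : Type*} (g : α → ℝ≥0∞) {s : ℝ} (hs : 0 < s) (x : α) :
    ∑' m : ℤ, (2 ^ m) ^ s * {z | (2 : ℝ≥0∞) ^ m < g z}.indicator 1 x ≤
      (1 - 2 ^ (-s))⁻¹ * g x ^ s := by
  rcases eq_or_ne (g x) 0 with h0 | h0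
  · simp [h0]
  rcases eq_or_ne (g x) ∞ with hT | hT
  · rw [hT, ENNReal.top_rpow_of_pos hs, ENNReal.mul_top]
    · exact le_top
    · simp
  obtain ⟨M, hM1, hM2⟩ := ENNReal.exists_mem_Ioc_zpow (x := g x) (y := 2) h0 hT
    (by norm_num) (by norm_num)
  have hinj : Function.Injective fun k : ℕ => M - (k : ℤ) := fun i j h => by
    have h : M - (i : ℤ) = M - j := h
    omega
  rw [← hinj.tsum_eq]
  · calc ∑' k : ℕ, ((2 : ℝ≥0∞) ^ (M - (k : ℤ))) ^ s *
          {z | (2 : ℝ≥0∞) ^ (M - (k : ℤ)) < g z}.indicator 1 x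
        ≤ ∑' k : ℕ, (2 ^ M) ^ s * (2 ^ (-s)) ^ k := by
          refine ENNReal.tsum_le_tsum fun k => ?_
          have h1 : {z | (2 : ℝ≥0∞) ^ (M - (k : ℤ)) < g z}.indicator (1 : α → ℝ≥0∞) x ≤ 1 :=
            indicator_le_self _ _ x
          refine (mul_le_mul_right h1 _).trans (le_of_eq ?_)
          rw [mul_one, sub_eq_add_neg, ENNReal.zpow_add (by norm_num) (by norm_num),
            ENNReal.mul_rpow_of_nonneg _ _ hs.le]
          congr 1
          rw [← ENNReal.rpow_intCast, ← ENNReal.rpow_mul, ← ENNReal.rpow_natCast,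
            ← ENNReal.rpow_mul]
          congr 1
          push_cast
          ring
      _ = (2 ^ M) ^ s * (1 - 2 ^ (-s))⁻¹ := by rw [ENNReal.tsum_mul_left, ENNReal.tsum_geometric]
      _ ≤ _ := by rw [mul_comm]; gcongr
  · intro m hm
    by_contra hmr
    refine hm ?_
    have hMm : M < m := by
      by_contra hle
      exact hmr ⟨(M - m).toNat, by show M - ((M - m).toNat : ℤ) = m; omega⟩
    have : x ∉ {z | (2 : ℝ≥0∞) ^ m < g z} := by
      simp only [mem_ofPred_eq, not_lt]
      exact hM2.trans (ENNReal.zpow_le_of_le (by norm_num) hMm)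
    simp only
    rw [indicator_of_notMem this, mul_zero]

theorem one_sub_two_rpow_neg_inv_ne_top {s : ℝ} (hs : 0 < s) :
    (1 - (2 : ℝ≥0∞) ^ (-s))⁻¹ ≠ ∞ := by
  refine ENNReal.inv_ne_top.2 (tsub_pos_of_lt ?_).ne'
  exact ENNReal.rpow_lt_one_of_one_lt_of_neg (by norm_num) (by linarith)

/-- A domination of the level sets of `G` by those of `g`, with a loss of order `q`, bounds `L^s`
norms for `q < s`: this is the Marcinkiewicz interpolation argument in dyadic form. -/
theorem lintegral_rpow_le_of_measure_lt_le {α : Type*} [MeasurableSpace α] {ν : Measure α}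
    {G g : α → ℝ≥0∞} (hG : AEMeasurable G ν) (hg : AEMeasurable g ν) {C : ℝ≥0∞} {q s : ℝ}
    (hq : 0 ≤ q) (hqs : q < s)
    (h : ∀ m : ℤ, ν {x | 2 ^ m < G x} ≤ C * ∑' k : ℕ, (2 ^ k) ^ q * ν {x | 2 ^ k * 2 ^ m < g x}) :
    ∫⁻ x, G x ^ s ∂ν ≤ C * (2 ^ s * (1 - 2 ^ (-(s - q)))⁻¹ * (1 - 2 ^ (-s))⁻¹) *
      ∫⁻ x, g x ^ s ∂ν := by
  have hs : 0 < s := hq.trans_lt hqs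
  have hlevel : ∀ F : α → ℝ≥0∞, AEMeasurable F ν → ∀ m : ℤ,
      NullMeasurableSet {x | (2 : ℝ≥0∞) ^ m < F x} ν :=
    fun F hF m => nullMeasurableSet_lt aemeasurable_const hF
  have hint : ∀ F : α → ℝ≥0∞, AEMeasurable F ν → ∀ w : ℤ → ℝ≥0∞,
      ∫⁻ x, ∑' m : ℤ, w m * {z | (2 : ℝ≥0∞) ^ m < F z}.indicator 1 x ∂ν =
        ∑' m : ℤ, w m * ν {x | 2 ^ m < F x} := by
    intro F hF w
    rw [lintegral_tsum]
    · congr 1 with m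
      rw [lintegral_const_mul'' (f := {z | (2 : ℝ≥0∞) ^ m < F z}.indicator 1) _
          (aemeasurable_one.indicator₀ (hlevel F hF m)),
        lintegral_indicator_one₀ (hlevel F hF m)]
    · exact fun m => (aemeasurable_one.indicator₀ (hlevel F hF m)).const_mul _
  have hz : ∀ m : ℤ, ∀ k : ℕ, (2 : ℝ≥0∞) ^ k * 2 ^ m = 2 ^ (m + (k : ℤ)) := by
    intro m k
    rw [ENNReal.zpow_add (by norm_num) (by norm_num), mul_comm, zpow_natCast]
  calc ∫⁻ x, G x ^ s ∂ν
      ≤ ∑' m : ℤ, (2 ^ (m + 1)) ^ s * ν {x | 2 ^ m < G x} := by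
        rw [← hint G hG]
        exact lintegral_mono fun x => rpow_le_tsum_two_zpow G hs x
    _ ≤ ∑' m : ℤ, ∑' k : ℕ, C * (2 ^ s * (2 ^ (-(s - q))) ^ k) *
          ((2 ^ (m + (k : ℤ))) ^ s * ν {x | 2 ^ (m + (k : ℤ)) < g x}) := by
        gcongr with m
        refine (mul_le_mul_right (h m) _).trans (le_of_eq ?_)
        rw [← mul_assoc, ← ENNReal.tsum_mul_left]
        congr 1 with k
        rw [hz]
        have e : ((2 : ℝ≥0∞) ^ (m + 1)) ^ s * (2 ^ k) ^ q =
            2 ^ s * (2 ^ (-(s - q))) ^ k * (2 ^ (m + (k : ℤ))) ^ s := by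
          simp only [← ENNReal.rpow_intCast, ← ENNReal.rpow_natCast, ← ENNReal.rpow_mul]
          rw [← ENNReal.rpow_add _ _ (by norm_num) (by norm_num),
            ← ENNReal.rpow_add _ _ (by norm_num) (by norm_num),
            ← ENNReal.rpow_add _ _ (by norm_num) (by norm_num)]
          congr 1
          push_cast
          ring
        calc _ = C * (((2 : ℝ≥0∞) ^ (m + 1)) ^ s * (2 ^ k) ^ q) *
              ν {x | 2 ^ (m + (k : ℤ)) < g x} := by ring
          _ = _ := by rw [e]; ring
    _ = ∑' k : ℕ, C * (2 ^ s * (2 ^ (-(s - q))) ^ k) *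
          ∑' m : ℤ, (2 ^ m) ^ s * ν {x | 2 ^ m < g x} := by
        rw [ENNReal.tsum_comm]
        congr 1 with k
        rw [ENNReal.tsum_mul_left]
        congr 1
        exact (Equiv.addRight (k : ℤ)).tsum_eq fun m : ℤ =>
          ((2 : ℝ≥0∞) ^ m) ^ s * ν {x | 2 ^ m < g x}
    _ ≤ ∑' k : ℕ, C * (2 ^ s * (2 ^ (-(s - q))) ^ k) *
          ((1 - 2 ^ (-s))⁻¹ * ∫⁻ x, g x ^ s ∂ν) := by
        gcongr with k
        rw [← hint g hg, ← lintegral_const_mul' _ _ (one_sub_two_rpow_neg_inv_ne_top hs)]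
        exact lintegral_mono fun x => tsum_two_zpow_le g hs x
    _ = _ := by
        rw [ENNReal.tsum_mul_right, ENNReal.tsum_mul_left, ENNReal.tsum_mul_left,
          ENNReal.tsum_geometric]
        ring

end Dyadic

/-! ### Consequences of the restricted weak-type inequality -/

section Distribution

variable {V : Type*} [NormedAddCommGroup V] [InnerProductSpace ℝ V] [MeasurableSpace V]
  [BorelSpace V] [FiniteDimensional ℝ V]

/-- The level sets of the maximal function are controlled by those of `g`, with an arbitrarily
small loss in the exponent: cut `g` into its dyadic level sets above the height at which the
trivial bound applies. -/
theorem RestrictedWeakType.exists_volume_lt_le_tsum {μ : Measure V} [IsFiniteMeasure μ] {p q : ℝ}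
    (h : RestrictedWeakType μ p) (hp : 0 < p) (hpq : p < q) :
    ∃ C c : ℝ≥0, ∀ g : V → ℝ≥0∞, Measurable g → ∀ lam : ℝ≥0∞, lam ≠ 0 → lam ≠ ∞ →
      volume {x | lam < posMaximal μ g x} ≤
        C * ∑' k : ℕ, (2 ^ k) ^ q * volume {x | 2 ^ k * lam < c * g x} := by
  obtain ⟨C₀, hC₀, hC⟩ := h
  set A : ℝ≥0 := (μ univ).toNNReal + 1 with hA
  have hAμ : μ univ ≤ A := by
    rw [hA, ENNReal.coe_add, ENNReal.coe_toNNReal (measure_ne_top μ _)]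
    exact le_self_add
  have hA0 : 0 < A := by positivity
  -- the geometric weights `θ ^ k` that raise the exponent from `p` to exactly `q`
  set θ : ℝ := 2 ^ (1 - q / p) with hθ
  have hθ0 : 0 < θ := by positivity
  have hθ1 : θ < 1 := by
    refine Real.rpow_lt_one_of_one_lt_of_neg (by norm_num) ?_
    have : 1 < q / p := (one_lt_div hp).2 hpq
    linarith
  have hA1 : 0 < A * (1 - θ) := mul_pos (by exact_mod_cast hA0) (by linarith)
  refine ⟨(C₀ * (A * (1 - θ)) ^ (-p)).toNNReal, 2 * A, fun g hg lam h0 hT => ?_⟩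
  lift lam to ℝ≥0 using hT
  have hl0 : 0 < lam := by
    rw [pos_iff_ne_zero]; exact_mod_cast h0
  set E : ℕ → Set V := fun k => {x | 2 ^ k * (lam : ℝ≥0∞) < (2 * A : ℝ≥0) * g x} with hE
  have hEm : ∀ k, MeasurableSet (E k) := fun k =>
    measurableSet_lt measurable_const (hg.const_mul _)
  have hsub : {x | (lam : ℝ≥0∞) < posMaximal μ g x} ⊆ {x | ENNReal.ofReal (A * lam) <
      ∑' k : ℕ, 2 ^ k * (lam : ℝ≥0∞) * posMaximal μ ((E k).indicator 1) x} := by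
    intro x hx
    have h1 : ((2 * A : ℝ≥0) : ℝ≥0∞) * posMaximal μ g x ≤
        posMaximal μ (fun y => (2 * A : ℝ≥0) * g y) x := by
      have hne : ((2 * A : ℝ≥0) : ℝ≥0∞) ≠ 0 := by exact_mod_cast (by positivity : 2 * A ≠ 0)
      have h2 := posMaximal_const_mul_le μ (fun y => ((2 * A : ℝ≥0) : ℝ≥0∞) * g y)
        (ENNReal.inv_ne_top.2 hne) x
      simp_rw [← mul_assoc, ENNReal.inv_mul_cancel hne ENNReal.coe_ne_top, one_mul] at h2
      calc ((2 * A : ℝ≥0) : ℝ≥0∞) * posMaximal μ g x ≤ _ := mul_le_mul_right h2 _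
        _ = _ := by rw [← mul_assoc, ENNReal.mul_inv_cancel hne ENNReal.coe_ne_top, one_mul]
    have h3 : posMaximal μ (fun y => (2 * A : ℝ≥0) * g y) x ≤ A * lam +
        ∑' k : ℕ, 2 ^ k * (lam : ℝ≥0∞) * posMaximal μ ((E k).indicator 1) x := by
      refine (posMaximal_mono μ (fun y => le_add_tsum_two_pow_mul_indicator
        (fun y => ((2 * A : ℝ≥0) : ℝ≥0∞) * g y) h0 y) x).trans ?_
      refine (posMaximal_add_le μ measurable_const x).trans ?_
      gcongr
      · refine (posMaximal_le_of_le_const μ (fun _ => le_rfl) x).trans ?_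
        rw [mul_comm]
        gcongr
      · refine (posMaximal_tsum_le μ
          (fun k => (measurable_one.indicator (hEm k)).const_mul _) x).trans ?_
        gcongr with k
        exact posMaximal_const_mul_le μ _ (ENNReal.mul_ne_top (by simp) ENNReal.coe_ne_top) x
    have h4 : ((A * lam : ℝ≥0) : ℝ≥0∞) + (A * lam : ℝ≥0) < (A * lam : ℝ≥0) +
        ∑' k : ℕ, 2 ^ k * (lam : ℝ≥0∞) * posMaximal μ ((E k).indicator 1) x := by
      calc ((A * lam : ℝ≥0) : ℝ≥0∞) + (A * lam : ℝ≥0) = (2 * A : ℝ≥0) * (lam : ℝ≥0∞) := by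
            push_cast; ring
        _ < (2 * A : ℝ≥0) * posMaximal μ g x := by
            refine ENNReal.mul_lt_mul_right ?_ ENNReal.coe_ne_top hx
            exact_mod_cast (by positivity : 2 * A ≠ 0)
        _ ≤ _ := h1.trans (h3.trans (le_of_eq (by push_cast; rfl)))
    have h5 := lt_of_add_lt_add_left h4
    rw [mem_ofPred_eq]
    convert h5 using 1
    rw [← NNReal.coe_mul, ENNReal.ofReal_coe_nnreal]
  refine (measure_mono hsub).trans ((measure_lt_tsum_le volume _ (by positivity) hθ0 hθ1).trans ?_)
  rw [← ENNReal.tsum_mul_left]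
  gcongr with k
  have hsub2 : {x | ENNReal.ofReal (A * lam * (1 - θ) * θ ^ k) <
      2 ^ k * (lam : ℝ≥0∞) * posMaximal μ ((E k).indicator 1) x} ⊆
      {x | ENNReal.ofReal (A * (1 - θ) * (θ / 2) ^ k) < posMaximal μ ((E k).indicator 1) x} := by
    intro x hx
    rw [mem_ofPred_eq] at hx ⊢
    by_contra hle
    refine absurd hx (not_lt.2 ?_)
    calc 2 ^ k * (lam : ℝ≥0∞) * posMaximal μ ((E k).indicator 1) x
        ≤ ENNReal.ofReal (2 ^ k * lam) * ENNReal.ofReal (A * (1 - θ) * (θ / 2) ^ k) := by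
          refine mul_le_mul' (le_of_eq ?_) (not_lt.1 hle)
          rw [ENNReal.ofReal_mul (by positivity), ENNReal.ofReal_coe_nnreal,
            ENNReal.ofReal_pow (by norm_num)]
          simp
      _ = _ := by
          rw [← ENNReal.ofReal_mul (by positivity)]
          congr 1
          rw [div_pow]
          field_simp
  refine (measure_mono hsub2).trans ((hC (E k) (hEm k) _ (by positivity)).trans (le_of_eq ?_))
  rw [← mul_assoc]
  congr 1
  rw [Real.mul_rpow hA1.le (by positivity), ← mul_assoc, ENNReal.ofReal_mul (by positivity)]
  congr 1
  have e1 : ((θ / 2) ^ k) ^ (-p) = (2 : ℝ) ^ (k * q) := by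
    have : θ / 2 = 2 ^ (-(q / p)) := by
      rw [hθ, sub_eq_neg_add, Real.rpow_add (by norm_num), Real.rpow_one]
      field_simp
    rw [this, ← Real.rpow_natCast, ← Real.rpow_mul (by positivity),
      ← Real.rpow_mul (by positivity)]
    congr 1
    field_simp
  rw [e1, ← ENNReal.ofReal_rpow_of_pos (by norm_num), ENNReal.ofReal_ofNat,
    ENNReal.rpow_mul, ENNReal.rpow_natCast]

/-- The weak-type `(s, s)` inequality, for exponents `s` above the critical one. -/
theorem RestrictedWeakType.exists_volume_lt_le_lintegral {μ : Measure V} [IsFiniteMeasure μ]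
    {p s : ℝ} (h : RestrictedWeakType μ p) (hp : 0 < p) (hps : p < s) :
    ∃ C : ℝ≥0, ∀ g : V → ℝ≥0∞, Measurable g → ∀ lam : ℝ≥0∞, lam ≠ 0 → lam ≠ ∞ →
      volume {x | lam < posMaximal μ g x} ≤ C / lam ^ s * ∫⁻ x, g x ^ s := by
  obtain ⟨q, hpq, hqs⟩ := exists_between hps
  obtain ⟨C, c, hC⟩ := h.exists_volume_lt_le_tsum hp hpq
  have hs : 0 < s := hp.trans hps
  have hK := one_sub_two_rpow_neg_inv_ne_top (sub_pos.2 hqs)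
  set K := (1 - (2 : ℝ≥0∞) ^ (-(s - q)))⁻¹ with hKdef
  have hD : (C : ℝ≥0∞) * K * (c : ℝ≥0∞) ^ s ≠ ∞ := ENNReal.mul_ne_top
    (ENNReal.mul_ne_top ENNReal.coe_ne_top hK) (ENNReal.rpow_ne_top_of_nonneg hs.le
      ENNReal.coe_ne_top)
  refine ⟨(C * K * (c : ℝ≥0∞) ^ s).toNNReal, fun g hg lam h0 hT => (hC g hg lam h0 hT).trans ?_⟩
  rw [ENNReal.coe_toNNReal hD]
  have hl0 : lam ^ s ≠ 0 := by simp [h0, hT]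
  have hlT : lam ^ s ≠ ∞ := ENNReal.rpow_ne_top_of_nonneg hs.le hT
  calc (C : ℝ≥0∞) * ∑' k : ℕ, (2 ^ k) ^ q * volume {x | 2 ^ k * lam < c * g x}
      ≤ C * ∑' k : ℕ, (2 ^ (-(s - q))) ^ k * ((c : ℝ≥0∞) ^ s / lam ^ s * ∫⁻ x, g x ^ s) := by
        refine mul_le_mul_right (ENNReal.tsum_le_tsum fun k => ?_) _
        have hk0 : (2 ^ k * lam) ^ s ≠ 0 := by simp [h0, hs.le]
        have hkT : (2 ^ k * lam) ^ s ≠ ∞ :=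
          ENNReal.rpow_ne_top_of_nonneg hs.le (ENNReal.mul_ne_top (by simp) hT)
        have h1 : volume {x | 2 ^ k * lam < c * g x} ≤
            (∫⁻ x, (c * g x) ^ s) / (2 ^ k * lam) ^ s := by
          refine le_trans (measure_mono fun x hx => ?_)
            (meas_ge_le_lintegral_div ((hg.const_mul _).pow_const s).aemeasurable hk0 hkT)
          exact ENNReal.rpow_le_rpow (le_of_lt hx) hs.le
        refine (mul_le_mul_right h1 _).trans (le_of_eq ?_)
        simp_rw [ENNReal.mul_rpow_of_nonneg _ _ hs.le]
        rw [lintegral_const_mul _ (hg.pow_const s), div_eq_mul_inv, div_eq_mul_inv,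
          ENNReal.mul_inv (Or.inr hlT) (Or.inr hl0)]
        have e : ((2 : ℝ≥0∞) ^ k) ^ q * ((2 ^ k) ^ s)⁻¹ = (2 ^ (-(s - q))) ^ k := by
          simp only [← ENNReal.rpow_natCast, ← ENNReal.rpow_mul, ← ENNReal.rpow_neg]
          rw [← ENNReal.rpow_add _ _ (by norm_num) (by norm_num)]
          congr 1
          ring
        rw [← e]
        ring
    _ = _ := by
        rw [ENNReal.tsum_mul_right, ENNReal.tsum_geometric, div_eq_mul_inv, div_eq_mul_inv]
        ring

end Distribution

end DilationMaximal

end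

noncomputable section

namespace DilationMaximal

open Metric Filter Topology

/-! ### Almost everywhere convergence and measurability -/

section Averages

variable {V : Type*} [NormedAddCommGroup V] [InnerProductSpace ℝ V] [MeasurableSpace V]
  [BorelSpace V] [FiniteDimensional ℝ V] {μ : Measure V} {p : ℝ}

/-- Averages over the dilates of `μ` do not see null sets, at almost every point and
simultaneously for all dilations. -/
theorem RestrictedWeakType.ae_forall_ae_of_ae (h : RestrictedWeakType μ p) {P : V → Prop}
    (hP : ∀ᵐ x : V, P x) : ∀ᵐ x : V, ∀ t : ℝ, 0 < t → ∀ᵐ y ∂μ, P (x - t • y) := by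
  obtain ⟨C, _, hC⟩ := h
  set E := toMeasurable volume {x | ¬ P x} with hE
  have hEm : MeasurableSet E := measurableSet_toMeasurable _ _
  have hE0 : volume E = 0 := by rw [hE, measure_toMeasurable]; exact hP
  have h1 : ∀ m : ℕ, ∀ᵐ x : V, posMaximal μ (E.indicator 1) x ≤ ENNReal.ofReal (1 / (m + 1)) := by
    intro m
    have := hC E hEm (1 / (m + 1)) (by positivity)
    rw [hE0, mul_zero, nonpos_iff_eq_zero] at this
    rw [ae_iff]
    simpa only [not_le] using this
  filter_upwards [ae_all_iff.2 h1] with x hx t ht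
  have h0 : posMaximal μ (E.indicator 1) x = 0 := by
    have hT : Tendsto (fun m : ℕ => ENNReal.ofReal (1 / ((m : ℝ) + 1))) atTop (𝓝 0) := by
      simpa using ENNReal.tendsto_ofReal tendsto_one_div_add_atTop_nhds_zero_nat
    exact le_antisymm (ge_of_tendsto' hT hx) zero_le
  have h2 : ∫⁻ y, E.indicator 1 (x - t • y) ∂μ = 0 :=
    le_antisymm ((lintegral_le_posMaximal μ _ x ht).trans h0.le) zero_le
  rw [lintegral_eq_zero_iff (measurable_comp_sub_smul (measurable_one.indicator hEm) x t)] at h2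
  filter_upwards [h2] with y hy
  by_contra hn
  have : x - t • y ∈ E := subset_toMeasurable volume {x | ¬ P x} hn
  simp [this] at hy

/-- At almost every point the averages of `f` over all dilates of `μ` converge absolutely, and
they depend continuously on the dilation. -/
def HasContinuousAverages (μ : Measure V) (f : V → ℂ) : Prop :=
  ∀ᵐ x : V, (∀ t : ℝ, 0 < t → Integrable (fun y => f (x - t • y)) μ) ∧
    ContinuousOn (fun t : ℝ => ∫ y, f (x - t • y) ∂μ) (Ioi 0)

theorem hasContinuousAverages_of_hasCompactSupport [IsFiniteMeasure μ] {f : V → ℂ}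
    (hf : Continuous f) (hc : HasCompactSupport f) : HasContinuousAverages μ f := by
  obtain ⟨C, hC⟩ := hf.bounded_above_of_compact_support hc
  refine ae_of_all _ fun x => ⟨fun t _ => ?_, Continuous.continuousOn ?_⟩
  · exact Integrable.mono' (integrable_const C)
      (hf.comp (by fun_prop)).aestronglyMeasurable (ae_of_all _ fun y => hC _)
  · refine continuous_of_dominated (bound := fun _ => C) (fun t => ?_)
      (fun t => ae_of_all _ fun y => hC _) (integrable_const C) (ae_of_all _ fun y => ?_)
    · exact (hf.comp (by fun_prop)).aestronglyMeasurable
    · exact hf.comp (by fun_prop)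

theorem HasContinuousAverages.congr (h : RestrictedWeakType μ p) {f g : V → ℂ}
    (hf : HasContinuousAverages μ f) (hfg : f =ᵐ[volume] g) : HasContinuousAverages μ g := by
  filter_upwards [hf, h.ae_forall_ae_of_ae hfg] with x hx hfg
  refine ⟨fun t ht => (hx.1 t ht).congr (hfg t ht), hx.2.congr fun t ht => ?_⟩
  exact (integral_congr_ae (hfg t ht)).symm

/-- Continuity of the averages passes to limits for which the maximal function of the error
tends to zero in measure. -/
theorem HasContinuousAverages.of_tendsto {f : V → ℂ} (hf : Measurable f) {F : ℕ → V → ℂ}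
    (hF : ∀ m, HasContinuousAverages μ (F m))
    (hlim : ∀ lam : ℝ≥0∞, lam ≠ 0 → lam ≠ ∞ → Tendsto (fun m =>
      volume {x | lam < posMaximal μ (fun y => ‖f y - F m y‖ₑ) x}) atTop (𝓝 0)) :
    HasContinuousAverages μ f := by
  have h1 : ∀ j : ℕ, ∀ᵐ x : V, ∃ m,
      posMaximal μ (fun y => ‖f y - F m y‖ₑ) x ≤ (j + 1 : ℝ≥0∞)⁻¹ := by
    intro j
    rw [ae_iff]
    refine le_antisymm (ge_of_tendsto' (hlim (j + 1 : ℝ≥0∞)⁻¹ (by simp) (by simp)) fun m => ?_)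
      zero_le
    refine measure_mono fun x hx => ?_
    simp only [mem_ofPred_eq, not_exists, not_le] at hx
    exact hx m
  filter_upwards [ae_all_iff.2 hF, ae_all_iff.2 h1] with x hx hsmall
  have hint : ∀ t : ℝ, 0 < t → Integrable (fun y => f (x - t • y)) μ := by
    intro t ht
    obtain ⟨m, hm⟩ := hsmall 0
    have h2 : Integrable (fun y => f (x - t • y) - F m (x - t • y)) μ := by
      refine ⟨(measurable_comp_sub_smul hf x t).aestronglyMeasurable.sub
        ((hx m).1 t ht).aestronglyMeasurable, ?_⟩
      refine lt_of_le_of_lt ((lintegral_le_posMaximal μ (fun y => ‖f y - F m y‖ₑ) x ht).trans hm)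
        (by simp)
    refine (h2.add ((hx m).1 t ht)).congr (ae_of_all _ fun y => ?_)
    simp
  refine ⟨hint, continuousOn_of_uniform_approx_of_continuousOn fun u hu => ?_⟩
  obtain ⟨ε, hε, hεu⟩ := _root_.mem_uniformity_edist.1 hu
  obtain ⟨j, hj⟩ := ENNReal.exists_inv_nat_lt hε.ne'
  obtain ⟨m, hm⟩ := hsmall j
  refine ⟨_, (hx m).2, fun t ht => hεu ?_⟩
  rw [edist_eq_enorm_sub, ← integral_sub (hint t ht) ((hx m).1 t ht)]
  calc ‖∫ y, f (x - t • y) - F m (x - t • y) ∂μ‖ₑ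
      ≤ ∫⁻ y, ‖f (x - t • y) - F m (x - t • y)‖ₑ ∂μ := enorm_integral_le_lintegral_enorm _
    _ ≤ (j + 1 : ℝ≥0∞)⁻¹ := (lintegral_le_posMaximal μ (fun y => ‖f y - F m y‖ₑ) x ht).trans hm
    _ ≤ (j : ℝ≥0∞)⁻¹ := ENNReal.inv_le_inv.2 le_self_add
    _ < ε := hj

/-- Density of the continuous functions with compact support. -/
theorem HasContinuousAverages.of_memLp [IsFiniteMeasure μ] (h : RestrictedWeakType μ p)
    (hp : 0 < p) {s : ℝ} (hps : p < s) {f : V → ℂ} (hf : Measurable f)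
    (hfs : MemLp f (ENNReal.ofReal s)) : HasContinuousAverages μ f := by
  have hs : 0 < s := hp.trans hps
  obtain ⟨C, hC⟩ := h.exists_volume_lt_le_lintegral hp hps
  have happ : ∀ m : ℕ, ∃ g : V → ℂ, HasCompactSupport g ∧
      eLpNorm (f - g) (ENNReal.ofReal s) ≤ (m + 1 : ℝ≥0∞)⁻¹ ∧ Continuous g := fun m => by
    obtain ⟨g, h1, h2, h3, _⟩ := hfs.exists_hasCompactSupport_eLpNorm_sub_le
      ENNReal.ofReal_ne_top (ε := (m + 1 : ℝ≥0∞)⁻¹) (by simp)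
    exact ⟨g, h1, h2, h3⟩
  choose F hFc hFs hFcont using happ
  refine of_tendsto hf (fun m => hasContinuousAverages_of_hasCompactSupport (hFcont m) (hFc m))
    fun lam h0 hT => ?_
  have hlT : (C : ℝ≥0∞) / lam ^ s ≠ ∞ := by
    refine ENNReal.div_ne_top ENNReal.coe_ne_top ?_
    simp [h0, hT]
  have hlim : Tendsto (fun m : ℕ => (C : ℝ≥0∞) / lam ^ s * ((m + 1 : ℝ≥0∞)⁻¹) ^ s) atTop
      (𝓝 (C / lam ^ s * 0 ^ s)) := by
    refine ENNReal.Tendsto.const_mul ?_ (Or.inr hlT)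
    refine (ENNReal.continuous_rpow_const.tendsto 0).comp ?_
    have := ENNReal.tendsto_inv_nat_nhds_zero.comp (tendsto_add_atTop_nat 1)
    simpa [Function.comp_def] using this
  rw [ENNReal.zero_rpow_of_pos hs, mul_zero] at hlim
  refine tendsto_of_tendsto_of_tendsto_of_le_of_le tendsto_const_nhds hlim (fun _ => zero_le)
    fun m => ?_
  have hfm : Measurable fun y => ‖f y - F m y‖ₑ := (hf.sub (hFcont m).measurable).enorm
  refine (hC _ hfm lam h0 hT).trans ?_
  gcongr
  have := hFs m
  rw [eLpNorm_eq_lintegral_rpow_enorm_toReal (by simpa using hs) ENNReal.ofReal_ne_top,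
    ENNReal.toReal_ofReal hs.le, one_div, ENNReal.rpow_inv_le_iff hs] at this
  simpa using this

/-- A bounded function has continuous averages: the averages near a point only involve the
restriction of the function to a ball, which is square integrable. -/
theorem HasContinuousAverages.of_memLp_top [IsFiniteMeasure μ] (h : RestrictedWeakType μ p)
    (hp : 0 < p) {s R : ℝ} (hps : p < s) (hR : μ (closedBall 0 R)ᶜ = 0)
    {f : V → ℂ} (hf : Measurable f) (hfs : MemLp f ∞) : HasContinuousAverages μ f := by
  have hloc : ∀ N : ℕ, HasContinuousAverages μ ((ball 0 N).indicator f) := by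
    intro N
    refine HasContinuousAverages.of_memLp h hp hps (hf.indicator measurableSet_ball) ?_
    rw [memLp_indicator_iff_restrict measurableSet_ball]
    have : IsFiniteMeasure ((volume : Measure V).restrict (ball 0 (N : ℝ))) :=
      ⟨by simpa using measure_ball_lt_top⟩
    exact (hfs.restrict _).mono_exponent le_top
  filter_upwards [ae_all_iff.2 hloc] with x hx
  have hRae : ∀ᵐ y ∂μ, ‖y‖ ≤ R := by
    rw [ae_iff]
    convert hR using 2
    ext y; simp
  have key : ∀ T : ℝ, ∃ N : ℕ, ∀ t : ℝ, 0 < t → t < T →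
      ∀ᵐ y ∂μ, (ball 0 (N : ℝ)).indicator f (x - t • y) = f (x - t • y) := by
    intro T
    obtain ⟨N, hN⟩ := exists_nat_gt (‖x‖ + T * R)
    refine ⟨N, fun t ht htT => ?_⟩
    filter_upwards [hRae] with y hy
    refine indicator_of_mem ?_ f
    rw [mem_ball_zero_iff]
    calc ‖x - t • y‖ ≤ ‖x‖ + ‖t • y‖ := norm_sub_le _ _
      _ = ‖x‖ + t * ‖y‖ := by rw [norm_smul, Real.norm_of_nonneg ht.le]
      _ ≤ ‖x‖ + T * R := by
        have := ht.le.trans htT.le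
        gcongr
      _ < N := hN
  refine ⟨fun t ht => ?_, fun t ht => ?_⟩
  · obtain ⟨N, hN⟩ := key (t + 1)
    exact ((hx N).1 t ht).congr (hN t ht (by linarith))
  · obtain ⟨N, hN⟩ := key (t + 1)
    have hct := ((hx N).2.continuousAt (Ioi_mem_nhds ht))
    refine (hct.congr ?_).continuousWithinAt
    filter_upwards [Ioo_mem_nhds (show 0 < t from ht) (lt_add_one t)] with r hr
    exact integral_congr_ae (hN r hr.1 hr.2)

/-- By continuity, the supremum over all dilations may be taken over the rational ones. -/
theorem HasContinuousAverages.aemeasurable_iSup [SFinite μ] {f : V → ℂ} (hf : Measurable f)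
    (h : HasContinuousAverages μ f) :
    AEMeasurable (fun x => ⨆ (t : ℝ) (_ : 0 < t), ‖∫ y, f (x - t • y) ∂μ‖ₑ) volume := by
  refine ⟨fun x => ⨆ (q : ℚ) (_ : 0 < q), ‖∫ y, f (x - (q : ℝ) • y) ∂μ‖ₑ, ?_, ?_⟩
  · refine Measurable.iSup fun q => Measurable.iSup fun _ => ?_
    refine (StronglyMeasurable.integral_prod_right (f := fun x y => f (x - (q : ℝ) • y))
      (Measurable.stronglyMeasurable ?_)).measurable.enorm
    have h2 : Measurable fun z : V × V => z.1 - (q : ℝ) • z.2 := by fun_prop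
    exact hf.comp h2
  · filter_upwards [h] with x hx
    refine le_antisymm (iSup₂_le fun t ht => ?_) (iSup₂_le fun q hq => ?_)
    · by_contra hlt
      rw [not_le] at hlt
      have hct := ((hx.2.continuousAt (Ioi_mem_nhds ht)).enorm.eventually (lt_mem_nhds hlt)).and
        (Ioi_mem_nhds ht)
      obtain ⟨U, hU, hUo, htU⟩ := _root_.mem_nhds_iff.1 hct
      obtain ⟨q, hq⟩ := (Rat.denseRange_cast (𝕜 := ℝ)).exists_mem_open hUo ⟨t, htU⟩
      have hqU := hU hq
      refine absurd hqU.1 (not_lt.2 ?_)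
      have hq0 : 0 < q := by exact_mod_cast (show (0 : ℝ) < q from hqU.2)
      exact le_iSup₂ (f := fun (q : ℚ) (_ : 0 < q) => ‖∫ y, f (x - (q : ℝ) • y) ∂μ‖ₑ) q hq0
    · exact le_iSup₂ (f := fun (t : ℝ) (_ : 0 < t) => ‖∫ y, f (x - t • y) ∂μ‖ₑ) (q : ℝ)
        (by exact_mod_cast hq)

/-- For arbitrary measurable functions with values in `[0, ∞]` the maximal function is a supremum
over uncountably many dilations, and need not be measurable; indicator functions have continuous
averages. -/
theorem aemeasurable_posMaximal_indicator [IsFiniteMeasure μ] (h : RestrictedWeakType μ p)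
    (hp : 0 < p) {E : Set V} (hE : MeasurableSet E) (hEv : volume E ≠ ∞) :
    AEMeasurable (posMaximal μ (E.indicator 1)) volume := by
  have hm : Measurable (E.indicator (1 : V → ℂ)) := measurable_one.indicator hE
  have := (HasContinuousAverages.of_memLp h hp (lt_add_one p) hm
    (memLp_indicator_const _ hE (1 : ℂ) (Or.inr hEv))).aemeasurable_iSup hm
  refine this.congr (ae_of_all _ fun x => ?_)
  unfold posMaximal
  dsimp only
  congr 1 with t
  congr 1 with ht
  have hE' : MeasurableSet ((fun y => x - t • y) ⁻¹' E) :=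
    measurable_comp_sub_smul measurable_id x t hE
  have e1 : ∀ y, E.indicator (1 : V → ℂ) (x - t • y) =
      ((fun y => x - t • y) ⁻¹' E).indicator 1 y := fun y => rfl
  have e2 : ∀ y, E.indicator (1 : V → ℝ≥0∞) (x - t • y) =
      ((fun y => x - t • y) ⁻¹' E).indicator 1 y := fun y => rfl
  simp_rw [e1, e2]
  have e3 : ∫ y, ((fun y => x - t • y) ⁻¹' E).indicator (1 : V → ℂ) y ∂μ =
      (μ.real ((fun y => x - t • y) ⁻¹' E) : ℂ) := by
    rw [integral_indicator hE']
    simp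
  rw [e3, lintegral_indicator_one hE', ← ofReal_norm, Complex.norm_real,
    Real.norm_of_nonneg measureReal_nonneg, ofReal_measureReal]

end Averages

end DilationMaximal

end

noncomputable section

namespace DilationMaximal

open Metric Filter Topology

/-! ### Lorentz norms and the endpoint inequality -/

section Lorentz

variable {α : Type*} [MeasurableSpace α] {ν : Measure α} {p : ℝ}

theorem two_zpow_eq_ofReal (m : ℤ) : (2 : ℝ≥0∞) ^ m = ENNReal.ofReal ((2 : ℝ) ^ m) := by
  rw [← ENNReal.rpow_intCast, ← Real.rpow_intCast, ← ENNReal.ofReal_rpow_of_pos (by norm_num),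
    ENNReal.ofReal_ofNat]

theorem mul_measure_rpow_le_lintegral (g : α → ℝ≥0∞) (hp : 0 < p) {r s : ℝ} :
    ENNReal.ofReal (s - r) * ν {x | ENNReal.ofReal s < g x} ^ (1 / p) ≤
      ∫⁻ u in Ioc r s, ν {x | ENNReal.ofReal u < g x} ^ (1 / p) := by
  rw [mul_comm, ← Real.volume_Ioc, ← setLIntegral_const]
  refine setLIntegral_mono' measurableSet_Ioc fun u hu => ?_
  refine ENNReal.rpow_le_rpow (measure_mono fun x hx => ?_) (by positivity)
  exact lt_of_le_of_lt (ENNReal.ofReal_le_ofReal hu.2) hx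

theorem measure_lt_top_of_lorentzNormOne {g : α → ℝ≥0∞} (hp : 0 < p)
    (hg : lorentzNormOne g p ν < ∞) {s : ℝ} (hs : 0 < s) :
    ν {x | ENNReal.ofReal s < g x} < ∞ := by
  have h1 : ENNReal.ofReal p * (ENNReal.ofReal s * ν {x | ENNReal.ofReal s < g x} ^ (1 / p)) ≤
      lorentzNormOne g p ν := by
    unfold lorentzNormOne
    gcongr
    refine le_trans (le_of_eq (by rw [sub_zero])) ((mul_measure_rpow_le_lintegral (r := 0)
      g hp).trans ?_)
    simp only [enorm_eq_self]
    exact lintegral_mono_set fun u hu => hu.1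
  have h2 := h1.trans_lt hg
  by_contra hT
  rw [not_lt, top_le_iff] at hT
  rw [hT, ENNReal.top_rpow_of_pos (by positivity), ENNReal.mul_top (by simpa using hs),
    ENNReal.mul_top (by simpa using hp)] at h2
  exact absurd h2 (lt_irrefl _)

/-- The dyadic form of the Lorentz norm. -/
theorem tsum_two_zpow_mul_measure_rpow_le (g : α → ℝ≥0∞) (hp : 0 < p) :
    ∑' m : ℤ, 2 ^ m * ν {x | 2 ^ m < g x} ^ (1 / p) ≤
      2 * ∫⁻ s in Ioi (0 : ℝ), ν {x | ENNReal.ofReal s < g x} ^ (1 / p) := by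
  have hmono : Monotone fun m : ℤ => (2 : ℝ) ^ m := zpow_right_mono₀ (by norm_num)
  have hterm : ∀ m : ℤ, (2 : ℝ≥0∞) ^ (m + 1) * ν {x | 2 ^ (m + 1) < g x} ^ (1 / p) ≤
      2 * ∫⁻ s in Ioc ((2 : ℝ) ^ m) (2 ^ Order.succ m),
        ν {x | ENNReal.ofReal s < g x} ^ (1 / p) := by
    intro m
    rw [Order.succ_eq_add_one]
    refine le_trans (le_of_eq ?_) (mul_le_mul_right (mul_measure_rpow_le_lintegral g hp) 2)
    rw [← mul_assoc, two_zpow_eq_ofReal (m + 1)]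
    congr 1
    rw [zpow_add₀ (by norm_num), zpow_one, mul_two, add_sub_cancel_left, ← mul_two,
      ENNReal.ofReal_mul (by positivity), mul_comm, ENNReal.ofReal_ofNat]
  calc ∑' m : ℤ, 2 ^ m * ν {x | 2 ^ m < g x} ^ (1 / p)
      = ∑' m : ℤ, (2 : ℝ≥0∞) ^ (m + 1) * ν {x | 2 ^ (m + 1) < g x} ^ (1 / p) :=
        ((Equiv.addRight (1 : ℤ)).tsum_eq fun m : ℤ =>
          (2 : ℝ≥0∞) ^ m * ν {x | 2 ^ m < g x} ^ (1 / p)).symm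
    _ ≤ _ := ENNReal.tsum_le_tsum hterm
    _ = 2 * ∫⁻ s in ⋃ m : ℤ, Ioc ((2 : ℝ) ^ m) (2 ^ Order.succ m),
          ν {x | ENNReal.ofReal s < g x} ^ (1 / p) := by
        rw [ENNReal.tsum_mul_left, lintegral_iUnion (fun m => measurableSet_Ioc)
          hmono.pairwise_disjoint_on_Ioc_succ]
    _ ≤ _ := by
        gcongr
        refine iUnion_subset fun m u hu => ?_
        exact lt_trans (by positivity : (0 : ℝ) < 2 ^ m) hu.1

theorem lintegral_le_four_mul_lorentzNormOne {g : α → ℝ≥0∞} (hg : Measurable g) :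
    ∫⁻ x, g x ∂ν ≤ 4 * lorentzNormOne g 1 ν := by
  have hm : ∀ m : ℤ, MeasurableSet {x | (2 : ℝ≥0∞) ^ m < g x} :=
    fun m => measurableSet_lt measurable_const hg
  calc ∫⁻ x, g x ∂ν
      ≤ ∫⁻ x, ∑' m : ℤ, 2 ^ (m + 1) * {z | (2 : ℝ≥0∞) ^ m < g z}.indicator 1 x ∂ν :=
        lintegral_mono fun x => by simpa using rpow_le_tsum_two_zpow g zero_lt_one x
    _ = 2 * ∑' m : ℤ, 2 ^ m * ν {x | 2 ^ m < g x} ^ (1 / (1 : ℝ)) := by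
        rw [lintegral_tsum fun m =>
          ((measurable_one.indicator (hm m)).const_mul _).aemeasurable, ← ENNReal.tsum_mul_left]
        congr 1 with m
        rw [lintegral_const_mul _ (measurable_one.indicator (hm m)),
          lintegral_indicator_one (hm m), ENNReal.zpow_add (by norm_num) (by norm_num), zpow_one,
          div_one, ENNReal.rpow_one]
        ring
    _ ≤ 2 * (2 * ∫⁻ s in Ioi (0 : ℝ), ν {x | ENNReal.ofReal s < g x} ^ (1 / (1 : ℝ))) := by
        gcongr
        exact tsum_two_zpow_mul_measure_rpow_le g one_pos
    _ = _ := by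
        unfold lorentzNormOne
        simp only [enorm_eq_self]
        rw [ENNReal.ofReal_one, one_mul, ← mul_assoc]
        norm_num

/-- On a set of finite measure a weak-type bound of order `p > 1` controls the integral. -/
theorem setLIntegral_le_of_measure_lt_le (hp : 1 < p) {G : α → ℝ≥0∞} (hG : AEMeasurable G ν)
    {C v : ℝ≥0∞} (hv : v ≠ ∞)
    (h : ∀ lam : ℝ≥0∞, lam ≠ 0 → lam ≠ ∞ → ν {x | lam < G x} ≤ C * lam ^ (-p) * v)
    {S : Set α} (hS : ν S ≠ ∞) :
    ∫⁻ x in S, G x ∂ν ≤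
      (1 + C * (1 - 2 ^ (-(p - 1)))⁻¹) * (v ^ (1 / p) * ν S ^ (1 - 1 / p)) := by
  have hp0 : 0 < p := by linarith
  have h1p : 0 < 1 - 1 / p := by
    rw [sub_pos, div_lt_one hp0]; exact hp
  rcases eq_or_ne (ν S) 0 with hS0 | hS0
  · rw [setLIntegral_measure_zero _ _ hS0]; exact zero_le
  set K := (1 - (2 : ℝ≥0∞) ^ (-(p - 1)))⁻¹ with hK
  have hτ : ∀ τ : ℝ≥0∞, τ ≠ 0 → τ ≠ ∞ →
      ∫⁻ x in S, G x ∂ν ≤ τ * ν S + C * K * (τ ^ (1 - p) * v) := by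
    intro τ h0 hT
    have hkT : ∀ k : ℕ, (2 : ℝ≥0∞) ^ k * τ ≠ ∞ := fun k => ENNReal.mul_ne_top (by simp) hT
    have hm : ∀ k : ℕ, NullMeasurableSet {x | 2 ^ k * τ < G x} ν :=
      fun k => nullMeasurableSet_lt aemeasurable_const hG
    calc ∫⁻ x in S, G x ∂ν
        ≤ ∫⁻ x in S, (τ + ∑' k : ℕ, 2 ^ k * τ * {z | 2 ^ k * τ < G z}.indicator 1 x) ∂ν :=
          lintegral_mono fun x => le_add_tsum_two_pow_mul_indicator G h0 x
      _ = τ * ν S + ∑' k : ℕ, 2 ^ k * τ * ∫⁻ x in S, {z | 2 ^ k * τ < G z}.indicator 1 x ∂ν := by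
          rw [lintegral_add_left measurable_const, setLIntegral_const, lintegral_tsum]
          · congr 2 with k
            rw [lintegral_const_mul' _ _ (hkT k)]
          · exact fun k => ((aemeasurable_one.indicator₀ (hm k)).const_mul _).restrict
      _ ≤ τ * ν S + ∑' k : ℕ, C * (2 ^ (-(p - 1))) ^ k * (τ ^ (1 - p) * v) := by
          refine add_le_add_right (ENNReal.tsum_le_tsum fun k => ?_) _
          have h1 : ∫⁻ x in S, {z | 2 ^ k * τ < G z}.indicator 1 x ∂ν ≤
              C * (2 ^ k * τ) ^ (-p) * v := by
            refine (setLIntegral_le_lintegral _ _).trans ?_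
            rw [lintegral_indicator_one₀ (hm k)]
            exact h _ (by simp [h0]) (hkT k)
          refine (mul_le_mul_right h1 _).trans (le_of_eq ?_)
          have e1 : (2 : ℝ≥0∞) ^ k * τ * (2 ^ k * τ) ^ (-p) =
              (2 ^ (-(p - 1))) ^ k * τ ^ (1 - p) := by
            calc (2 : ℝ≥0∞) ^ k * τ * (2 ^ k * τ) ^ (-p) = (2 ^ k * τ) ^ (1 - p) := by
                  rw [sub_eq_add_neg, ENNReal.rpow_add _ _ (by simp [h0]) (hkT k),
                    ENNReal.rpow_one]
              _ = _ := by
                  rw [ENNReal.mul_rpow_of_ne_top (by simp) hT, ← ENNReal.rpow_natCast,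
                    ← ENNReal.rpow_mul, ← ENNReal.rpow_natCast, ← ENNReal.rpow_mul]
                  congr 2
                  ring
          calc _ = C * ((2 : ℝ≥0∞) ^ k * τ * (2 ^ k * τ) ^ (-p)) * v := by ring
            _ = _ := by rw [e1]; ring
      _ = _ := by
          rw [ENNReal.tsum_mul_right, ENNReal.tsum_mul_left, ENNReal.tsum_geometric, ← hK]
  rcases eq_or_ne v 0 with hv0 | hv0
  · have hT : Tendsto (fun m : ℕ => ((m + 1 : ℕ) : ℝ≥0∞)⁻¹ * ν S) atTop (𝓝 (0 * ν S)) :=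
      ENNReal.Tendsto.mul_const (ENNReal.tendsto_inv_nat_nhds_zero.comp (tendsto_add_atTop_nat 1))
        (Or.inr hS)
    rw [zero_mul] at hT
    refine (ge_of_tendsto' hT fun m => ?_).trans zero_le
    have := hτ (((m + 1 : ℕ) : ℝ≥0∞)⁻¹) (ENNReal.inv_ne_zero.2 (ENNReal.natCast_ne_top _))
      (ENNReal.inv_ne_top.2 (by exact_mod_cast m.succ_ne_zero))
    simpa [hv0] using this
  · have hd0 : v / ν S ≠ 0 := ENNReal.div_ne_zero.2 ⟨hv0, hS⟩
    have hdT : v / ν S ≠ ∞ := ENNReal.div_ne_top hv hS0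
    -- the two terms balance at this height
    refine (hτ ((v / ν S) ^ (1 / p)) (by simp [hd0, hdT])
      (ENNReal.rpow_ne_top_of_nonneg (by positivity) hdT)).trans (le_of_eq ?_)
    have e : ∀ e1 : ℝ, (v / ν S) ^ e1 = v ^ e1 * ν S ^ (-e1) := fun e1 => by
      rw [div_eq_mul_inv, ENNReal.mul_rpow_of_ne_top hv (ENNReal.inv_ne_top.2 hS0),
        ENNReal.inv_rpow, ENNReal.rpow_neg]
    have a1 : (v / ν S) ^ (1 / p) * ν S = v ^ (1 / p) * ν S ^ (1 - 1 / p) := by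
      rw [e, mul_assoc, sub_eq_neg_add, ENNReal.rpow_add _ _ hS0 hS, ENNReal.rpow_one]
    have a2 : ((v / ν S) ^ (1 / p)) ^ (1 - p) * v = v ^ (1 / p) * ν S ^ (1 - 1 / p) := by
      have c1 : 1 / p * (1 - p) = 1 / p - 1 := by field_simp
      rw [← ENNReal.rpow_mul, c1, e, neg_sub, mul_right_comm]
      congr 1
      rw [ENNReal.rpow_sub _ _ hv0 hv, ENNReal.rpow_one, ENNReal.div_mul_cancel hv0 hv]
    rw [a1, a2]
    ring

end Lorentz

section Endpoint

variable {V : Type*} [NormedAddCommGroup V] [InnerProductSpace ℝ V] [MeasurableSpace V]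
  [BorelSpace V] [FiniteDimensional ℝ V] {μ : Measure V} {p : ℝ}

/-- The endpoint inequality: the maximal operator maps `L^{p,1}` into weak `L^p`. -/
def LorentzWeakType (μ : Measure V) (p : ℝ) : Prop :=
  ∃ C : ℝ≥0, ∀ g : V → ℝ≥0∞, Measurable g → ∀ lam : ℝ≥0∞, lam ≠ 0 → lam ≠ ∞ →
    lam * volume {x | lam < posMaximal μ g x} ^ (1 / p) ≤ C * lorentzNormOne g p volume

/-- For `p > 1` weak `L^p` is normable, so the restricted weak-type inequality can be summed over
the dyadic level sets. -/
theorem RestrictedWeakType.lorentzWeakType [IsFiniteMeasure μ] (h : RestrictedWeakType μ p)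
    (hp : 1 < p) : LorentzWeakType μ p := by
  have hp0 : 0 < p := by linarith
  have hrw := h
  obtain ⟨C₀, hC₀, hC⟩ := h
  have hK := one_sub_two_rpow_neg_inv_ne_top (sub_pos.2 hp)
  set K := 1 + ENNReal.ofReal C₀ * (1 - (2 : ℝ≥0∞) ^ (-(p - 1)))⁻¹ with hKdef
  have hKT : K ≠ ∞ := ENNReal.add_ne_top.2
    ⟨ENNReal.one_ne_top, ENNReal.mul_ne_top ENNReal.ofReal_ne_top hK⟩
  have hK0 : K ≠ 0 := by simp [hKdef]
  refine ⟨(K * 4).toNNReal, fun g hg lam h0 hT => ?_⟩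
  have hK4 : K * 4 ≠ ∞ := ENNReal.mul_ne_top hKT (by simp)
  rw [ENNReal.coe_toNNReal hK4]
  rcases eq_or_ne (lorentzNormOne g p volume) ∞ with hL | hL
  · rw [hL, ENNReal.mul_top (mul_ne_zero hK0 (by simp))]
    exact le_top
  have hE : ∀ m : ℤ, volume {x | 2 ^ m < g x} ≠ ∞ := by
    intro m
    have := measure_lt_top_of_lorentzNormOne hp0 hL.lt_top (s := (2 : ℝ) ^ m) (by positivity)
    rw [← two_zpow_eq_ofReal] at this
    exact this.ne
  have hEm : ∀ m : ℤ, MeasurableSet {x | (2 : ℝ≥0∞) ^ m < g x} :=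
    fun m => measurableSet_lt measurable_const hg
  set H : V → ℝ≥0∞ := fun x =>
    ∑' m : ℤ, 2 ^ (m + 1) * posMaximal μ ({z | (2 : ℝ≥0∞) ^ m < g z}.indicator 1) x with hH
  have hm : ∀ m : ℤ, AEMeasurable (posMaximal μ ({z | (2 : ℝ≥0∞) ^ m < g z}.indicator 1))
      volume := fun m => aemeasurable_posMaximal_indicator hrw hp0 (hEm m) (hE m)
  have hHm : AEMeasurable H volume := AEMeasurable.tsum fun m => (hm m).const_mul _
  have h2T : ∀ m : ℤ, (2 : ℝ≥0∞) ^ m ≠ ∞ := fun m =>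
    ENNReal.zpow_ne_top (by norm_num) (by norm_num) m
  have hgH : ∀ x, posMaximal μ g x ≤ H x := by
    intro x
    have h1 : g ≤ fun x => ∑' m : ℤ, 2 ^ (m + 1) * {z | (2 : ℝ≥0∞) ^ m < g z}.indicator 1 x := by
      intro x
      simpa using rpow_le_tsum_two_zpow g zero_lt_one x
    refine (posMaximal_mono μ h1 x).trans ((posMaximal_tsum_le μ
      (fun m => (measurable_one.indicator (hEm m)).const_mul _) x).trans ?_)
    exact ENNReal.tsum_le_tsum fun m => posMaximal_const_mul_le μ _ (h2T _) x
  set L := ∫⁻ s in Ioi (0 : ℝ), volume {x | ENNReal.ofReal s < g x} ^ (1 / p) with hLdef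
  have hLL : L ≤ lorentzNormOne g p volume := by
    unfold lorentzNormOne
    simp only [enorm_eq_self]
    refine le_mul_of_one_le_left zero_le ?_
    rw [ENNReal.one_le_ofReal]
    exact hp.le
  have hS : ∀ S : Set V, volume S ≠ ∞ →
      ∫⁻ x in S, H x ≤ K * 4 * L * volume S ^ (1 - 1 / p) := by
    intro S hS
    calc ∫⁻ x in S, H x
        = ∑' m : ℤ, 2 ^ (m + 1) *
            ∫⁻ x in S, posMaximal μ ({z | (2 : ℝ≥0∞) ^ m < g z}.indicator 1) x := by
          rw [hH, lintegral_tsum fun m => ((hm m).const_mul _).restrict]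
          congr 1 with m
          rw [lintegral_const_mul' _ _ (h2T _)]
      _ ≤ ∑' m : ℤ, 2 ^ (m + 1) * (K * (volume {x | 2 ^ m < g x} ^ (1 / p) *
            volume S ^ (1 - 1 / p))) := by
          refine ENNReal.tsum_le_tsum fun m => mul_le_mul_right ?_ _
          refine setLIntegral_le_of_measure_lt_le hp (hm m) (hE m) (fun r hr0 hrT => ?_) hS
          lift r to ℝ≥0 using hrT
          have hr : 0 < (r : ℝ) := by
            rw [NNReal.coe_pos, pos_iff_ne_zero]; exact_mod_cast hr0
          have := hC _ (hEm m) r hr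
          rwa [ENNReal.ofReal_mul hC₀, ← ENNReal.ofReal_rpow_of_pos hr,
            ENNReal.ofReal_coe_nnreal] at this
      _ = K * volume S ^ (1 - 1 / p) * (2 *
            ∑' m : ℤ, 2 ^ m * volume {x | 2 ^ m < g x} ^ (1 / p)) := by
          rw [← ENNReal.tsum_mul_left, ← ENNReal.tsum_mul_left]
          congr 1 with m
          rw [ENNReal.zpow_add (by norm_num) (by norm_num), zpow_one]
          ring
      _ ≤ K * volume S ^ (1 - 1 / p) * (2 * (2 * L)) := by
          gcongr
          exact tsum_two_zpow_mul_measure_rpow_le g hp0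
      _ = _ := by ring
  -- the set `{H' > λ}` is exhausted by sets of finite measure, where the integral bound applies
  set H' := hHm.mk H with hH'
  have hHH' : H =ᵐ[volume] H' := hHm.ae_eq_mk
  have hfin : ∀ S : Set V, MeasurableSet S → S ⊆ {x | lam < H' x} → volume S ≠ ∞ →
      volume S ≤ (K * 4 * L / lam) ^ p := by
    intro S hSm hSsub hST
    rcases eq_or_ne (volume S) 0 with hS0 | hS0
    · rw [hS0]; exact zero_le
    have h1 : lam * volume S ≤ K * 4 * L * volume S ^ (1 - 1 / p) := by
      refine le_trans ?_ (hS S hST)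
      rw [← setLIntegral_const, lintegral_congr_ae (ae_restrict_of_ae hHH')]
      exact setLIntegral_mono' hSm fun x hx => (hSsub hx).le
    have hq0 : volume S ^ (1 - 1 / p) ≠ 0 := by simp [hS0, hST]
    have hqT : volume S ^ (1 - 1 / p) ≠ ∞ := by simp [hS0, hST]
    rw [← ENNReal.rpow_inv_le_iff hp0, ← one_div,
      ENNReal.le_div_iff_mul_le (Or.inl h0) (Or.inl hT), mul_comm,
      ← ENNReal.mul_le_mul_iff_left hq0 hqT, mul_assoc, ← ENNReal.rpow_add _ _ hS0 hST]
    simpa using h1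
  rw [mul_comm, ← ENNReal.le_div_iff_mul_le (Or.inl h0) (Or.inl hT), one_div,
    ENNReal.rpow_inv_le_iff hp0]
  calc volume {x | lam < posMaximal μ g x} ≤ volume {x | lam < H x} :=
        measure_mono fun x hx => lt_of_lt_of_le hx (hgH x)
    _ ≤ volume {x | lam < H' x} := by
        refine measure_mono_ae ?_
        filter_upwards [hHH'] with x hx h
        have h : lam < H x := h
        show lam < H' x
        rwa [← hx]
    _ = ⨆ N : ℕ, volume ({x | lam < H' x} ∩ ball 0 N) := by
        rw [← Monotone.measure_iUnion, ← inter_iUnion, iUnion_ball_nat, inter_univ]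
        exact fun i j hij => inter_subset_inter_right _ (ball_subset_ball (by exact_mod_cast hij))
    _ ≤ (K * 4 * L / lam) ^ p := by
        refine iSup_le fun N => hfin _ ?_ inter_subset_left ?_
        · exact (measurableSet_lt measurable_const hHm.measurable_mk).inter measurableSet_ball
        · exact (measure_mono inter_subset_right).trans_lt measure_ball_lt_top |>.ne
    _ ≤ _ := by gcongr

/-- A measure whose balls have mass at most a multiple of their volume is bounded by that multiple
of the volume. -/
theorem exists_le_smul_volume_of_frostman [IsFiniteMeasure μ] {C₁ : ℝ} (hC₁ : 0 ≤ C₁)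
    (hF : ∀ x r, 0 < r → μ (ball x r) ≤ ENNReal.ofReal (C₁ * r ^ Module.finrank ℝ V)) :
    ∃ C : ℝ≥0, μ ≤ C • volume := by
  set n := Module.finrank ℝ V
  have hv0 : volume (ball (0 : V) 1) ≠ 0 := (measure_ball_pos _ _ one_pos).ne'
  have hvT : volume (ball (0 : V) 1) ≠ ∞ := measure_ball_lt_top.ne
  have hDT : ENNReal.ofReal (C₁ * 2 ^ n) / volume (ball (0 : V) 1) ≠ ∞ :=
    ENNReal.div_ne_top ENNReal.ofReal_ne_top hv0
  refine ⟨(ENNReal.ofReal (C₁ * 2 ^ n) / volume (ball (0 : V) 1)).toNNReal, ?_⟩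
  rw [Measure.le_iff']
  intro s
  refine (Besicovitch.vitaliFamily μ).measure_le_of_frequently_le _ Measure.AbsolutelyContinuous.rfl
    s fun x _ => (Besicovitch.tendsto_filterAt μ x).frequently (Eventually.frequently ?_)
  filter_upwards [self_mem_nhdsWithin] with r hr
  have hr : 0 < r := hr
  calc μ (closedBall x r) ≤ μ (ball x (2 * r)) :=
        measure_mono (closedBall_subset_ball (by linarith))
    _ ≤ ENNReal.ofReal (C₁ * (2 * r) ^ n) := hF x _ (by positivity)
    _ = ENNReal.ofReal (C₁ * 2 ^ n) * ENNReal.ofReal (r ^ n) := by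
        rw [← ENNReal.ofReal_mul (by positivity), mul_pow, mul_assoc]
    _ = ENNReal.ofReal (C₁ * 2 ^ n) / volume (ball (0 : V) 1) *
          (ENNReal.ofReal (r ^ n) * volume (ball (0 : V) 1)) := by
        rw [mul_comm (ENNReal.ofReal (r ^ n)), ← mul_assoc, ENNReal.div_mul_cancel hv0 hvT]
    _ = ENNReal.ofReal (C₁ * 2 ^ n) / volume (ball (0 : V) 1) * volume (ball x r) := by
        rw [Measure.addHaar_ball_of_pos _ _ hr]
    _ ≤ _ := by
        rw [Measure.smul_apply, ENNReal.smul_def, ENNReal.coe_toNNReal hDT, smul_eq_mul]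
        gcongr
        exact ball_subset_closedBall

/-- When `b = n`, the measure has a bounded density, and the maximal operator is controlled by the
Hardy–Littlewood one. -/
theorem lorentzWeakType_one [IsFiniteMeasure μ] {R C₁ : ℝ} (hR0 : 0 < R)
    (hR : μ (closedBall 0 R)ᶜ = 0) (hC₁ : 0 ≤ C₁)
    (hF : ∀ x r, 0 < r → μ (ball x r) ≤ ENNReal.ofReal (C₁ * r ^ Module.finrank ℝ V)) :
    LorentzWeakType μ 1 := by
  obtain ⟨C, hC⟩ := exists_le_smul_volume_of_frostman hC₁ hF
  set n := Module.finrank ℝ V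
  set D : ℝ≥0∞ := C * volume (ball (0 : V) (R + 1)) + 1 with hD
  have hDT : D ≠ ∞ := ENNReal.add_ne_top.2
    ⟨ENNReal.mul_ne_top ENNReal.coe_ne_top measure_ball_lt_top.ne, ENNReal.one_ne_top⟩
  have hD0 : D ≠ 0 := by simp [hD]
  have hmax : ∀ (g : V → ℝ≥0∞) (x : V), posMaximal μ g x ≤ D * hlMaximal g x := by
    intro g x
    refine iSup₂_le fun t ht => ?_
    have hball : ∀ᵐ y ∂μ, y ∈ ball (0 : V) (R + 1) := by
      rw [ae_iff]
      refine measure_mono_null (fun y hy => ?_) hR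
      simp only [mem_ofPred_eq, mem_ball, mem_compl_iff, mem_closedBall] at hy ⊢
      linarith
    calc ∫⁻ y, g (x - t • y) ∂μ = ∫⁻ y in ball 0 (R + 1), g (x - t • y) ∂μ := by
          rw [Measure.restrict_eq_self_of_ae_mem hball]
      _ ≤ ∫⁻ y in ball 0 (R + 1), g (x - t • y) ∂((C : ℝ≥0) • volume) :=
          lintegral_mono' (Measure.restrict_mono_measure hC _) le_rfl
      _ = C * ∫⁻ y in ball 0 (R + 1), g (x - t • y) := by
          rw [Measure.restrict_smul, lintegral_smul_measure, ENNReal.smul_def, smul_eq_mul]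
      _ ≤ C * (ENNReal.ofReal (t ^ n)⁻¹ *
            (volume (ball x (t * (R + 1))) * hlMaximal g x)) := by
          rw [setLIntegral_comp_sub_smul_ball g x ht]
          gcongr
          exact setLIntegral_ball_le_hlMaximal g x (by positivity)
      _ = C * volume (ball (0 : V) (R + 1)) * hlMaximal g x := by
          have e : ENNReal.ofReal (t ^ n)⁻¹ * ENNReal.ofReal (t ^ n) = 1 := by
            rw [← ENNReal.ofReal_mul (by positivity), inv_mul_cancel₀ (by positivity),
              ENNReal.ofReal_one]
          rw [Measure.addHaar_ball_mul_of_pos _ _ ht]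
          calc _ = C * volume (ball (0 : V) (R + 1)) * hlMaximal g x *
                (ENNReal.ofReal (t ^ n)⁻¹ * ENNReal.ofReal (t ^ n)) := by ring
            _ = _ := by rw [e, mul_one]
      _ ≤ _ := by gcongr; exact le_self_add
  have hET : 4 ^ n * D * 4 ≠ ∞   :=
    ENNReal.mul_ne_top (ENNReal.mul_ne_top (by simp) hDT) (by simp)
  refine ⟨(4 ^ n * D * 4).toNNReal, fun g hg lam h0 hT => ?_⟩
  rw [ENNReal.coe_toNNReal hET, div_one, ENNReal.rpow_one]
  rw [mul_assoc]
  refine le_trans ?_ (mul_le_mul_right (lintegral_le_four_mul_lorentzNormOne hg) _)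
  have hsub : {x | lam < posMaximal μ g x} ⊆ {x | lam / D < hlMaximal g x} := by
    intro x hx
    rw [mem_ofPred_eq, ENNReal.div_lt_iff (Or.inl hD0) (Or.inl hDT), mul_comm]
    exact lt_of_lt_of_le hx (hmax g x)
  have hd0 : lam / D ≠ 0 := ENNReal.div_ne_zero.2 ⟨h0, hDT⟩
  have hdT : lam / D ≠ ∞ := ENNReal.div_ne_top hT hD0
  calc lam * volume {x | lam < posMaximal μ g x}
      ≤ lam * (4 ^ n * (∫⁻ y, g y) / (lam / D)) := by
        gcongr
        exact (measure_mono hsub).trans (volume_lt_hlMaximal_le g hd0 hdT)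
    _ = 4 ^ n * D * (∫⁻ x, g x) := by
        rw [div_eq_mul_inv, ENNReal.inv_div (Or.inl hDT) (Or.inl hD0), div_eq_mul_inv]
        calc lam * (4 ^ n * (∫⁻ y, g y) * (D * lam⁻¹)) =
            4 ^ n * D * (∫⁻ y, g y) * (lam * lam⁻¹) := by ring
          _ = _ := by rw [ENNReal.mul_inv_cancel h0 hT, mul_one]

/-- The convergence of the averages for functions in `L^{p,1}`: truncate `f` at large and small
heights, and apply the endpoint inequality to the error. -/
theorem LorentzWeakType.hasContinuousAverages [IsFiniteMeasure μ] (hw : LorentzWeakType μ p)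
    (h : RestrictedWeakType μ p) (hp : 0 < p) {f : V → ℂ} (hf : Measurable f)
    (hfL : lorentzNormOne f p volume < ∞) : HasContinuousAverages μ f := by
  obtain ⟨C, hC⟩ := hw
  have hfin : ∀ s : ℝ, 0 < s → volume {x | ENNReal.ofReal s < ‖f x‖ₑ} < ∞ := fun s hs => by
    refine measure_lt_top_of_lorentzNormOne (g := fun x => ‖f x‖ₑ) hp ?_ hs
    simpa [lorentzNormOne] using hfL
  set A : ℕ → Set V := fun m => {x | ENNReal.ofReal (1 / (m + 1)) < ‖f x‖ₑ ∧ ‖f x‖ₑ ≤ m} with hA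
  have hAm : ∀ m, MeasurableSet (A m) := fun m =>
    (measurableSet_lt measurable_const hf.enorm).inter
      (measurableSet_le hf.enorm measurable_const)
  have hF : ∀ m, HasContinuousAverages μ ((A m).indicator f) := by
    intro m
    refine HasContinuousAverages.of_memLp h hp (lt_add_one p) (hf.indicator (hAm m)) ?_
    have hAv : volume (A m) < ∞ :=
      (measure_mono fun x hx => hx.1).trans_lt (hfin (1 / (m + 1)) (by positivity))
    rw [memLp_indicator_iff_restrict (hAm m)]
    have : IsFiniteMeasure (volume.restrict (A m)) := ⟨by simpa using hAv⟩
    refine MemLp.of_bound hf.aestronglyMeasurable m ?_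
    filter_upwards [ae_restrict_mem (hAm m)] with x hx
    have := hx.2
    rw [← ofReal_norm, ENNReal.ofReal_le_natCast] at this
    exact this
  refine HasContinuousAverages.of_tendsto hf hF fun lam h0 hT => ?_
  set g : ℕ → V → ℝ≥0∞ := fun m x => ‖f x - (A m).indicator f x‖ₑ with hg
  have hgm : ∀ m, Measurable (g m) := fun m => (hf.sub (hf.indicator (hAm m))).enorm
  have hgle : ∀ m x, g m x ≤ ‖f x‖ₑ := by
    intro m x
    by_cases hx : x ∈ A m <;> simp [hg, hx]
  have hpt : ∀ s : ℝ, 0 < s → Tendsto (fun m => volume {x | ENNReal.ofReal s < g m x}) atTop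
      (𝓝 0) := by
    intro s hs
    have hlim : Tendsto (fun m : ℕ => volume ({x | ENNReal.ofReal s < ‖f x‖ₑ} ∩
        {x | (m : ℝ≥0∞) < ‖f x‖ₑ})) atTop (𝓝 0) := by
      have hempty : ⋂ m : ℕ, ({x | ENNReal.ofReal s < ‖f x‖ₑ} ∩ {x | (m : ℝ≥0∞) < ‖f x‖ₑ}) =
          ∅ := by
        refine eq_empty_of_forall_notMem fun x hx => ?_
        obtain ⟨m, hm⟩ := ENNReal.exists_nat_gt (enorm_ne_top (x := f x))
        exact absurd (mem_iInter.1 hx m).2 (not_lt.2 hm.le)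
      rw [← measure_empty (μ := (volume : Measure V)), ← hempty]
      refine tendsto_measure_iInter_atTop (fun m => ?_) (fun i j hij => ?_) ⟨0, ?_⟩
      · exact ((measurableSet_lt measurable_const hf.enorm).inter
          (measurableSet_lt measurable_const hf.enorm)).nullMeasurableSet
      · exact inter_subset_inter_right _ fun x hx =>
          lt_of_le_of_lt (by exact_mod_cast hij : (i : ℝ≥0∞) ≤ j) hx
      · exact ((measure_mono inter_subset_left).trans_lt (hfin s hs)).ne
    refine tendsto_of_tendsto_of_tendsto_of_le_of_le' tendsto_const_nhds hlim
      (Eventually.of_forall fun _ => zero_le) ?_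
    have hev : ∀ᶠ m : ℕ in atTop, 1 / ((m : ℝ) + 1) < s :=
      tendsto_one_div_add_atTop_nhds_zero_nat.eventually (gt_mem_nhds hs)
    filter_upwards [hev] with m hm
    refine measure_mono fun x hx => ?_
    have hx : ENNReal.ofReal s < g m x := hx
    have hxf := hx.trans_le (hgle m x)
    refine ⟨hxf, ?_⟩
    by_contra hle
    have hxA : x ∈ A m := ⟨(ENNReal.ofReal_le_ofReal hm.le).trans_lt hxf, not_lt.1 hle⟩
    simp [hg, hxA] at hx
  have hL0 : Tendsto (fun m => lorentzNormOne (g m) p volume) atTop (𝓝 0) := by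
    have h1 : Tendsto (fun m => ∫⁻ s in Ioi (0 : ℝ),
        volume {x | ENNReal.ofReal s < g m x} ^ (1 / p)) atTop
        (𝓝 (∫⁻ s in Ioi (0 : ℝ), 0)) := by
      refine tendsto_lintegral_of_dominated_convergence
        (fun s => volume {x | ENNReal.ofReal s < ‖f x‖ₑ} ^ (1 / p)) (fun m => ?_)
        (fun m => ae_of_all _ fun s => ?_) ?_ ?_
      · refine Antitone.measurable fun s r hsr => ?_
        refine ENNReal.rpow_le_rpow (measure_mono fun x hx => ?_) (by positivity)
        exact lt_of_le_of_lt (ENNReal.ofReal_le_ofReal hsr) hx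
      · refine ENNReal.rpow_le_rpow (measure_mono fun x hx => ?_) (by positivity)
        exact lt_of_lt_of_le hx (hgle m x)
      · intro hT
        unfold lorentzNormOne at hfL
        rw [hT, ENNReal.mul_top (by simpa using hp)] at hfL
        exact absurd hfL (lt_irrefl _)
      · filter_upwards [ae_restrict_mem measurableSet_Ioi] with s hs
        have := (ENNReal.continuous_rpow_const (y := 1 / p)).tendsto 0 |>.comp (hpt s hs)
        rwa [ENNReal.zero_rpow_of_pos (by positivity)] at this
    have h2 := ENNReal.Tendsto.const_mul (a := ENNReal.ofReal p) h1 (Or.inr ENNReal.ofReal_ne_top)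
    simpa [lorentzNormOne] using h2
  have hlim : Tendsto (fun m => (C * lorentzNormOne (g m) p volume / lam) ^ p) atTop (𝓝 0) := by
    have h1 : Tendsto (fun m => C * lorentzNormOne (g m) p volume / lam) atTop (𝓝 0) := by
      have := ENNReal.Tendsto.div_const (ENNReal.Tendsto.const_mul (a := (C : ℝ≥0∞)) hL0
        (Or.inr ENNReal.coe_ne_top)) (Or.inr h0)
      simpa using this
    have h2 := (ENNReal.continuous_rpow_const (y := p)).tendsto 0 |>.comp h1
    rwa [ENNReal.zero_rpow_of_pos hp] at h2
  refine tendsto_of_tendsto_of_tendsto_of_le_of_le tendsto_const_nhds hlim (fun _ => zero_le)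
    fun m => ?_
  have h1 := hC (g m) (hgm m) lam h0 hT
  rw [mul_comm, ← ENNReal.le_div_iff_mul_le (Or.inl h0) (Or.inl hT), one_div,
    ENNReal.rpow_inv_le_iff hp] at h1
  exact h1

end Endpoint

end DilationMaximal

end

noncomputable section

namespace DilationMaximal

open Metric Filter Topology FourierTransform

/-! ### The maximal operator on Euclidean space -/

section Euclidean

variable {d : ℕ} {μ : Measure (EuclideanSpace ℝ (Fin d))} {p : ℝ}

theorem measureFourier_eq_fourierMeasure (μ : Measure (EuclideanSpace ℝ (Fin d)))
    (ξ : EuclideanSpace ℝ (Fin d)) : measureFourier μ ξ = fourierMeasure μ ξ := by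
  unfold measureFourier fourierMeasure
  congr 1 with y
  rw [Real.fourierChar_apply]
  congr 1
  push_cast
  ring

theorem isFiniteMeasure_of_isFrostman {b : ℝ} (hsupp : IsCompact μ.support)
    (hdim : IsFrostman μ b) : IsFiniteMeasure μ := by
  obtain ⟨R, hR⟩ := hsupp.isBounded.subset_ball 0
  obtain ⟨C, hC⟩ := hdim
  refine ⟨?_⟩
  calc μ univ = μ (μ.support ∪ μ.supportᶜ) := by rw [union_compl_self]
    _ ≤ μ μ.support + μ μ.supportᶜ := measure_union_le _ _
    _ ≤ μ (ball 0 (max R 1)) + 0 := by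
        rw [Measure.measure_compl_support]
        gcongr
        exact hR.trans (ball_subset_ball (le_max_left _ _))
    _ < ∞ := by
        rw [add_zero]
        exact (hC 0 _ (by positivity)).trans_lt ENNReal.ofReal_lt_top

/-- Near the origin the decay hypothesis is replaced by the boundedness of the Fourier transform
of a finite measure. -/
theorem HasFourierDecay.exists_norm_fourierMeasure_le [IsFiniteMeasure μ] {a : ℝ} (ha : 0 < a)
    (h : HasFourierDecay μ a) : ∃ C : ℝ, ∀ ξ, ‖fourierMeasure μ ξ‖ ≤ C * (1 + ‖ξ‖) ^ (-a) := by
  obtain ⟨C, hC⟩ := h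
  refine ⟨(μ.real univ + |C|) * 2 ^ a, fun ξ => ?_⟩
  have h2 : ∀ r : ℝ, 0 < r → 1 + ‖ξ‖ ≤ 2 * r → r ^ (-a) ≤ 2 ^ a * (1 + ‖ξ‖) ^ (-a) := by
    intro r hr hle
    calc r ^ (-a) = 2 ^ a * (2 * r) ^ (-a) := by
          rw [Real.mul_rpow (by norm_num) hr.le, ← mul_assoc, ← Real.rpow_add (by norm_num)]
          simp
      _ ≤ _ := by
          gcongr ?_ * ?_
          exact Real.rpow_le_rpow_of_nonpos (by positivity) hle (by linarith)
  have h3 : 0 ≤ (2 : ℝ) ^ a * (1 + ‖ξ‖) ^ (-a) := by positivity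
  rw [mul_assoc]
  rcases le_or_gt ‖ξ‖ 1 with hξ | hξ
  · have := h2 1 one_pos (by linarith)
    rw [Real.one_rpow] at this
    calc ‖fourierMeasure μ ξ‖ ≤ μ.real univ * 1 := by
          rw [mul_one]; exact norm_fourierMeasure_le μ ξ
      _ ≤ _ := by
          gcongr
          exact le_add_of_nonneg_right (abs_nonneg C)
  · have hξ0 : 0 < ‖ξ‖ := by linarith
    rw [← measureFourier_eq_fourierMeasure]
    calc ‖measureFourier μ ξ‖ ≤ C * ‖ξ‖ ^ (-a) := hC ξ (norm_pos_iff.1 hξ0)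
      _ ≤ (μ.real univ + |C|) * ‖ξ‖ ^ (-a) := by
          gcongr
          exact (le_abs_self C).trans (le_add_of_nonneg_left measureReal_nonneg)
      _ ≤ _ := by
          gcongr
          exact h2 _ hξ0 (by linarith)

theorem convMeasure_dilate (μ : Measure (EuclideanSpace ℝ (Fin d)))
    (f : EuclideanSpace ℝ (Fin d) → ℂ) {t : ℝ} (ht : 0 < t) (x : EuclideanSpace ℝ (Fin d)) :
    convMeasure f (dilate μ t) x = ∫ y, f (x - t • y) ∂μ :=
  integral_map_equiv (Homeomorph.smulOfNeZero t ht.ne').toMeasurableEquiv fun y => f (x - y)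

theorem integrable_dilate_iff (μ : Measure (EuclideanSpace ℝ (Fin d)))
    (f : EuclideanSpace ℝ (Fin d) → ℂ) {t : ℝ} (ht : 0 < t) (x : EuclideanSpace ℝ (Fin d)) :
    Integrable (fun y => f (x - y)) (dilate μ t) ↔ Integrable (fun y => f (x - t • y)) μ :=
  integrable_map_equiv (Homeomorph.smulOfNeZero t ht.ne').toMeasurableEquiv fun y => f (x - y)

theorem maximalFn_eq_iSup (μ : Measure (EuclideanSpace ℝ (Fin d)))
    (f : EuclideanSpace ℝ (Fin d) → ℂ) :
    maximalFn μ f = fun x => ⨆ (t : ℝ) (_ : 0 < t), ‖∫ y, f (x - t • y) ∂μ‖ₑ := by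
  ext x
  unfold maximalFn
  congr 1 with t
  congr 1 with ht
  rw [convMeasure_dilate μ f ht]

theorem RestrictedWeakType.maximalFn_ae_eq (h : RestrictedWeakType μ p)
    {f g : EuclideanSpace ℝ (Fin d) → ℂ} (hfg : f =ᵐ[volume] g) :
    maximalFn μ f =ᵐ[volume] maximalFn μ g := by
  filter_upwards [h.ae_forall_ae_of_ae hfg] with x hx
  simp only [maximalFn_eq_iSup]
  congr 1 with t
  congr 1 with ht
  rw [integral_congr_ae (hx t ht)]

theorem maximalFn_le_posMaximal (μ : Measure (EuclideanSpace ℝ (Fin d)))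
    (f : EuclideanSpace ℝ (Fin d) → ℂ) (x : EuclideanSpace ℝ (Fin d)) :
    maximalFn μ f x ≤ posMaximal μ (fun y => ‖f y‖ₑ) x := by
  rw [maximalFn_eq_iSup]
  refine iSup₂_le fun t ht => (enorm_integral_le_lintegral_enorm _).trans ?_
  exact lintegral_le_posMaximal μ (fun y => ‖f y‖ₑ) x ht

/-- The maximal function is well defined and measurable for every function which agrees almost
everywhere with one that has continuous averages. -/
theorem RestrictedWeakType.maximalFn_definedAE [SFinite μ] (h : RestrictedWeakType μ p)
    {f g : EuclideanSpace ℝ (Fin d) → ℂ} (hg : Measurable g) (hfg : f =ᵐ[volume] g)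
    (hc : HasContinuousAverages μ g) :
    MaximalFnDefinedAE μ f ∧ AEMeasurable (maximalFn μ f) volume := by
  constructor
  · filter_upwards [hc.congr h hfg.symm] with x hx t ht
    exact (integrable_dilate_iff μ f ht x).2 (hx.1 t ht)
  · refine AEMeasurable.congr ?_ (h.maximalFn_ae_eq hfg).symm
    rw [maximalFn_eq_iSup]
    exact hc.aemeasurable_iSup hg

theorem RestrictedWeakType.eLpNorm_maximalFn_top_le [IsFiniteMeasure μ]
    (h : RestrictedWeakType μ p) (f : EuclideanSpace ℝ (Fin d) → ℂ) :
    eLpNorm (maximalFn μ f) ∞ volume ≤ μ univ * eLpNorm f ∞ volume := by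
  rw [eLpNorm_exponent_top, eLpNorm_exponent_top]
  refine essSup_le_of_ae_le _ ?_
  filter_upwards [h.ae_forall_ae_of_ae (ae_le_eLpNormEssSup (f := f))] with x hx
  rw [enorm_eq_self, maximalFn_eq_iSup]
  refine iSup₂_le fun t ht => (enorm_integral_le_lintegral_enorm _).trans ?_
  rw [mul_comm, ← lintegral_const]
  exact lintegral_mono_ae (hx t ht)

/-- The strong-type inequality above the critical exponent. -/
theorem RestrictedWeakType.exists_eLpNorm_maximalFn_le [IsFiniteMeasure μ]
    (h : RestrictedWeakType μ p) (hp : 0 < p) {s : ℝ} (hps : p < s) :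
    ∃ C : ℝ≥0, ∀ f : EuclideanSpace ℝ (Fin d) → ℂ, AEStronglyMeasurable f volume →
      AEMeasurable (maximalFn μ f) volume →
      eLpNorm (maximalFn μ f) (ENNReal.ofReal s) volume ≤
        C * eLpNorm f (ENNReal.ofReal s) volume := by
  obtain ⟨q, hpq, hqs⟩ := exists_between hps
  have hq : 0 < q := hp.trans hpq
  have hs : 0 < s := hq.trans hqs
  obtain ⟨C, c, hC⟩ := h.exists_volume_lt_le_tsum hp hpq
  set K : ℝ≥0∞ := C * (2 ^ s * (1 - 2 ^ (-(s - q)))⁻¹ * (1 - 2 ^ (-s))⁻¹) * (c : ℝ≥0∞) ^ s with hK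
  have hKT : K ≠ ∞ := by
    have h2 : (2 : ℝ≥0∞) ^ s ≠ ∞ := ENNReal.rpow_ne_top_of_nonneg hs.le (by norm_num)
    exact ENNReal.mul_ne_top (ENNReal.mul_ne_top ENNReal.coe_ne_top (ENNReal.mul_ne_top
      (ENNReal.mul_ne_top h2 (one_sub_two_rpow_neg_inv_ne_top (sub_pos.2 hqs)))
      (one_sub_two_rpow_neg_inv_ne_top hs)))
      (ENNReal.rpow_ne_top_of_nonneg hs.le ENNReal.coe_ne_top)
  have hKT' : K ^ (1 / s) ≠ ∞ := ENNReal.rpow_ne_top_of_nonneg (by positivity) hKT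
  refine ⟨(K ^ (1 / s)).toNNReal, fun f hf hM => ?_⟩
  rw [ENNReal.coe_toNNReal hKT']
  set g := hf.mk f with hg
  have hgm : Measurable g := hf.stronglyMeasurable_mk.measurable
  have hfg : f =ᵐ[volume] g := hf.ae_eq_mk
  have hint : ∫⁻ x, maximalFn μ f x ^ s ≤ K * ∫⁻ x, ‖g x‖ₑ ^ s := by
    refine (lintegral_rpow_le_of_measure_lt_le hM
      (hgm.enorm.const_mul (c : ℝ≥0∞)).aemeasurable (C := C) hq.le hqs fun m => ?_).trans
      (le_of_eq ?_)
    · refine le_trans (measure_mono_ae ?_) (hC (fun y => ‖g y‖ₑ) hgm.enorm (2 ^ m)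
        (ENNReal.zpow_pos (by norm_num) (by norm_num) m).ne'
        (ENNReal.zpow_ne_top (by norm_num) (by norm_num) m))
      filter_upwards [h.maximalFn_ae_eq hfg] with x hx hlt
      have hlt : 2 ^ m < maximalFn μ f x := hlt
      rw [hx] at hlt
      exact hlt.trans_le (maximalFn_le_posMaximal μ g x)
    · simp_rw [ENNReal.mul_rpow_of_nonneg _ _ hs.le]
      rw [lintegral_const_mul _ (hgm.enorm.pow_const s), hK]
      ring
  rw [eLpNorm_congr_ae hfg, eLpNorm_eq_lintegral_rpow_enorm_toReal (by simpa using hs)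
    ENNReal.ofReal_ne_top, eLpNorm_eq_lintegral_rpow_enorm_toReal (by simpa using hs)
    ENNReal.ofReal_ne_top, ENNReal.toReal_ofReal hs.le,
    ← ENNReal.mul_rpow_of_nonneg _ _ (by positivity)]
  simp only [enorm_eq_self]
  exact ENNReal.rpow_le_rpow hint (by positivity)

theorem lorentzNormOne_congr_ae {f g : EuclideanSpace ℝ (Fin d) → ℂ} (hfg : f =ᵐ[volume] g) :
    lorentzNormOne f p volume = lorentzNormOne g p volume := by
  unfold lorentzNormOne
  congr 2 with s
  congr 1
  refine measure_congr ?_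
  filter_upwards [hfg] with x hx
  show (ENNReal.ofReal s < ‖f x‖ₑ) = (ENNReal.ofReal s < ‖g x‖ₑ)
  rw [hx]

theorem LorentzWeakType.exists_lorentzNormTop_maximalFn_le (hw : LorentzWeakType μ p)
    (h : RestrictedWeakType μ p) (hp : 0 < p) :
    ∃ C : ℝ≥0, ∀ f : EuclideanSpace ℝ (Fin d) → ℂ, AEStronglyMeasurable f volume →
      lorentzNormTop (maximalFn μ f) p volume ≤ C * lorentzNormOne f p volume := by
  obtain ⟨C, hC⟩ := hw
  refine ⟨C, fun f hf => ?_⟩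
  have hgm : Measurable (hf.mk f) := hf.stronglyMeasurable_mk.measurable
  have hfg : f =ᵐ[volume] hf.mk f := hf.ae_eq_mk
  refine iSup₂_le fun s hs => ?_
  have h1 := hC (fun y => ‖hf.mk f y‖ₑ) hgm.enorm (ENNReal.ofReal s) (by simpa using hs)
    ENNReal.ofReal_ne_top
  have h2 : lorentzNormOne (fun y => ‖hf.mk f y‖ₑ) p volume = lorentzNormOne f p volume := by
    rw [lorentzNormOne_congr_ae hfg]
    simp [lorentzNormOne]
  rw [h2] at h1
  refine le_trans (mul_le_mul_right (ENNReal.rpow_le_rpow (measure_mono_ae ?_) (by positivity)) _)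
    h1
  filter_upwards [h.maximalFn_ae_eq hfg] with x hx hlt
  have hlt : ENNReal.ofReal s < ‖maximalFn μ f x‖ₑ := hlt
  rw [enorm_eq_self, hx] at hlt
  exact hlt.trans_le (maximalFn_le_posMaximal μ _ x)

end Euclidean

end DilationMaximal

end
theorem theorem1p3 (d : ℕ) (hd : 1 ≤ d) (a b : ℝ) (ha : 1 / 2 < a)
    (hb : (d : ℝ) - 1 < b) (hbd : b ≤ d)
    (μ : Measure (EuclideanSpace ℝ (Fin d))) (hsupp : IsCompact μ.support)
    (hdecay : DilationMaximal.HasFourierDecay μ a) (hdim : DilationMaximal.IsFrostman μ b) :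
    (∀ p : ℝ≥0∞, ENNReal.ofReal (DilationMaximal.critExp d a b) < p →
      ∃ C : ℝ≥0, ∀ f : EuclideanSpace ℝ (Fin d) → ℂ, MemLp f p volume →
        DilationMaximal.MaximalFnDefinedAE μ f ∧
        AEMeasurable (DilationMaximal.maximalFn μ f) volume ∧
        eLpNorm (DilationMaximal.maximalFn μ f) p volume ≤ C * eLpNorm f p volume) ∧
    (∃ C : ℝ≥0, ∀ f : EuclideanSpace ℝ (Fin d) → ℂ, AEStronglyMeasurable f volume →
      DilationMaximal.lorentzNormOne f (DilationMaximal.critExp d a b) volume < ∞ →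
        DilationMaximal.MaximalFnDefinedAE μ f ∧
        AEMeasurable (DilationMaximal.maximalFn μ f) volume ∧
        DilationMaximal.lorentzNormTop (DilationMaximal.maximalFn μ f)
            (DilationMaximal.critExp d a b) volume ≤
          C * DilationMaximal.lorentzNormOne f (DilationMaximal.critExp d a b) volume) := by
  have hfin : IsFiniteMeasure μ :=
    DilationMaximal.isFiniteMeasure_of_isFrostman hsupp hdim
  obtain ⟨C₀, hC₀⟩ := hdecay.exists_norm_fourierMeasure_le (by linarith)
  obtain ⟨C, hC⟩ := hdim
  have hF : ∀ x r, 0 < r → μ (Metric.ball x r) ≤ ENNReal.ofReal (|C| * r ^ b) := by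
    intro x r hr
    refine (hC x r hr).trans (ENNReal.ofReal_le_ofReal ?_)
    gcongr
    exact le_abs_self C
  obtain ⟨R, hR0, hR⟩ : ∃ R : ℝ, 0 < R ∧ μ (Metric.closedBall 0 R)ᶜ = 0 := by
    obtain ⟨R, hR⟩ := hsupp.isBounded.subset_closedBall 0
    refine ⟨max R 1, by positivity, measure_mono_null ?_ Measure.measure_compl_support⟩
    exact compl_subset_compl.2 (hR.trans (Metric.closedBall_subset_closedBall (le_max_left _ _)))
  have hn : Module.finrank ℝ (EuclideanSpace ℝ (Fin d)) = d := finrank_euclideanSpace_fin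
  set p := DilationMaximal.critExp d a b with hpdef
  have hrw : DilationMaximal.RestrictedWeakType μ p := by
    have := DilationMaximal.restrictedWeakType_of_decay μ hR0 hR ha (by rwa [hn]) hC₀
      (abs_nonneg C) hF
    rwa [hn] at this
  have hγ : 0 < (d : ℝ) - b + 2 * a - 1 := by linarith
  have hpeq : p = 1 + (d - b) / ((d : ℝ) - b + 2 * a - 1) := by
    rw [hpdef, DilationMaximal.critExp]
    field_simp
    ring
  have hp1 : 1 ≤ p := by
    rw [hpeq]
    have : 0 ≤ (d - b) / ((d : ℝ) - b + 2 * a - 1) := div_nonneg (by linarith) hγ.le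
    linarith
  have hp0 : 0 < p := by linarith
  refine ⟨fun q hq => ?_, ?_⟩
  · rcases eq_or_ne q ∞ with rfl | hqT
    · refine ⟨(μ univ).toNNReal, fun f hf => ?_⟩
      have hg := hf.1.stronglyMeasurable_mk.measurable
      have hM := hrw.maximalFn_definedAE hg hf.1.ae_eq_mk
        (DilationMaximal.HasContinuousAverages.of_memLp_top
        hrw hp0 (lt_add_one p) hR hg ((memLp_congr_ae hf.1.ae_eq_mk).1 hf))
      refine ⟨hM.1, hM.2, ?_⟩
      rw [ENNReal.coe_toNNReal (measure_ne_top μ _)]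
      exact hrw.eLpNorm_maximalFn_top_le f
    · lift q to ℝ≥0 using hqT
      have hps : p < (q : ℝ) := by
        rw [← ENNReal.ofReal_coe_nnreal, ENNReal.ofReal_lt_ofReal_iff_of_nonneg hp0.le] at hq
        exact hq
      obtain ⟨C', hC'⟩ := hrw.exists_eLpNorm_maximalFn_le hp0 hps
      rw [ENNReal.ofReal_coe_nnreal] at hC'
      refine ⟨C', fun f hf => ?_⟩
      have hg := hf.1.stronglyMeasurable_mk.measurable
      have hM := hrw.maximalFn_definedAE hg hf.1.ae_eq_mk
        (DilationMaximal.HasContinuousAverages.of_memLp hrw hp0 hps hg (by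
          rw [ENNReal.ofReal_coe_nnreal]
          exact (memLp_congr_ae hf.1.ae_eq_mk).1 hf))
      exact ⟨hM.1, hM.2, hC' f hf.1 hM.2⟩
  · have hw : DilationMaximal.LorentzWeakType μ p := by
      -- `p = 1` forces `b = d`
      rcases hp1.eq_or_lt with h1 | h1
      · have hb' : b = d := by
          rw [hpeq, left_eq_add, div_eq_zero_iff, or_iff_left hγ.ne'] at h1
          linarith
        rw [← h1]
        refine DilationMaximal.lorentzWeakType_one hR0 hR (abs_nonneg C) fun x r hr => ?_
        rw [hn, ← Real.rpow_natCast, ← hb']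
        exact hF x r hr
      · exact hrw.lorentzWeakType h1
    obtain ⟨C', hC'⟩ := hw.exists_lorentzNormTop_maximalFn_le hrw hp0
    refine ⟨C', fun f hf hfL => ?_⟩
    have hg := hf.stronglyMeasurable_mk.measurable
    have hM := hrw.maximalFn_definedAE hg hf.ae_eq_mk (hw.hasContinuousAverages hrw hp0 hg
      (by rwa [← DilationMaximal.lorentzNormOne_congr_ae hf.ae_eq_mk]))
    exact ⟨hM.1, hM.2, hC' f hf⟩
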